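/- All schemes and morphisms are over $\mathbb C$. Let $X$ be a locally Noetherian scheme, let $Y$ be proper over $\mathbb C$ (e.g. projective), let $r\ge 0$, and let $\mathrm{pr}_1,\mathrm{pr}_2$ be the projections of $X\times Y$. *Morphisms.* Let $\mathcal E$ be a locally free $\mathcal O_X$-module of rank $r$ and $\mathcal O_X^{Az}=\mathcal{E}nd_{\mathcal O_X}(\mathcal E)$. Consider pairs $(\mathcal A,f)$ of a commutative quasi-coherent $\mathcal O_X$-subalgebra $\mathcal A\subset\mathcal O_X^{Az}$ and a morphism $f:X_{\mathcal A}:=\mathbf{Spec}_X\mathcal A\to Y$. A pair $(\mathcal A',f')$ refines $(\mathcal A,f)$ if $\mathcal A'\subset\mathcal A$ and $f$ is the composition $X_{\mathcal A}\to X_{\mathcal A'}\xrightarrow{f'}Y$. Two pairs are equivalent if some third pair refines both, and a *morphism* $\varphi:(X^{Az},\mathcal E)\to Y$ is an equivalence class of pairs (for the equivalence relation generated by this). A *canonical presentation* $(\mathcal A_\varphi,f_\varphi)$ of $\varphi$ is a pair in $\varphi$ that refines every pair in $\varphi$; write $X_\varphi=\mathbf{Spec}_X\mathcal A_\varphi$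 (the surrogate) and $\pi_\varphi:X_\varphi\to X$. An isomorphism $e:\mathcal E_1\cong\mathcal E_2$ is an isomorphism from $\varphi_1:(X^{Az},\mathcal E_1)\to Y$ to $\varphi_2:(X^{Az},\mathcal E_2)\to Y$ (over $\mathrm{id}_X$) if conjugation by $e$ maps $\mathcal A_{\varphi_1}$ onto $\mathcal A_{\varphi_2}$ and the induced morphism $X_{\varphi_2}\to X_{\varphi_1}$ is compatible with $f_{\varphi_2}$ and $f_{\varphi_1}$. *Sheaves.* A coherent $\mathcal O_{X\times Y}$-module $\widetilde{\mathcal E}$ is *flat over $X$ of relative length $r$* if all stalks $\widetilde{\mathcal E}_z$ are flat over $\mathcal O_{X,\mathrm{pr}_1(z)}$ and, for every $x\in X$, the restriction of $\widetilde{\mathcal E}$ to the fibre over $x$ is zero-dimensional of length $r$ over $\kappa(x)$, i.e. $\sum_{\mathrm{pr}_1(z)=x}\dim_{\kappa(x)}\big(\kappa(x)\otimes_{\mathcal O_{X,x}}\widetilde{\mathcal E}_z\big)=r$. A pair $(\widetilde{\mathcal E},\theta)$ with $\theta:\mathrm{pr}_{1*}\widetilde{\mathcal E}\cong\mathcal E$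 *corresponds* to $\varphi:(X^{Az},\mathcal E)\to Y$ if, compatibly with $\theta$, $\widetilde{\mathcal E}\cong(\pi_\varphi,f_\varphi)_*({}_{\mathcal O_{X_\varphi}}\mathcal E)$, where ${}_{\mathcal O_{X_\varphi}}\mathcal E$ is $\mathcal E$ regarded as an $\mathcal O_{X_\varphi}$-module through $\mathcal A_\varphi\subset\mathcal{E}nd_{\mathcal O_X}(\mathcal E)$. **Lemma.** Giving a morphism $(X^{Az},\mathcal E)\to Y$ is equivalent to giving a coherent $\mathcal O_{X\times Y}$-module that is flat over $X$ of relative length $r$. Precisely: 1. If $\widetilde{\mathcal E}$ is a coherent $\mathcal O_{X\times Y}$-module, flat over $X$ of relative length $r$, then $\mathrm{pr}_{1*}\widetilde{\mathcal E}$ is locally free of rank $r$. 2. Let $\mathcal E$ be locally free of rank $r$ on $X$. - (a) Every morphism $\varphi:(X^{Az},\mathcal E)\to Y$ has a unique canonical presentation. - (b) Every such $\varphi$ corresponds to some $(\widetilde{\mathcal E},\theta)$. - (c) Whenever $(\widetilde{\mathcal E},\theta)$ corresponds to $\varphi$, $\widetilde{\mathcal E}$ is coherent, flat over $X$ of relative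 length $r$, and there is an isomorphism from $X_\varphi$ to the scheme-theoretic support $\mathrm{Supp}\,\widetilde{\mathcal E}$ under which $\pi_\varphi$ and $f_\varphi$ are the restrictions of $\mathrm{pr}_1$ and $\mathrm{pr}_2$. - (d) Conversely, if $\widetilde{\mathcal E}$ is coherent, flat over $X$ of relative length $r$, and $\theta:\mathrm{pr}_{1*}\widetilde{\mathcal E}\cong\mathcal E$, then $(\widetilde{\mathcal E},\theta)$ corresponds to exactly one morphism $\varphi:(X^{Az},\mathcal E)\to Y$. 3. If $(\widetilde{\mathcal E}_i,\theta_i)$ corresponds to $\varphi_i:(X^{Az},\mathcal E_i)\to Y$ for $i=1,2$, with $\mathcal E_1,\mathcal E_2$ locally free of rank $r$, then $g\mapsto\theta_2\circ\mathrm{pr}_{1*}g\circ\theta_1^{-1}$ is a bijection from the isomorphisms $g:\widetilde{\mathcal E}_1\cong\widetilde{\mathcal E}_2$ to the isomorphisms from $\varphi_1$ to $\varphi_2$ over $\mathrm{id}_X$. In particular $(\widetilde{\mathcal E},\theta)$ in (b) is unique up to a unique isomorphism. -/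

import Mathlib

open CategoryTheory CategoryTheory.Limits AlgebraicGeometry TensorProduct

universe u

noncomputable section

namespace AzumayaBrane

/-! ### Coherent, locally free and relatively finite-length sheaves -/

section Sheaves

variable {Z X : Scheme.{u}}

/-- A coherent sheaf on a (locally Noetherian) scheme: quasi-coherent, with finitely generated
modules of sections over all affine opens. -/
def IsCoherent (F : Z.Modules) : Prop :=
  SheafOfModules.IsQuasicoherent.{u} F ∧
    ∀ W : Z.Opens, IsAffineOpen W → Module.Finite Γ(Z, W) Γ(F, W)

/-- Locally free of rank `r`: locally isomorphic to `𝒪^r`. -/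
def IsLocallyFreeOfRank (E : X.Modules) (r : ℕ) : Prop :=
  ∀ x : X, ∃ U : X.Opens, x ∈ U ∧
    Nonempty ((E.restrict U.ι : U.toScheme.Modules) ≅
      (SheafOfModules.free (ULift.{u} (Fin r)) : SheafOfModules.{u} U.toScheme.ringCatSheaf))

/-- The stalk of an `𝒪_Z`-module `F` at `z`, to be viewed over the local ring of `X` at `f z`. -/
def StalkOver (_f : Z ⟶ X) (F : Z.Modules) (z : Z) : Type u :=
  ↑(TopCat.Presheaf.stalk F.presheaf z)

instance (f : Z ⟶ X) (F : Z.Modules) (z : Z) : AddCommGroup (StalkOver f F z) :=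
  inferInstanceAs (AddCommGroup ↑(TopCat.Presheaf.stalk F.presheaf z))

/-- The `𝒪_{Z,z}`-module structure on the stalk `F_z`. -/
abbrev stalkModule (f : Z ⟶ X) (F : Z.Modules) (z : Z) :
    Module (Z.presheaf.stalk z) (StalkOver f F z) :=
  letI F' : PresheafOfModules.{u} ((Z.presheaf : TopCat.Presheaf CommRingCat.{u} Z) ⋙
    forget₂ CommRingCat.{u} RingCat.{u}) := F.val
  inferInstanceAs (Module ↑(TopCat.Presheaf.stalk (C := CommRingCat.{u}) Z.presheaf z)
    ↑(TopCat.Presheaf.stalk (C := Ab.{u}) F'.presheaf z))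

/-- The `𝒪_{X,f(z)}`-module structure on the stalk `F_z`, through `𝒪_{X,f(z)} ⟶ 𝒪_{Z,z}`. -/
instance (f : Z ⟶ X) (F : Z.Modules) (z : Z) :
    Module (X.presheaf.stalk (f z)) (StalkOver f F z) :=
  letI := stalkModule f F z
  Module.compHom _ (f.stalkMap z).hom

/-- `F` is flat over `X`. -/
def IsFlatOver (f : Z ⟶ X) (F : Z.Modules) : Prop :=
  ∀ z : Z, Module.Flat (X.presheaf.stalk (f z)) (StalkOver f F z)

/-- The length, over the residue field `κ(x)` of `x = f z`, of the stalk at `z` of the restriction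
of `F` to the fibre of `f` over `x`, which is `κ(x) ⊗ F_z`. -/
def fibreLengthAt (f : Z ⟶ X) (F : Z.Modules) (z : Z) : ℕ∞ :=
  Module.length (IsLocalRing.ResidueField (X.presheaf.stalk (f z)))
    (IsLocalRing.ResidueField (X.presheaf.stalk (f z)) ⊗[X.presheaf.stalk (f z)] StalkOver f F z)

/-- `F` has relative length `r` over `X`: for every `x`, the lengths over `κ(x)` of the stalks of
the restriction of `F` to the fibre over `x` add up to `r`. In particular only finitely many of
these stalks are nonzero, and the restriction is zero-dimensional. -/
def HasRelativeLength (f : Z ⟶ X) (F : Z.Modules) (r : ℕ) : Prop :=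
  ∀ x : X, (⨆ s : Finset {z : Z // f z = x}, ∑ z ∈ s, fibreLengthAt f F z.1) = (r : ℕ∞)

/-- A coherent sheaf on `Z`, flat over `X` of relative length `r`. -/
structure IsFlatFamily (f : Z ⟶ X) (F : Z.Modules) (r : ℕ) : Prop where
  coherent : IsCoherent F
  flat : IsFlatOver f F
  length : HasRelativeLength f F r

/-- The annihilator ideal sheaf of `F`, whose sections over an affine open `W` annihilate
`Γ(F, W)` (the largest quasi-coherent ideal sheaf with this property). -/
def annihilator (F : Z.Modules) : Z.IdealSheafData :=
  Scheme.IdealSheafData.ofIdeals fun W => Module.annihilator Γ(Z, W.1) Γ(F, W.1)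

/-- The scheme-theoretic support of `F`. -/
abbrev schemeSupport (F : Z.Modules) : Scheme.{u} := (annihilator F).subscheme

/-- The closed immersion of the scheme-theoretic support. -/
abbrev schemeSupportι (F : Z.Modules) : schemeSupport F ⟶ Z := (annihilator F).subschemeι

end Sheaves

/-! ### The sheaf of algebras `𝒪_X^{Az} = ℰnd(E)` -/

section EndSheaf

variable {X : Scheme.{u}}

/-- Restriction of sections of an `𝒪_X`-module. -/
abbrev resSec (E : X.Modules) {V W : X.Opens} (h : W ≤ V) (m : Γ(E, V)) : Γ(E, W) :=
  E.presheaf.map (homOfLE h).op m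

/-- Restriction of functions. -/
abbrev resFun {V W : X.Opens} (h : W ≤ V) : Γ(X, V) →+* Γ(X, W) :=
  (X.presheaf.map (homOfLE h).op).hom

/-- The ring of sections over `U` of `ℰnd(E)`: families of `𝒪(V)`-linear endomorphisms of
`Γ(E, V)` for `V ⊆ U`, compatible with restriction. -/
def EndOn (E : X.Modules) (U : X.Opens) :
    Subring (∀ V : {V : X.Opens // V ≤ U}, Module.End Γ(X, V.1) Γ(E, V.1)) where
  carrier := {s | ∀ (V W : {V : X.Opens // V ≤ U}) (h : W.1 ≤ V.1) (m : Γ(E, V.1)),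
    s W (resSec E h m) = resSec E h (s V m)}
  mul_mem' := fun {a b} ha hb V W h m => by
    change a W (b W _) = _
    rw [hb V W h, ha V W h]; rfl
  one_mem' := fun V W h m => rfl
  add_mem' := fun {a b} ha hb V W h m => by
    change a W _ + b W _ = _
    rw [hb V W h, ha V W h, ← map_add]; rfl
  zero_mem' := fun V W h m => (map_zero (E.presheaf.map (homOfLE h).op).hom).symm
  neg_mem' := fun {a} ha V W h m => by
    change - (a W _) = _
    rw [ha V W h]
    exact (map_neg (E.presheaf.map (homOfLE h).op).hom _).symm

/-- Restriction of sections of `ℰnd(E)`. -/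
def EndOn.res (E : X.Modules) {U U' : X.Opens} (h : U' ≤ U) : EndOn E U →+* EndOn E U' where
  toFun s := ⟨fun V => s.1 ⟨V.1, V.2.trans h⟩, fun V W hVW m =>
    s.2 ⟨V.1, V.2.trans h⟩ ⟨W.1, W.2.trans h⟩ hVW m⟩
  map_one' := rfl
  map_mul' _ _ := rfl
  map_zero' := rfl
  map_add' _ _ := rfl

/-- The structure map `𝒪_X ⟶ ℰnd(E)`, on sections over `U`. -/
def EndOn.scalar (E : X.Modules) (U : X.Opens) : Γ(X, U) →+* EndOn E U :=
  (RingHom.pi fun V : {V : X.Opens // V ≤ U} =>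
    (algebraMap Γ(X, V.1) (Module.End Γ(X, V.1) Γ(E, V.1))).comp (resFun V.2)).codRestrict
    (EndOn E U) fun a V W h m => by
      change resFun W.2 a • resSec E h m = resSec E h (resFun V.2 a • m)
      have e : resFun W.2 a = resFun h (resFun V.2 a) := by
        change _ = (X.presheaf.map (homOfLE V.2).op ≫ X.presheaf.map (homOfLE h).op).hom a
        rw [← Functor.map_comp]; rfl
      rw [e]
      exact (E.map_smul (homOfLE h) (resFun V.2 a) m).symm

/-- The action of a morphism of `𝒪_X`-modules on sections over `V`, as a linear map. -/
def appLin {E₁ E₂ : X.Modules} (g : E₁ ⟶ E₂) (V : X.Opens) :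
    Γ(E₁, V) →ₗ[Γ(X, V)] Γ(E₂, V) where
  toFun := g.app V
  map_add' := map_add (g.app V).hom
  map_smul' := g.app_smul

/-- Conjugation by an isomorphism `e : E₁ ≅ E₂`, as a map `ℰnd(E₁) ⟶ ℰnd(E₂)` on sections. -/
def EndOn.conj {E₁ E₂ : X.Modules} (e : E₁ ≅ E₂) (U : X.Opens) : EndOn E₁ U →+* EndOn E₂ U where
  toFun s := ⟨fun V => appLin e.hom V.1 ∘ₗ s.1 V ∘ₗ appLin e.inv V.1, fun V W h m => by
    have nat {A B : X.Modules} (g : A ⟶ B) (m : Γ(A, V.1)) :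
        g.app W.1 (resSec A h m) = resSec B h (g.app V.1 m) :=
      congr($(g.mapPresheaf.naturality (homOfLE h).op) m)
    change e.hom.app W.1 (s.1 W (e.inv.app W.1 (resSec E₂ h m))) =
      resSec E₂ h (e.hom.app V.1 (s.1 V (e.inv.app V.1 m)))
    rw [nat e.inv, s.2 V W h, nat e.hom]⟩
  map_one' := by
    apply Subtype.ext; funext V; ext m
    change (e.inv ≫ e.hom).app V.1 m = m
    rw [e.inv_hom_id]; rfl
  map_mul' s t := by
    apply Subtype.ext; funext V; ext m
    change e.hom.app V.1 (s.1 V (t.1 V (e.inv.app V.1 m))) =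
      e.hom.app V.1 (s.1 V ((e.hom ≫ e.inv).app V.1 (t.1 V (e.inv.app V.1 m))))
    rw [e.hom_inv_id]; rfl
  map_zero' := by
    apply Subtype.ext; funext V; ext m
    exact map_zero (e.hom.app V.1).hom
  map_add' s t := by
    apply Subtype.ext; funext V; ext m
    exact map_add (e.hom.app V.1).hom _ _

end EndSheaf

/-! ### Commutative `𝒪_X`-subalgebras of `𝒪_X^{Az}` and their relative spectra -/

section Surrogate

variable {X : Scheme.{u}}

/-- A subsheaf of commutative subrings of `ℰnd(E)` containing the image of `𝒪_X`, that is, a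
commutative `𝒪_X`-subalgebra. -/
structure CommSubsheaf (E : X.Modules) where
  /-- the sections over `U` -/
  obj (U : X.Opens) : Subring (EndOn E U)
  res_mem {U V : X.Opens} (h : V ≤ U) {s : EndOn E U} : s ∈ obj U → EndOn.res E h s ∈ obj V
  mem_of_locally {U : X.Opens} (s : EndOn E U) :
    (∀ x ∈ U, ∃ (V : X.Opens) (h : V ≤ U), x ∈ V ∧ EndOn.res E h s ∈ obj V) → s ∈ obj U
  scalar_mem (U : X.Opens) (a : Γ(X, U)) : EndOn.scalar E U a ∈ obj U
  comm {U : X.Opens} {s t : EndOn E U} : s ∈ obj U → t ∈ obj U → s * t = t * s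

namespace CommSubsheaf

variable {E : X.Modules} (A : CommSubsheaf E)

instance (U : X.Opens) : CommRing (A.obj U) :=
  { (inferInstance : Ring (A.obj U)) with
    mul_comm := fun a b => Subtype.ext (A.comm a.2 b.2) }

/-- Restriction of sections of `𝒜`. -/
def res {U V : X.Opens} (h : V ≤ U) : A.obj U →+* A.obj V :=
  (EndOn.res E h).restrict _ _ fun _ => A.res_mem h

/-- The structure map `𝒪_X ⟶ 𝒜` on sections over `U`. -/
def scalar (U : X.Opens) : Γ(X, U) →+* A.obj U :=
  (EndOn.scalar E U).codRestrict (A.obj U) (A.scalar_mem U)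

/-- `𝒜` as a presheaf of commutative rings. -/
def presheaf : X.Opensᵒᵖ ⥤ CommRingCat.{u} where
  obj U := CommRingCat.of (A.obj U.unop)
  map i := CommRingCat.ofHom (A.res i.unop.le)
  map_id _ := rfl
  map_comp _ _ := rfl

/-- The structure map `𝒪_X ⟶ 𝒜`. -/
def structureMap : X.presheaf ⟶ A.presheaf where
  app U := CommRingCat.ofHom (A.scalar U.unop)
  naturality U V i := by
    ext a
    apply Subtype.ext; apply Subtype.ext; funext W
    change algebraMap _ (Module.End Γ(X, W.1) Γ(E, W.1)) (resFun W.2 (X.presheaf.map i a)) =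
      algebraMap _ (Module.End Γ(X, W.1) Γ(E, W.1)) (resFun (W.2.trans i.unop.le) a)
    congr 1
    change (X.presheaf.map i ≫ X.presheaf.map (homOfLE W.2).op).hom a = _
    rw [← Functor.map_comp]; rfl

/-- `𝒜` is quasi-coherent: `𝒜(D(f)) = 𝒜(U)_f` for every affine open `U` and every function `f`
on `U`. -/
def IsQuasicoherent : Prop :=
  ∀ (U : X.Opens) (_ : IsAffineOpen U) (f : Γ(X, U)),
    letI := (A.res (X.basicOpen_le f)).toAlgebra
    IsLocalization.Away (A.scalar U f) (A.obj (X.basicOpen f))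

end CommSubsheaf

/-- A commutative quasi-coherent `𝒪_X`-subalgebra `𝒜` of `ℰnd(E)`. -/
structure CommSubalgebra (E : X.Modules) extends CommSubsheaf E where
  isQuasicoherent : toCommSubsheaf.IsQuasicoherent

namespace CommSubalgebra

variable {E E₁ E₂ : X.Modules} (A : CommSubalgebra E)

open Scheme.AffineZariskiSite

lemma coequifibered :
    ((toOpensFunctor X).op.whiskerLeft A.structureMap).Coequifibered :=
  coequifibered_iff_forall_isLocalizationAway.mpr fun U f => A.isQuasicoherent U.1 U.2 f

/-- The affine pieces `Spec 𝒜(U) ⟶ U`, for `U ⊆ X` affine open, with their gluing. -/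
def gluingData := relativeGluingData A.coequifibered

instance : (A.gluingData.functor ⋙ Scheme.forget).IsLocallyDirected :=
  Scheme.Cover.RelativeGluingData.instIsLocallyDirectedI₀CompFunctorForgetOfIsThin ..

/-- The surrogate `X_𝒜`, the relative spectrum of `𝒜`. -/
def surrogate : Scheme.{u} := A.gluingData.glued

/-- The structure morphism `X_𝒜 ⟶ X`. -/
def toBase : A.surrogate ⟶ X := A.gluingData.toBase

/-- The inclusion of the affine piece `Spec 𝒜(U)` in `X_𝒜`. -/
def ι (U : X.AffineZariskiSite) : Spec (A.presheaf.obj (.op U.1)) ⟶ A.surrogate :=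
  colimit.ι A.gluingData.functor U

lemma ι_toBase (U : X.AffineZariskiSite) :
    A.ι U ≫ A.toBase = Spec.map (A.structureMap.app (.op U.1)) ≫ U.2.fromSpec :=
  colimit.ι_desc _ _

/-- The canonical (iso)morphism `Γ(π⁻¹(U), 𝒪) ⟶ 𝒜(U)`, for `π : X_𝒜 ⟶ X` and `U ⊆ X` affine open:
restriction to the affine piece `Spec 𝒜(U)`. -/
def eval (U : X.AffineZariskiSite) :
    Γ(A.surrogate, A.toBase ⁻¹ᵁ U.1) →+* A.obj U.1 :=
  ((A.ι U).appLE (A.toBase ⁻¹ᵁ U.1) ⊤ (by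
    rw [← Scheme.Hom.comp_preimage, ι_toBase, Scheme.Hom.comp_preimage]
    simp) ≫ (Scheme.ΓSpecIso (A.presheaf.obj (.op U.1))).hom).hom

/-- The morphism of relative spectra `X_ℬ ⟶ X_𝒜` induced by a morphism `𝒜 ⟶ ℬ`. -/
def specMap {A : CommSubalgebra E₁} {B : CommSubalgebra E₂} (t : A.presheaf ⟶ B.presheaf) :
    B.surrogate ⟶ A.surrogate :=
  colimMap (show B.gluingData.functor ⟶ A.gluingData.functor from
    Functor.whiskerRight (NatTrans.rightOp ((toOpensFunctor X).op.whiskerLeft t)) Scheme.Spec)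

/-- The morphism of presheaves `𝒜 ⟶ ℬ` induced by an isomorphism `e : E₁ ≅ E₂` such that
conjugation by `e` maps `𝒜` into `ℬ`. -/
def conjMap {A : CommSubalgebra E₁} {B : CommSubalgebra E₂} (e : E₁ ≅ E₂)
    (h : ∀ U, ∀ s ∈ A.obj U, EndOn.conj e U s ∈ B.obj U) : A.presheaf ⟶ B.presheaf where
  app U := CommRingCat.ofHom ((EndOn.conj e U.unop).restrict _ _ (h U.unop))
  naturality _ _ _ := rfl

instance : LE (CommSubalgebra E) := ⟨fun A B => ∀ U, A.obj U ≤ B.obj U⟩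

/-- The morphism of presheaves `𝒜 ⟶ ℬ` induced by an inclusion `𝒜 ⊆ ℬ`. -/
def inclMap {A B : CommSubalgebra E} (h : A ≤ B) : A.presheaf ⟶ B.presheaf where
  app U := CommRingCat.ofHom (Subring.inclusion (h U.unop))
  naturality _ _ _ := rfl

end CommSubalgebra

end Surrogate

/-! ### Morphisms from an Azumaya scheme with a fundamental module -/

section Morphisms

variable {S X Y : Scheme.{u}} (sX : X ⟶ S) (sY : Y ⟶ S) (E : X.Modules)

/-- A pair `(𝒪_X ⊆ 𝒜 ⊆ ℰnd(E), f : X_𝒜 ⟶ Y)`, all over the base `S`. -/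
structure Presentation where
  /-- the subalgebra `𝒜` -/
  alg : CommSubalgebra E
  /-- the morphism `f : X_𝒜 ⟶ Y` -/
  map : alg.surrogate ⟶ Y
  map_over : map ≫ sY = alg.toBase ≫ sX

variable {sX sY E}

/-- `p ≼ q`: the subalgebra of `p` is contained in that of `q`, and the morphism of `q` is the
composition of `X_{𝒜_q} ⟶ X_{𝒜_p}` with the morphism of `p`. -/
def Presentation.Refines (p q : Presentation sX sY E) : Prop :=
  ∃ h : p.alg ≤ q.alg, q.map = CommSubalgebra.specMap (CommSubalgebra.inclMap h) ≫ p.map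

variable (sX sY E) in
/-- A morphism `(X^{Az}, E) ⟶ Y`, where `𝒪_X^{Az} = ℰnd(E)`: an equivalence class of pairs
`(𝒪_X ⊆ 𝒜 ⊆ ℰnd(E), f : X_𝒜 ⟶ Y)`, where two pairs are equivalent if both are refined by a third
one. -/
def AzumayaMorphism : Type u :=
  Quot fun p q : Presentation sX sY E => ∃ t : Presentation sX sY E, t.Refines p ∧ t.Refines q

/-- The morphism given by a pair. -/
def Presentation.toMorphism (p : Presentation sX sY E) : AzumayaMorphism sX sY E := Quot.mk _ p

/-- `p = (𝒜_φ, f_φ : X_φ ⟶ Y)` is the canonical presentation of `φ`: it belongs to `φ`, and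
every pair in `φ` contains `𝒜_φ` and has a morphism to `Y` that factors as `X_𝒜 ⟶ X_φ ⟶ Y`. -/
structure Presentation.IsCanonical (p : Presentation sX sY E) (φ : AzumayaMorphism sX sY E) :
    Prop where
  toMorphism_eq : p.toMorphism = φ
  refines : ∀ q : Presentation sX sY E, q.toMorphism = φ → p.Refines q

/-- The morphism `(π, f) : X_𝒜 ⟶ X × Y`. -/
def Presentation.graph (p : Presentation sX sY E) : p.alg.surrogate ⟶ pullback sX sY :=
  pullback.lift p.alg.toBase p.map p.map_over.symm

lemma Presentation.graph_fst (p : Presentation sX sY E) :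
    p.graph ≫ pullback.fst sX sY = p.alg.toBase :=
  pullback.lift_fst _ _ _

/-- A quasi-coherent `𝒪_{X_𝒜}`-module `M` with an isomorphism `θ : π_* M ≅ E` is `E` regarded as
an `𝒪_{X_𝒜}`-module: the functions on `X_𝒜` act on `M` as the sections of `𝒜 ⊆ ℰnd(E)` act
on `E`. -/
structure IsModuleOver (A : CommSubalgebra E) (M : A.surrogate.Modules)
    (θ : (Scheme.Modules.pushforward A.toBase).obj M ≅ E) : Prop where
  quasicoherent : SheafOfModules.IsQuasicoherent.{u} M
  smul (U : X.AffineZariskiSite) (t : Γ(A.surrogate, A.toBase ⁻¹ᵁ U.1))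
    (m : Γ(M, A.toBase ⁻¹ᵁ U.1)) :
    θ.hom.app U.1 (t • m) = (A.eval U t).1.1 ⟨U.1, le_rfl⟩ (θ.hom.app U.1 m)

/-- The sheaf `F` on `X × Y`, with an identification `θ : pr₁_* F ≅ E`, is the push-forward
along `(π_φ, f_φ) : X_φ ⟶ X × Y` of `E` regarded as an `𝒪_{X_φ}`-module. -/
def Corresponds (φ : AzumayaMorphism sX sY E) (F : (pullback sX sY).Modules)
    (θ : (Scheme.Modules.pushforward (pullback.fst sX sY)).obj F ≅ E) : Prop :=
  ∃ p : Presentation sX sY E, p.IsCanonical φ ∧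
    ∃ (M : p.alg.surrogate.Modules)
      (η : (Scheme.Modules.pushforward p.alg.toBase).obj M ≅ E)
      (κ : F ≅ (Scheme.Modules.pushforward p.graph).obj M),
      IsModuleOver p.alg M η ∧
      θ = (Scheme.Modules.pushforward (pullback.fst sX sY)).mapIso κ ≪≫
        (Scheme.Modules.pushforwardComp p.graph (pullback.fst sX sY)).app M ≪≫
        (Scheme.Modules.pushforwardCongr p.graph_fst).app M ≪≫ η

/-- An isomorphism `e : E₁ ≅ E₂` is an isomorphism from the morphism `φ₁ : (X^{Az}, E₁) ⟶ Y` to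
the morphism `φ₂ : (X^{Az}, E₂) ⟶ Y`, over the identity of `X`: conjugation by `e` maps `𝒜_{φ₁}`
onto `𝒜_{φ₂}`, and the induced `X_{φ₂} ⟶ X_{φ₁}` is compatible with `f_{φ₁}` and `f_{φ₂}`. -/
def IsMorphismIso {E₁ E₂ : X.Modules} (e : E₁ ≅ E₂) (φ₁ : AzumayaMorphism sX sY E₁)
    (φ₂ : AzumayaMorphism sX sY E₂) : Prop :=
  ∃ (p₁ : Presentation sX sY E₁) (p₂ : Presentation sX sY E₂),
    p₁.IsCanonical φ₁ ∧ p₂.IsCanonical φ₂ ∧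
    (∀ U s, EndOn.conj e U s ∈ p₂.alg.obj U → s ∈ p₁.alg.obj U) ∧
    ∃ h : ∀ U, ∀ s ∈ p₁.alg.obj U, EndOn.conj e U s ∈ p₂.alg.obj U,
      p₂.map = CommSubalgebra.specMap (CommSubalgebra.conjMap e h) ≫ p₁.map

end Morphisms

end AzumayaBrane

end

open AzumayaBrane

open AzumayaBrane

noncomputable section

/-! A morphism from the Azumaya scheme amounts to a closed subscheme of `X × Y`, finite over `X`,
whose functions act faithfully on `E`. A flat family of relative length `r` amounts to the same
thing: its support together with the module that lives on it. The proof makes both identifications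
precise.

Canonical presentations. Over an affine `U`, the algebra `𝒜(U)` embeds in the endomorphisms of the
finitely generated module `Γ(E, U)`, so `X_𝒜` is finite over the locally Noetherian `X`
(`CommSubalgebra.isFinite_toBase`). The scheme-theoretic image `Z` of the graph `X_𝒜 ⟶ X × Y` is
proper over `X` with finite fibres because `X_𝒜` surjects onto it, hence it is finite over `X`
(`isFinite_imageι_comp`). Its functions inject into those of `X_𝒜`, so `Z` is the spectrum of a
smaller algebra: every pair is refined by one whose graph is a closed immersion
(`Presentation.exists_refines`). Refinement does not change the ideal of the graph, since an
inclusion of algebras is injective on functions. Hence two pairs with closed graph that refine the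
same pair coincide (`Presentation.eq_of_refines`), the closed-graph refinement is constant on
equivalence classes, and it is the canonical presentation.

From morphisms to sheaves. Let `M` be `E` regarded as a module on `X_φ`, and `F` its push-forward
along the closed graph. Functions on `X_φ` act faithfully on `M`, so the annihilator of `F` is the
ideal of the graph, which identifies the support. Flatness and length are computed on `X_φ`, where
the push-forward of `M` to `X` is `E`: the stalks of `M` are localizations of `Γ(E, U)` at primes of
a finite algebra, and the dimension of `κ(x) ⊗ Γ(E, U)` is the sum of the dimensions of its
localizations at the primes over `x` (`exists_finset_sum_finrank`).

From sheaves to morphisms. A coherent `F` is `i_* M` for a faithful `M` on its support `Z`. By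
Nakayama every point of `Z` contributes at least one to the length, so the fibres of `Z` over `X`
are finite, and `Z`, being proper, is finite over `X`. The push-forward of `F` is then finitely
generated and flat over Noetherian rings, so it is locally free, and the length count gives its
rank. Through `θ` the functions on `Z` act faithfully on `E`, so they form a subalgebra of `ℰnd(E)`
with spectrum `Z` (`Act.exists_commSubalgebra`); its graph is closed, so this presentation is
canonical.

Isomorphisms. Functions on `X × Y` surject locally onto those of a closed subscheme, so an
isomorphism of the sheaves identifies the supports and is linear over them. Read through `θ₁` and
`θ₂`, this says that conjugation carries `𝒜_{φ₁}` onto `𝒜_{φ₂}`. Conversely such a conjugation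
lifts, because push-forward along an affine morphism is fully faithful on quasi-coherent modules
with their action of functions (`existsUnique_hom_of_pushforward`).

The sheaf theory underneath rests on `Act.exists_module`: for `π` affine, a quasi-coherent sheaf
with an action of `π_* 𝒪_Z` comes from `Z`. The sheaf on `Z` is produced by a left adjoint and
recognized on affine pieces by its universal property (`universal_spec`). -/

namespace AzumayaBrane

/-! ### Quasi-coherence as a localization property of sections -/

section QC
variable {Z X : Scheme.{u}}

@[simp] lemma resSec_resSec (M : Z.Modules) {U V W : Z.Opens} (h : V ≤ U) (h' : W ≤ V) (m : Γ(M, U)) :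
    resSec M h' (resSec M h m) = resSec M (h'.trans h) m := by
  change (M.presheaf.map (homOfLE h).op ≫ M.presheaf.map (homOfLE h').op) m = _
  rw [← Functor.map_comp]; rfl

@[simp] lemma resFun_resFun {U V W : Z.Opens} (h : V ≤ U) (h' : W ≤ V) (m : Γ(Z, U)) :
    resFun h' (resFun h m) = resFun (h'.trans h) m := by
  change (Z.presheaf.map (homOfLE h).op ≫ Z.presheaf.map (homOfLE h').op).hom m = _
  rw [← Functor.map_comp]; rfl

@[simp] lemma resSec_self (M : Z.Modules) {U : Z.Opens} (m : Γ(M, U)) :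
    resSec M (le_refl U) m = m := 
  congr($(M.presheaf.map_id (.op U)) m)

@[simp] lemma resFun_self {U : Z.Opens} (m : Γ(Z, U)) :
    resFun (le_refl U) m = m := 
  congr($(Z.presheaf.map_id (.op U)) m)

lemma resSec_smul (M : Z.Modules) {U V : Z.Opens} (h : V ≤ U) (a : Γ(Z, U)) (m : Γ(M, U)) :
    resSec M h (a • m) = resFun h a • resSec M h m := M.map_smul (homOfLE h) a m

lemma app_resSec {M N : Z.Modules} (g : M ⟶ N) {U V : Z.Opens} (h : V ≤ U) (m : Γ(M, U)) :
    g.app V (resSec M h m) = resSec N h (g.app U m) :=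
  congr($(g.mapPresheaf.naturality (homOfLE h).op) m)

lemma fromSpec_appIso_inv {W : Z.Opens} (hW : IsAffineOpen W) (U : (Spec Γ(Z, W)).Opens)
    (hU : hW.fromSpec ''ᵁ U ≤ W) (a : Γ(Z, W)) :
    (hW.fromSpec.appIso U).inv ((Spec Γ(Z, W)).presheaf.map (U.leTop).op
      ((Scheme.ΓSpecIso Γ(Z, W)).inv a)) = resFun hU a := by
  apply (ConcreteCategory.bijective_of_isIso (hW.fromSpec.appIso U).hom).1
  rw [← ConcreteCategory.comp_apply, Iso.inv_hom_id]
  change _ = (Z.presheaf.map (homOfLE hU).op ≫ (hW.fromSpec.appIso U).hom) a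
  rw [Scheme.Hom.appIso_hom', Scheme.Hom.map_appLE]
  rw [Scheme.Hom.appLE, IsAffineOpen.fromSpec_app_self]
  simp
  rfl

/-- The ring `Γ(Z, W)` acts on sections over `Spec Γ(Z, W)` through global functions on the
spectrum. `fromSpec_appIso_inv` matches this with restriction of functions to the image in `Z`. -/
lemma smul_restrict_fromSpec (M : Z.Modules) {W : Z.Opens} (hW : IsAffineOpen W) (U : (Spec Γ(Z, W)).Opens)
    (hU : hW.fromSpec ''ᵁ U ≤ W) (a : Γ(Z, W)) (m : Γ(M.restrict hW.fromSpec, U)) :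
    (M.restrictAppIso hW.fromSpec U).hom (a • m) =
      resFun hU a • (M.restrictAppIso hW.fromSpec U).hom m := by
  rw [Scheme.Modules.smul_Spec_def]
  rw [← fromSpec_appIso_inv]
  rfl

/-- On `Spec Γ(Z, W)` the sections over a basic open are a localization of the global ones; the two
halves are surjectivity up to a denominator and the description of the kernel. The elementwise form
survives the identification of opens that are equal only propositionally. -/
lemma exists_of_isQuasicoherent (M : Z.Modules) (hM : SheafOfModules.IsQuasicoherent.{u} M)
    {W : Z.Opens} (hW : IsAffineOpen W) (f : Γ(Z, W)) :
    (∀ s : Γ(M, Z.basicOpen f), ∃ (n : ℕ) (t : Γ(M, W)),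
      resSec M (Z.basicOpen_le f) t = resFun (Z.basicOpen_le f) (f ^ n) • s) ∧
    (∀ t : Γ(M, W), resSec M (Z.basicOpen_le f) t = 0 → ∃ n : ℕ, f ^ n • t = 0) := by
  let j := hW.fromSpec
  have h1 : SheafOfModules.IsQuasicoherent.{u} (M.restrict j) :=
    Scheme.Modules.isQuasicoherent_restrictFunctor j M
  have h2 := (isIso_fromTildeΓ_iff_isLocalizing (M.restrict j)).mp inferInstance f
  have eW : j ''ᵁ ⊤ = W := by simp [j]
  have eD : j ''ᵁ (PrimeSpectrum.basicOpen f) = Z.basicOpen f := hW.fromSpec_image_basicOpen f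
  constructor
  · intro s
    obtain ⟨⟨t, ⟨_, n, rfl⟩⟩, ht⟩ := h2.surj ((M.restrictAppIso j _).inv (resSec M eD.le s))
    refine ⟨n, resSec M eW.ge ((M.restrictAppIso j _).hom t), ?_⟩
    have ht' := congr(resSec M eD.ge ((M.restrictAppIso j _).hom $ht))
    rw [resSec_resSec]
    have e1 := smul_restrict_fromSpec M hW _ (eD.le.trans (Z.basicOpen_le f)) (f ^ n)
      ((M.restrictAppIso j _).inv (resSec M eD.le s))
    refine (Eq.trans ?_ (ht'.symm.trans (congr(resSec M eD.ge $e1)))).trans ?_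
    · exact (resSec_resSec M (U := j ''ᵁ ⊤) (V := j ''ᵁ (PrimeSpectrum.basicOpen f))
        (j.image_mono le_top) eD.ge _).symm
    · rw [resSec_smul, resFun_resFun]
      congr 1
      exact (resSec_resSec M eD.le eD.ge s).trans (resSec_self M s)
  · intro t ht
    have : ((modulesSpecToSheaf.obj (M.restrict j)).obj.map
        (PrimeSpectrum.basicOpen f).leTop.op).hom ((M.restrictAppIso j _).inv (resSec M eW.le t)) = 0 := by
      refine (resSec_resSec M (U := W) (V := j ''ᵁ ⊤) (W := j ''ᵁ (PrimeSpectrum.basicOpen f)) eW.le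
        (j.image_mono le_top) t).trans ?_
      rw [← resSec_resSec M (Z.basicOpen_le f) eD.le, ht]
      exact map_zero (M.presheaf.map (homOfLE eD.le).op).hom
    obtain ⟨⟨_, n, rfl⟩, hn⟩ := (IsLocalizedModule.eq_zero_iff (.powers f) _).mp this
    refine ⟨n, ?_⟩
    have e1 := smul_restrict_fromSpec M hW _ eW.le (f ^ n)
      ((M.restrictAppIso j _).inv (resSec M eW.le t))
    have hn' := congr(resSec M eW.ge ((M.restrictAppIso j _).hom $hn))
    have e2 := (congr(resSec M eW.ge $e1)).symm.trans hn'
    rw [resSec_smul, resFun_resFun, resFun_self] at e2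
    refine Eq.trans ?_ (e2.trans (map_zero (M.presheaf.map (homOfLE eW.ge).op).hom))
    congr 1
    exact ((resSec_resSec M eW.le eW.ge t).trans (resSec_self M t)).symm

lemma isIso_sheafOfModules {M N : Z.Modules} (e : M ≅ N) :
    @IsIso (SheafOfModules.{u} Z.ringCatSheaf) _ M N e.hom :=
  ⟨e.inv, e.hom_inv_id, e.inv_hom_id⟩

/-- Transport of a presentation along an isomorphism of `𝒪_Z`-modules. -/
def presentationOfIso {M N : Z.Modules} (e : M ≅ N) (P : SheafOfModules.Presentation.{u} M) :
    SheafOfModules.Presentation.{u} N :=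
  have := isIso_sheafOfModules e
  SheafOfModules.Presentation.ofIsIso (R := Z.ringCatSheaf) (M := M) (N := N) e.hom P

lemma isQuasicoherent_of_iso {M N : Z.Modules} (e : M ≅ N)
    (hM : SheafOfModules.IsQuasicoherent.{u} M) : SheafOfModules.IsQuasicoherent.{u} N := by
  have := isIso_sheafOfModules e
  obtain ⟨⟨q⟩⟩ := hM
  exact (SheafOfModules.QuasicoherentData.ofIsIso (R := Z.ringCatSheaf) (M := M) (N := N)
    e.hom q).isQuasicoherent

/-- A presentation of the restriction to an open gives one on the slice site. -/
def presentationOver (M : Z.Modules) (U : Z.Opens)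
    (P : SheafOfModules.Presentation.{u} (M.restrict U.ι : U.toScheme.Modules)) :
    SheafOfModules.Presentation.{u} (SheafOfModules.over M U) :=
  letI e : SheafOfModules.{u} (Z.ringCatSheaf.over U) ≌ SheafOfModules.{u} U.toScheme.ringCatSheaf :=
    Scheme.Modules.overEquiv U
  letI P' := presentationOfIso ((Scheme.Modules.overFunctorEquiv U).symm.app M) P
  have : PreservesColimitsOfSize.{u, u} e.inverse := inferInstance
  letI i : SheafOfModules.unit.{u} (Z.ringCatSheaf.over U) ≅ e.inverse.obj (SheafOfModules.unit _) :=
    e.unitIso.app (SheafOfModules.unit.{u} _)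
  letI P'' := P'.map e.inverse i
  letI k := (e.unitIso.app (SheafOfModules.over (R := Z.ringCatSheaf) M U)).symm
  have : IsIso k.hom := inferInstance
  P''.ofIsIso k.hom

/-- Quasi-coherence is defined by presentations on slice sites; `presentationOver` carries
presentations on open subschemes there. -/
lemma isQuasicoherent_of_presentation (M : Z.Modules)
    (h : ∀ z : Z, ∃ U : Z.Opens, z ∈ U ∧
      Nonempty (SheafOfModules.Presentation.{u} (M.restrict U.ι : U.toScheme.Modules))) :
    SheafOfModules.IsQuasicoherent.{u} M := by
  choose U hU P using h
  have : ∀ z, SheafOfModules.IsQuasicoherent.{u} (SheafOfModules.over M (U z)) := fun z =>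
    (presentationOver M (U z) (P z).some).isQuasicoherent
  refine SheafOfModules.IsQuasicoherent.of_coversTop (R := Z.ringCatSheaf) M U ?_
  rw [Opens.coversTop_iff]
  exact top_le_iff.mp fun z _ => TopologicalSpace.Opens.mem_iSup.mpr ⟨z, hU z⟩

/-- The hypotheses say that the restriction to `Spec Γ(Z, W)` is localizing, hence is the tilde of
its global sections. A tilde has a presentation, which is transported to the open subscheme `W`. -/
lemma isQuasicoherent_of_exists (M : Z.Modules)
    (h : ∀ z : Z, ∃ (W : Z.Opens), z ∈ W ∧ IsAffineOpen W ∧ ∀ f : Γ(Z, W),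
    (∀ s : Γ(M, Z.basicOpen f), ∃ (n : ℕ) (t : Γ(M, W)),
      resSec M (Z.basicOpen_le f) t = resFun (Z.basicOpen_le f) (f ^ n) • s) ∧
    (∀ t : Γ(M, W), resSec M (Z.basicOpen_le f) t = 0 → ∃ n : ℕ, f ^ n • t = 0)) :
    SheafOfModules.IsQuasicoherent.{u} M := by
  refine isQuasicoherent_of_presentation M fun z => ?_
  obtain ⟨W, hz, hW, h⟩ := h z
  refine ⟨W, hz, ?_⟩
  let j := hW.fromSpec
  have eW : j ''ᵁ ⊤ = W := by simp [j]
  have : IsLocalizing (modulesSpecToSheaf.obj (M.restrict j)) := by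
    intro f
    have eD : j ''ᵁ (PrimeSpectrum.basicOpen f) = Z.basicOpen f := hW.fromSpec_image_basicOpen f
    obtain ⟨h1, h2⟩ := h f
    refine IsLocalizedModule.Away.mk_of_addCommGroup ?_ ?_ ?_
    · exact Scheme.Modules.isUnit_algebraMap_end_of_le_basicOpen (M := M.restrict j) f le_rfl
    · intro s
      obtain ⟨n, t, ht⟩ := h1 (resSec M eD.ge ((M.restrictAppIso j _).hom s))
      refine ⟨n, (M.restrictAppIso j _).inv (resSec M eW.le t), ?_⟩
      have e1 := smul_restrict_fromSpec M hW _ (eD.le.trans (Z.basicOpen_le f)) (f ^ n) s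
      refine Eq.trans ?_ (Eq.trans congr(resSec M eD.le $ht.symm) ?_)
      · rw [resSec_smul, resFun_resFun, resSec_resSec]
        exact e1.trans congr(_ • $((resSec_self M _).symm))
      · rw [resSec_resSec]
        exact (resSec_resSec M eW.le (j.image_mono le_top) t).symm
    · intro t ht
      have h0 : resSec M (Z.basicOpen_le f) (resSec M eW.ge ((M.restrictAppIso j _).hom t)) = 0 := by
        refine (resSec_resSec M eW.ge _ _).trans ((resSec_resSec M (j.image_mono
          (le_top (a := PrimeSpectrum.basicOpen f))) eD.ge (show Γ(M, j ''ᵁ ⊤) from t)).symm.trans ?_)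
        exact congr(resSec M eD.ge $ht).trans (map_zero (M.presheaf.map (homOfLE eD.ge).op).hom)
      obtain ⟨n, hn⟩ := h2 _ h0
      refine ⟨n, ?_⟩
      have e1 := smul_restrict_fromSpec M hW _ eW.le (f ^ n) t
      refine e1.trans (Eq.trans ?_ (congr(resSec M eW.le $hn).trans
        (map_zero (M.presheaf.map (homOfLE eW.le).op).hom)))
      rw [resSec_smul, resSec_resSec]
      exact congr(_ • $((resSec_self M _).symm))
  have h2 := (isIso_fromTildeΓ_iff_isLocalizing (M.restrict j)).mpr this
  -- Every global section serves as a generator and every relation among them as a relation.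
  let P := presentationOfIso (@asIso _ _ _ _ (M.restrict j).fromTildeΓ h2)
    (presentationTilde _ Set.univ (by simp) _ (Submodule.span_eq _))
  let P' := Scheme.Modules.presentationRestrict hW.isoSpec.hom P
  have e : hW.isoSpec.hom ≫ j = W.ι := by simp [j]
  exact ⟨presentationOfIso (((Scheme.Modules.restrictFunctorComp _ _).symm ≪≫
    (Scheme.Modules.restrictFunctorCongr e)).app M) P'⟩

end QC

/-! ### Gluing of sections, and push-forward along affine morphisms -/

section Sections
variable {Z X : Scheme.{u}}

@[simp] lemma resSec_zero (M : Z.Modules) {U V : Z.Opens} (h : V ≤ U) :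
    resSec M h (0 : Γ(M, U)) = 0 := map_zero (M.presheaf.map (homOfLE h).op).hom

@[simp] lemma resSec_add (M : Z.Modules) {U V : Z.Opens} (h : V ≤ U) (a b : Γ(M, U)) :
    resSec M h (a + b) = resSec M h a + resSec M h b := map_add (M.presheaf.map (homOfLE h).op).hom a b

@[simp] lemma resSec_sub (M : Z.Modules) {U V : Z.Opens} (h : V ≤ U) (a b : Γ(M, U)) :
    resSec M h (a - b) = resSec M h a - resSec M h b := map_sub (M.presheaf.map (homOfLE h).op).hom a b

/-- Sections of a sheaf of modules that agree locally are equal. -/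
lemma section_ext (M : Z.Modules) {U : Z.Opens} (s t : Γ(M, U))
    (h : ∀ z ∈ U, ∃ (V : Z.Opens) (hV : V ≤ U), z ∈ V ∧ resSec M hV s = resSec M hV t) : s = t := by
  refine TopCat.Presheaf.section_ext ⟨M.presheaf, M.isSheaf⟩ U s t fun z hz => ?_
  obtain ⟨V, hV, hzV, e⟩ := h z hz
  exact TopCat.Presheaf.germ_ext M.presheaf V hzV (homOfLE hV) (homOfLE hV) e

/-- Functions that agree locally are equal. -/
lemma fun_ext {U : Z.Opens} (s t : Γ(Z, U))
    (h : ∀ z ∈ U, ∃ (V : Z.Opens) (hV : V ≤ U), z ∈ V ∧ resFun hV s = resFun hV t) : s = t := by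
  refine TopCat.Presheaf.section_ext Z.sheaf U s t fun z hz => ?_
  obtain ⟨V, hV, hzV, e⟩ := h z hz
  exact TopCat.Presheaf.germ_ext Z.presheaf V hzV (homOfLE hV) (homOfLE hV) e

/-- Gluing of sections. -/
lemma exists_glue (M : Z.Modules) {ι : Type u} (V : ι → Z.Opens) (U : Z.Opens) (hV : ∀ i, V i ≤ U)
    (hU : ∀ z ∈ U, ∃ i, z ∈ V i) (s : ∀ i, Γ(M, V i))
    (h : ∀ i j, ∀ z ∈ V i ⊓ V j, ∃ (W : Z.Opens) (hi : W ≤ V i) (hj : W ≤ V j), z ∈ W ∧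
      resSec M hi (s i) = resSec M hj (s j)) :
    ∃ t : Γ(M, U), ∀ i, resSec M (hV i) t = s i := by
  obtain ⟨t, ht, -⟩ := TopCat.Sheaf.existsUnique_gluing' ⟨M.presheaf, M.isSheaf⟩ V U (fun i => homOfLE (hV i))
    (fun z hz => TopologicalSpace.Opens.mem_iSup.mpr (hU z hz)) s (fun i j =>
      section_ext M _ _ fun z hz => by
        obtain ⟨W, hi, hj, hzW, e⟩ := h i j z hz
        refine ⟨W, le_inf hi hj, hzW, ?_⟩
        exact (resSec_resSec M inf_le_left (le_inf hi hj) (s i)).trans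
          (e.trans (resSec_resSec M inf_le_right (le_inf hi hj) (s j)).symm))
  exact ⟨t, ht⟩

/-- The basic open is a variable `D` with an equation, so that the preimage of a basic open can be
used directly. -/
lemma exists_resSec_eq {M : Z.Modules} (hM : SheafOfModules.IsQuasicoherent.{u} M)
    {W : Z.Opens} (hW : IsAffineOpen W) (f : Γ(Z, W)) {D : Z.Opens} (hD : D = Z.basicOpen f)
    (hDW : D ≤ W) (s : Γ(M, D)) : ∃ (n : ℕ) (t : Γ(M, W)),
      resSec M hDW t = resFun hDW (f ^ n) • s := by
  subst hD; exact (exists_of_isQuasicoherent M hM hW f).1 s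

lemma exists_pow_smul_eq_zero {M : Z.Modules} (hM : SheafOfModules.IsQuasicoherent.{u} M)
    {W : Z.Opens} (hW : IsAffineOpen W) (f : Γ(Z, W)) {D : Z.Opens} (hD : D = Z.basicOpen f)
    (hDW : D ≤ W) (t : Γ(M, W)) (h : resSec M hDW t = 0) : ∃ n : ℕ, f ^ n • t = 0 := by
  subst hD; exact (exists_of_isQuasicoherent M hM hW f).2 t h

lemma app_resFun (π : Z ⟶ X) {U V : X.Opens} (h : V ≤ U) (a : Γ(X, U)) :
    π.app V (resFun h a) = resFun (π.preimage_mono h) (π.app U a) :=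
  congr($(π.naturality (homOfLE h).op) a)

/-- The preimage of an affine open is affine and the preimage of `D(f)` is the basic open of the
pulled-back function, so the localization conditions downstairs are instances of those upstairs. -/
lemma isQuasicoherent_pushforward (π : Z ⟶ X) [IsAffineHom π] (M : Z.Modules)
    (hM : SheafOfModules.IsQuasicoherent.{u} M) :
    SheafOfModules.IsQuasicoherent.{u} ((Scheme.Modules.pushforward π).obj M) := by
  refine isQuasicoherent_of_exists _ fun x => ?_
  obtain ⟨_, ⟨W, hW, rfl⟩, hx, -⟩ :=
    X.isBasis_affineOpens.exists_subset_of_mem_open (Set.mem_univ x) isOpen_univ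
  refine ⟨W, hx, hW, fun f => ?_⟩
  have hW' : IsAffineOpen (π ⁻¹ᵁ W) := hW.preimage π
  have hD := Scheme.preimage_basicOpen π f
  constructor
  · intro s
    obtain ⟨n, t, ht⟩ := exists_resSec_eq hM hW' (π.app W f) hD (π.preimage_mono (X.basicOpen_le f)) s
    refine ⟨n, t, ht.trans ?_⟩
    have e : resFun (π.preimage_mono (X.basicOpen_le f)) (π.app W f ^ n) =
        π.app _ (resFun (X.basicOpen_le f) (f ^ n)) := by
      rw [← map_pow]; exact (app_resFun π _ _).symm
    exact congr($e • (show Γ(M, π ⁻¹ᵁ X.basicOpen f) from s))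
  · intro t ht
    obtain ⟨n, hn⟩ := exists_pow_smul_eq_zero hM hW' (π.app W f) hD (π.preimage_mono (X.basicOpen_le f)) t ht
    refine ⟨n, ?_⟩
    rw [← map_pow] at hn
    exact hn

end Sections

/-! ### Extending linear maps from an affine open to its open subsets -/

section Extend
variable {Z X : Scheme.{u}}

/-- An invertible counit at `x` gives `x ≅ L (R x)`, and morphisms out of `L (R x)` are morphisms
out of `R x`. Nothing is needed of `y`. -/
lemma map_surjective_of_isIso_counit {C D : Type*} [Category* C] [Category* D] {L : C ⥤ D} {R : D ⥤ C}
    (adj : L ⊣ R) (x y : D) [IsIso (adj.counit.app x)] (h : R.obj x ⟶ R.obj y) :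
    ∃ g : x ⟶ y, R.map g = h := by
  refine ⟨inv (adj.counit.app x) ≫ (adj.homEquiv _ _).symm h, ?_⟩
  have := (adj.homEquiv _ _).apply_symm_apply h
  rw [Adjunction.homEquiv_unit] at this
  have h2 := adj.right_triangle_components_assoc (Y := x)
    (R.map (inv (adj.counit.app x) ≫ (adj.homEquiv _ _).symm h))
  rw [← h2, ← Functor.map_comp, IsIso.hom_inv_id_assoc, this]

/-- Tilde is left adjoint to global sections, with counit invertible at quasi-coherent sheaves; so
only the source has to be quasi-coherent. -/
lemma exists_hom_of_linearMap {R : CommRingCat.{u}} (Q N : (Spec R).Modules)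
    [hQ : SheafOfModules.IsQuasicoherent.{u} Q] (h : Γ(Q, ⊤) →ₗ[R] Γ(N, ⊤)) :
    ∃ g : Q ⟶ N, ∀ m, g.app ⊤ m = h m := by
  have := (isQuasicoherent_iff_isIso_fromTildeΓ _).mp hQ
  have hc : IsIso ((tilde.adjunction (R := R)).counit.app Q) := this
  let h' : ModuleCat.of R Γ(Q, ⊤) ⟶ ModuleCat.of R Γ(N, ⊤) := ModuleCat.ofHom h
  obtain ⟨g, hg⟩ := map_surjective_of_isIso_counit (tilde.adjunction (R := R)) Q N h'
  exact ⟨g, fun m => congr($(hg) m)⟩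

/-- A linear map between the sections over an affine open `W` extends to the sections over the open
subsets of `W`, if the source is quasi-coherent. -/
lemma exists_extend (Q N : Z.Modules) {W : Z.Opens} (hW : IsAffineOpen W)
    (hQ : SheafOfModules.IsQuasicoherent.{u} (Q.restrict hW.fromSpec))
    (h : Γ(Q, W) →ₗ[Γ(Z, W)] Γ(N, W)) :
    ∃ g : ∀ V : Z.Opens, V ≤ W → (Γ(Q, V) →ₗ[Γ(Z, V)] Γ(N, V)),
      (∀ m, g W le_rfl m = h m) ∧
      ∀ (V V' : Z.Opens) (hV : V ≤ W) (hV' : V' ≤ V) (m : Γ(Q, V)),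
        g V' (hV'.trans hV) (resSec Q hV' m) = resSec N hV' (g V hV m) := by
  let j := hW.fromSpec
  have eW : j ''ᵁ ⊤ = W := by simp [j]
  let h' : Γ(Q.restrict j, ⊤) →ₗ[Γ(Z, W)] Γ(N.restrict j, ⊤) :=
    { toFun := fun m => (N.restrictAppIso j ⊤).inv (resSec N eW.le (h (resSec Q eW.ge ((Q.restrictAppIso j ⊤).hom m))))
      map_add' := by 
        intro a b
        simp only [map_add]
      map_smul' := by
        intro a b
        simp only [RingHom.id_apply]
        rw [smul_restrict_fromSpec Q hW ⊤ eW.le, resSec_smul, resFun_resFun, map_smul, resSec_smul,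
          resFun_resFun]
        exact (smul_restrict_fromSpec N hW ⊤ eW.le a _).symm }
  obtain ⟨g, hg⟩ := exists_hom_of_linearMap (Q.restrict j) (N.restrict j) h'
  -- Each `V ≤ W` is the image of its own preimage in the spectrum, so the component of `g` at that
  -- preimage acts on sections over `V`.
  have eV : ∀ V : Z.Opens, V ≤ W → j ''ᵁ (j ⁻¹ᵁ V) = V := by
    intro V hV
    rw [Scheme.Hom.image_preimage_eq_opensRange_inf]
    simpa [j] using hV
  have hres : ∀ (V V' : Z.Opens) (hV : V ≤ W) (hV' : V' ≤ V) (m : Γ(Q, V)),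
      (Q.restrictAppIso j _).inv (resSec Q (eV V' (hV'.trans hV)).le (resSec Q hV' m)) =
      (Q.restrict j).presheaf.map (homOfLE (j.preimage_mono hV')).op
        ((Q.restrictAppIso j _).inv (resSec Q (eV V hV).le m)) := by
    intro V V' hV hV' m
    rw [resSec_resSec]
    exact (resSec_resSec Q (eV V hV).le (j.image_mono (j.preimage_mono hV')) m).symm
  let G : ∀ V : Z.Opens, V ≤ W → (Γ(Q, V) →ₗ[Γ(Z, V)] Γ(N, V)) := fun V hV => 
    { toFun := fun m => resSec N (eV V hV).ge ((N.restrictAppIso j _).hom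
        (g.app (j ⁻¹ᵁ V) ((Q.restrictAppIso j _).inv (resSec Q (eV V hV).le m))))
      map_add' := by 
        intro a b
        simp only [map_add]
      map_smul' := by
        intro a m
        simp only [RingHom.id_apply]
        rw [resSec_smul]
        have e1 := congr($(Scheme.Modules.smul_restrictAppIso_inv j Q (j ⁻¹ᵁ V)
          (resFun (eV V hV).le a)) (resSec Q (eV V hV).le m))
        have e2 := congr($(Scheme.Modules.smul_restrictAppIso_hom j N (j ⁻¹ᵁ V)
          ((j.appIso _).hom (resFun (eV V hV).le a))) (g.app (j ⁻¹ᵁ V) ((Q.restrictAppIso j _).inv (resSec Q (eV V hV).le m))))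
        have e3 := Scheme.Modules.Hom.app_smul g ((j.appIso _).hom (resFun (eV V hV).le a)) ((Q.restrictAppIso j _).inv (resSec Q (eV V hV).le m))
        refine congr(resSec N (eV V hV).ge ((N.restrictAppIso j _).hom (g.app _ $e1))).trans ?_
        refine congr(resSec N (eV V hV).ge ((N.restrictAppIso j _).hom $e3)).trans ?_
        refine congr(resSec N (eV V hV).ge $e2).trans ?_
        refine (resSec_smul N _ _ _).trans ?_
        congr 1
        have e4 := congr($((j.appIso (j ⁻¹ᵁ V)).hom_inv_id) (resFun (eV V hV).le a))
        refine congr(resFun (eV V hV).ge $e4).trans ?_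
        exact (resFun_resFun _ _ a).trans (resFun_self a) }
  refine ⟨G, ?_, ?_⟩
  · intro m
    have e0 : j ⁻¹ᵁ W = ⊤ := by simp [j]
    have e1 := app_resSec g e0.le ((Q.restrictAppIso j ⊤).inv (resSec Q eW.le m))
    rw [hg] at e1
    change resSec N (eV W le_rfl).ge _ = _
    have e2 : (Q.restrictAppIso j _).inv (resSec Q (eV W le_rfl).le m) =
      resSec (Q.restrict j) e0.le ((Q.restrictAppIso j ⊤).inv (resSec Q eW.le m)) :=
      (resSec_resSec Q eW.le (j.image_mono e0.le) m).symm
    rw [e2, e1]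
    have e3 : resSec Q eW.ge ((Q.restrictAppIso j ⊤).hom ((Q.restrictAppIso j ⊤).inv (resSec Q eW.le m))) = m := 
      (resSec_resSec Q eW.le eW.ge m).trans (resSec_self Q m)
    change resSec N (eV W le_rfl).ge (resSec N (j.image_mono e0.le) (resSec N eW.le (h _))) = _
    rw [e3, resSec_resSec, resSec_resSec, resSec_self]
  · intro V V' hV hV' m
    have e1 := app_resSec g (j.preimage_mono hV') ((Q.restrictAppIso j _).inv (resSec Q (eV V hV).le m))
    refine congr(resSec N (eV V' (hV'.trans hV)).ge ((N.restrictAppIso j _).hom (g.app _ $(hres V V' hV hV' m)))).trans ?_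
    refine congr(resSec N (eV V' (hV'.trans hV)).ge ((N.restrictAppIso j _).hom $e1)).trans ?_
    refine (resSec_resSec N (j.image_mono (j.preimage_mono hV')) (eV V' (hV'.trans hV)).ge _).trans ?_
    exact (resSec_resSec N (eV V hV).ge hV' _).symm

end Extend

/-! ### Actions of `π_* 𝒪_Z` and the sheaf on `Z` they induce -/

section Universal
variable {Z X : Scheme.{u}}

/-- An action of `π_* 𝒪_Z` on the sheaf of abelian groups underlying `E`. -/
structure Act (π : Z ⟶ X) (E : X.Modules) where
  /-- the action on sections -/
  act (V : X.Opens) : Γ(Z, π ⁻¹ᵁ V) →+* AddMonoid.End Γ(E, V)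
  res {V W : X.Opens} (h : W ≤ V) (t : Γ(Z, π ⁻¹ᵁ V)) (m : Γ(E, V)) :
    resSec E h (act V t m) = act W (resFun (π.preimage_mono h) t) (resSec E h m)

/-- A `π_* 𝒪_Z`-linear map from `E` to `π_* N`. -/
structure ActHom {π : Z ⟶ X} {E : X.Modules} (α : Act π E) (N : Z.Modules) where
  /-- the map on sections -/
  map (V : X.Opens) : Γ(E, V) →+ Γ(N, π ⁻¹ᵁ V)
  res {V W : X.Opens} (h : W ≤ V) (m : Γ(E, V)) :
    map W (resSec E h m) = resSec N (π.preimage_mono h) (map V m)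
  smul (V : X.Opens) (t : Γ(Z, π ⁻¹ᵁ V)) (m : Γ(E, V)) : map V (α.act V t m) = t • map V m

/-- For presheaves the left adjoint exists because every pullback object is defined; sheaves inherit
it. The generality is needed for the ringed space `(X, π_* 𝒪_Z)`, which need not be a scheme. -/
lemma isRightAdjoint_pushforward {C D : Type u} [SmallCategory C] [SmallCategory D]
    {J : GrothendieckTopology C} {K : GrothendieckTopology D} {F : C ⥤ D} [F.IsContinuous J K]
    {R : Sheaf K RingCat.{u}} [HasWeakSheafify K AddCommGrpCat.{u}]
    [K.WEqualsLocallyBijective AddCommGrpCat.{u}] {S : Sheaf J RingCat.{u}}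
    (φ : S ⟶ (F.sheafPushforwardContinuous RingCat.{u} J K).obj R) :
    (SheafOfModules.pushforward.{u} φ).IsRightAdjoint := by
  have : (PresheafOfModules.pushforward.{u} (F := F) (R := R.obj) (S := S.obj) φ.hom).IsRightAdjoint :=
    Functor.isRightAdjoint_of_leftAdjointObjIsDefined_eq_top
      (PresheafOfModules.pullbackObjIsDefined_eq_top (F := F) (R := R.obj) (S := S.obj) φ.hom)
  infer_instance

lemma existsUnique_of_adjunction {C D : Type*} [Category* C] [Category* D] {L : C ⥤ D} {R : D ⥤ C}
    (adj : L ⊣ R) {A : C} {B : D} (f : A ⟶ R.obj B) :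
    ∃! g : L.obj A ⟶ B, adj.unit.app A ≫ R.map g = f :=
  ⟨(adj.homEquiv _ _).symm f, (adj.homEquiv_unit ..).symm.trans ((adj.homEquiv _ _).apply_symm_apply f),
    fun _ hg => ((adj.homEquiv _ _).symm_apply_eq.mpr (hg.symm.trans (adj.homEquiv_unit ..).symm)).symm⟩

/-- The sheaf of rings `π_* 𝒪_Z`. -/
abbrev pushRing (π : Z ⟶ X) : Sheaf (Opens.grothendieckTopology X) RingCat.{u} :=
  ((TopologicalSpace.Opens.map π.base).sheafPushforwardContinuous RingCat.{u} (Opens.grothendieckTopology X)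
    (Opens.grothendieckTopology Z)).obj Z.ringCatSheaf

/-- The push-forward of modules from `𝒪_Z` to `π_* 𝒪_Z`. -/
abbrev pushMod (π : Z ⟶ X) : SheafOfModules.{u} Z.ringCatSheaf ⥤ SheafOfModules.{u} (pushRing π) :=
  SheafOfModules.pushforward (𝟙 (pushRing π))

instance (π : Z ⟶ X) : (pushMod π).IsRightAdjoint :=
  isRightAdjoint_pushforward (C := X.Opens) (D := Z.Opens) (K := Opens.grothendieckTopology Z)
    (R := Z.ringCatSheaf) (𝟙 (pushRing π))

/-- `E` as a sheaf of `π_* 𝒪_Z`-modules. -/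
def Act.toSheaf {π : Z ⟶ X} {E : X.Modules} (α : Act π E) : SheafOfModules.{u} (pushRing π) where
  val := 
    letI (V : X.Opensᵒᵖ) : Module ((pushRing π).obj.obj V) (E.presheaf.obj V) :=
      { smul := fun t m => α.act V.unop t m
        one_smul := fun m => congr($((α.act V.unop).map_one) m)
        mul_smul := fun s t m => congr($((α.act V.unop).map_mul s t) m)
        smul_zero := fun t => map_zero (α.act V.unop t)
        smul_add := fun t => map_add (α.act V.unop t)
        add_smul := fun s t m => congr($((α.act V.unop).map_add s t) m)
        zero_smul := fun m => congr($((α.act V.unop).map_zero) m) }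
    PresheafOfModules.ofPresheaf E.presheaf fun V W i t m => α.res i.unop.le t m
  isSheaf := E.isSheaf

/-- The sheaf of `𝒪_Z`-modules induced by a sheaf of `π_* 𝒪_Z`-modules represents the
`π_* 𝒪_Z`-linear maps. -/
lemma Act.exists_universal {π : Z ⟶ X} {E : X.Modules} (α : Act π E) :
    ∃ (M : Z.Modules) (η : ActHom α M), ∀ (N : Z.Modules) (h : ActHom α N),
      ∃! g : M ⟶ N, ∀ (V : X.Opens) (m : Γ(E, V)), g.app (π ⁻¹ᵁ V) (η.map V m) = h.map V m := by
  let adj := Adjunction.ofIsRightAdjoint (pushMod π)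
  let M : Z.Modules := (pushMod π).leftAdjoint.obj α.toSheaf
  let η := adj.unit.app α.toSheaf
  let toActHom : ∀ {N : Z.Modules} (h : α.toSheaf ⟶ (pushMod π).obj N), ActHom α N := fun {N} h =>
    { map := fun V => (h.val.app (.op V)).hom.toAddMonoidHom
      res := fun {V W} i m => congr($(h.val.naturality (homOfLE i).op) m)
      smul := fun V t m => (h.val.app (.op V)).hom.map_smul t m }
  let ofActHom : ∀ {N : Z.Modules} (h : ActHom α N), (α.toSheaf ⟶ (pushMod π).obj N) := fun {N} h =>

    ⟨PresheafOfModules.homMk (M₁ := α.toSheaf.val) (M₂ := ((pushMod π).obj N).val)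
      { app := fun V => AddCommGrpCat.ofHom (h.map V.unop)
        naturality := fun V W i => by
          ext m
          exact h.res i.unop.le m } fun V t m => h.smul V.unop t m⟩
  refine ⟨M, toActHom η, fun N h => ?_⟩
  obtain ⟨g, hg, hu⟩ := existsUnique_of_adjunction adj (ofActHom h)
  refine ⟨g, fun V m => congr(($hg).val.app (.op V) m), fun g' hg' => hu g' ?_⟩
  ext V m
  exact hg' V.unop m

end Universal

/-! ### Extension of `π_* 𝒪_Z`-linear maps for affine `π` -/

section ActExtend
variable {Z X : Scheme.{u}}

lemma exists_resFun_eq {W : Z.Opens} (hW : IsAffineOpen W) (f : Γ(Z, W)) {D : Z.Opens}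
    (hD : D = Z.basicOpen f) (hDW : D ≤ W) (s : Γ(Z, D)) :
    ∃ (n : ℕ) (t : Γ(Z, W)), resFun hDW t = resFun hDW (f ^ n) * s := by
  subst hD
  have := hW.isLocalization_basicOpen f
  obtain ⟨⟨t, ⟨_, n, rfl⟩⟩, ht⟩ := IsLocalization.surj (.powers f) s
  exact ⟨n, t, (ht.symm.trans (mul_comm _ _) :)⟩

lemma exists_pow_mul_eq_zero {W : Z.Opens} (hW : IsAffineOpen W) (f : Γ(Z, W)) {D : Z.Opens}
    (hD : D = Z.basicOpen f) (hDW : D ≤ W) (t : Γ(Z, W)) (h : resFun hDW t = 0) :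
    ∃ n : ℕ, f ^ n * t = 0 := by
  subst hD
  have := hW.isLocalization_basicOpen f
  obtain ⟨⟨_, n, rfl⟩, ht⟩ := (IsLocalization.map_eq_zero_iff (.powers f) Γ(Z, Z.basicOpen f) t).mp h
  exact ⟨n, ht⟩

lemma isUnit_resFun {W V : Z.Opens} (f : Γ(Z, W)) (hVW : V ≤ W) (hV : V ≤ Z.basicOpen f) :
    IsUnit (resFun hVW f) := by
  rw [← resFun_resFun (Z.basicOpen_le f) hV]
  exact (RingedSpace.isUnit_res_basicOpen Z.toRingedSpace f).map _

lemma smul_pow_cancel (N : Z.Modules) {W V : Z.Opens} (f : Γ(Z, W)) (hVW : V ≤ W)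
    (hV : V ≤ Z.basicOpen f) (n : ℕ) {s t : Γ(N, V)}
    (h : resFun hVW (f ^ n) • s = resFun hVW (f ^ n) • t) : s = t := by
  rw [map_pow] at h
  exact ((isUnit_resFun f hVW hV).pow n).smul_left_cancel.mp h

/-- Linear families of maps out of a quasi-coherent sheaf that agree on an affine open agree on its
open subsets. -/
lemma family_ext {E : X.Modules} (hE : SheafOfModules.IsQuasicoherent.{u} E) (N : X.Modules)
    {U : X.Opens} (hU : IsAffineOpen U)
    (g g' : ∀ V : X.Opens, V ≤ U → (Γ(E, V) →ₗ[Γ(X, V)] Γ(N, V)))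
    (hg : ∀ (V V' : X.Opens) (hV : V ≤ U) (hV' : V' ≤ V) (m : Γ(E, V)),
        g V' (hV'.trans hV) (resSec E hV' m) = resSec N hV' (g V hV m))
    (hg' : ∀ (V V' : X.Opens) (hV : V ≤ U) (hV' : V' ≤ V) (m : Γ(E, V)),
        g' V' (hV'.trans hV) (resSec E hV' m) = resSec N hV' (g' V hV m))
    (h : ∀ m, g U le_rfl m = g' U le_rfl m) (V : X.Opens) (hV : V ≤ U) (m : Γ(E, V)) :
    g V hV m = g' V hV m := by
  refine section_ext N _ _ fun x hx => ?_
  obtain ⟨f, hfV, hxf⟩ := hU.exists_basicOpen_le ⟨x, hx⟩ (hV hx)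
  refine ⟨X.basicOpen f, hfV, hxf, ?_⟩
  rw [← hg, ← hg']
  generalize resSec E hfV m = m₁
  obtain ⟨n, t, ht⟩ := exists_resSec_eq hE hU f rfl (X.basicOpen_le f) m₁
  refine smul_pow_cancel N f (X.basicOpen_le f) le_rfl n ?_
  rw [← map_smul, ← map_smul, ← ht]
  exact (hg _ _ le_rfl _ t).trans (congr(resSec N _ $(h t)).trans (hg' _ _ le_rfl _ t).symm)

lemma Act.act_mul {π : Z ⟶ X} {E : X.Modules} (α : Act π E) (V : X.Opens)
    (s t : Γ(Z, π ⁻¹ᵁ V)) (m : Γ(E, V)) : α.act V (s * t) m = α.act V s (α.act V t m) :=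
  congr($((α.act V).map_mul s t) m)

/-- A `Γ(Z, π⁻¹(U))`-linear map from `Γ(E, U)` extends to a `π_* 𝒪_Z`-linear map on `U`. -/
lemma Act.exists_extend {π : Z ⟶ X} [IsAffineHom π] {E : X.Modules} (α : Act π E)
    (hE : SheafOfModules.IsQuasicoherent.{u} E)
    (hα : ∀ V a m, α.act V (π.app V a) m = a • m) (N : Z.Modules)
    {U : X.Opens} (hU : IsAffineOpen U) (k : Γ(E, U) →+ Γ(N, π ⁻¹ᵁ U))
    (hk : ∀ t m, k (α.act U t m) = t • k m) :
    ∃ g : ∀ V : X.Opens, V ≤ U → (Γ(E, V) →+ Γ(N, π ⁻¹ᵁ V)),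
      (∀ m, g U le_rfl m = k m) ∧
      (∀ (V V' : X.Opens) (hV : V ≤ U) (hV' : V' ≤ V) (m : Γ(E, V)),
        g V' (hV'.trans hV) (resSec E hV' m) = resSec N (π.preimage_mono hV') (g V hV m)) ∧
      ∀ (V : X.Opens) (hV : V ≤ U) (t : Γ(Z, π ⁻¹ᵁ V)) (m : Γ(E, V)),
        g V hV (α.act V t m) = t • g V hV m := by
  have hU' : IsAffineOpen (π ⁻¹ᵁ U) := hU.preimage π
  let N' := (Scheme.Modules.pushforward π).obj N
  let k' : Γ(E, U) →ₗ[Γ(X, U)] Γ(N', U) :=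
    { toFun := k
      map_add' := map_add k
      map_smul' := fun a m => (congr(k $(hα U a m)).symm.trans (hk _ _) :) }
  obtain ⟨g, hg, hgr⟩ := AzumayaBrane.exists_extend E N' hU
    (Scheme.Modules.isQuasicoherent_restrictFunctor _ E) k'
  refine ⟨fun V hV => (g V hV).toAddMonoidHom, hg, hgr, fun V hV t m => ?_⟩
  refine section_ext N' (U := V) _ _ fun x hx => ?_
  obtain ⟨f, hfV, hxf⟩ := hU.exists_basicOpen_le ⟨x, hx⟩ (hV hx)
  refine ⟨X.basicOpen f, hfV, hxf, ?_⟩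
  have e1 := hgr V _ hV hfV (α.act V t m)
  rw [α.res] at e1
  refine e1.symm.trans (Eq.trans ?_ (resSec_smul N (π.preimage_mono hfV) t (g V hV m)).symm)
  refine Eq.trans ?_ (congrArg (fun y : Γ(N, π ⁻¹ᵁ X.basicOpen f) =>
    resFun (π.preimage_mono hfV) t • y) (hgr V _ hV hfV m))
  generalize resFun (π.preimage_mono hfV) t = t₁
  generalize resSec E hfV m = m₁
  have hD := Scheme.preimage_basicOpen π f
  -- The extension is so far only `𝒪_X`-linear. On `D(f)` both `f ^ n • m₁` and `f ^ l * t₁` come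
  -- from `U`, where `hk` gives linearity over functions on `Z`; then `f ^ (n + l)` can be cancelled
  -- because it is invertible on `D(f)`.
  obtain ⟨n, m₂, hm⟩ := exists_resSec_eq hE hU f rfl (X.basicOpen_le f) m₁
  obtain ⟨l, t₂, ht⟩ := exists_resFun_eq hU' (π.app U f) hD
    (π.preimage_mono (X.basicOpen_le f)) t₁
  have e2 : resFun (π.preimage_mono (X.basicOpen_le f)) (π.app U f ^ l) =
      π.app _ (resFun (X.basicOpen_le f) (f ^ l)) := by
    rw [← map_pow]; exact (app_resFun π _ _).symm
  rw [e2] at ht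
  generalize hfl : resFun (X.basicOpen_le f) (f ^ l) = fl at *
  generalize hfn : resFun (X.basicOpen_le f) (f ^ n) = fn at *
  have hu : fn * fl = resFun (X.basicOpen_le f) (f ^ (n + l)) := by
    rw [pow_add, map_mul, ← hfl, ← hfn]
  refine smul_pow_cancel N' f (X.basicOpen_le f) le_rfl (n + l) ?_
  rw [← hu]
  have hU₁ : X.basicOpen f ≤ U := X.basicOpen_le f
  have e3 : α.act _ (resFun (π.preimage_mono hU₁) t₂) (resSec E hU₁ m₂) =
      (fn * fl) • α.act _ t₁ m₁ := by
    rw [ht, hm, map_mul, mul_comm fn, mul_smul]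
    change α.act _ _ (α.act _ t₁ _) = _
    rw [hα, ← hα _ fn, ← hα _ fn]
    rw [← α.act_mul, ← α.act_mul, mul_comm]
  change (fn * fl) • g _ hU₁ _ = _
  rw [← map_smul, ← e3, ← α.res, hgr _ _ le_rfl hU₁, hg]
  refine congr(resSec N' hU₁ $(hk t₂ m₂)).trans ?_
  refine (resSec_smul N (π.preimage_mono hU₁) t₂ (k m₂)).trans ?_
  have e4 := hgr _ _ le_rfl hU₁ m₂
  rw [hg, hm, map_smul] at e4
  have e5 : resSec N (π.preimage_mono hU₁) (k m₂) =
      π.app _ fn • (show Γ(N, π ⁻¹ᵁ X.basicOpen f) from g _ hU₁ m₁) := e4.symm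
  rw [e5, ht]
  change (π.app _ fl * t₁) • (π.app _ fn • (show Γ(N, π ⁻¹ᵁ X.basicOpen f) from g _ hU₁ m₁)) =
    π.app _ (fn * fl) • (t₁ • (show Γ(N, π ⁻¹ᵁ X.basicOpen f) from g _ hU₁ m₁))
  rw [smul_smul, smul_smul, map_mul]
  congr 1
  ring

end ActExtend

/-! ### Linear maps into push-forwards from an affine open -/

section ActModule
variable {Z X : Scheme.{u}}

/-- The morphism of modules given by a natural family of linear maps. -/
def homOfFamily {E N : X.Modules} (g : ∀ V : X.Opens, Γ(E, V) →ₗ[Γ(X, V)] Γ(N, V))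
    (hg : ∀ (V V' : X.Opens) (h : V' ≤ V) (m : Γ(E, V)), g V' (resSec E h m) = resSec N h (g V m)) :
    E ⟶ N :=
  ⟨PresheafOfModules.homMk (M₁ := E.val) (M₂ := N.val)
    { app := fun V => AddCommGrpCat.ofHom (g V.unop).toAddMonoidHom
      naturality := fun V W i => by
        ext m
        exact hg _ _ i.unop.le m } fun V t m => (g V.unop).map_smul t m⟩

lemma modules_hom_ext {E N : X.Modules} {f g : E ⟶ N} (h : ∀ V m, f.app V m = g.app V m) : f = g :=
  Scheme.Modules.hom_ext _ _ fun V => by ext m; exact h V m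

lemma exists_affine_mem {U : X.Opens} {x : X} (hx : x ∈ U) :
    ∃ W : X.Opens, IsAffineOpen W ∧ x ∈ W ∧ W ≤ U := by
  obtain ⟨_, ⟨W, hW, rfl⟩, hxW, hWU⟩ :=
    X.isBasis_affineOpens.exists_subset_of_mem_open (SetLike.mem_coe.mpr hx) U.isOpen
  exact ⟨W, hW, hxW, hWU⟩

/-- A morphism that is bijective on sections over affine opens is an isomorphism. -/
lemma isIso_of_bijective {E N : X.Modules} (g : E ⟶ N)
    (hg : ∀ U : X.Opens, IsAffineOpen U → Function.Bijective (g.app U)) : IsIso g := by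
  refine Scheme.Modules.Hom.isIso_iff_isIso_app.mpr fun U =>
    (ConcreteCategory.isIso_iff_bijective _).mpr ⟨fun s t h => ?_, fun s => ?_⟩
  · refine section_ext E s t fun x hx => ?_
    obtain ⟨W, hW, hxW, hWU⟩ := exists_affine_mem hx
    refine ⟨W, hWU, hxW, (hg W hW).1 ?_⟩
    rw [app_resSec, app_resSec, h]
  · choose W hW hxW hWU using fun x : U => exists_affine_mem x.2
    choose t ht using fun x : U => (hg (W x) (hW x)).2 (resSec N (hWU x) s)
    obtain ⟨t', ht'⟩ := exists_glue E W U hWU (fun x hx => ⟨⟨x, hx⟩, hxW _⟩) t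
      fun i j z hz => by
        obtain ⟨V, hV, hzV, hVle⟩ := exists_affine_mem hz
        refine ⟨V, hVle.trans inf_le_left, hVle.trans inf_le_right, hzV, (hg V hV).1 ?_⟩
        rw [app_resSec, app_resSec, ht, ht, resSec_resSec, resSec_resSec]
    refine ⟨t', section_ext N _ _ fun x hx => ⟨W ⟨x, hx⟩, hWU _, hxW ⟨x, hx⟩, ?_⟩⟩
    rw [← app_resSec, ht', ht]

lemma hom_ext_of_app_top {R : CommRingCat.{u}} {Q N : (Spec R).Modules}
    (hQ : SheafOfModules.IsQuasicoherent.{u} Q) {f g : Q ⟶ N}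
    (h : ∀ m, f.app ⊤ m = g.app ⊤ m) : f = g :=
  modules_hom_ext fun V m => family_ext hQ N (isAffineOpen_top (Spec R)) (fun V _ => appLin f V)
    (fun V _ => appLin g V) (fun _ _ _ h' m => app_resSec f h' m)
    (fun _ _ _ h' m => app_resSec g h' m) h V le_top m

lemma isQuasicoherent_of_fromSpec (M : Z.Modules)
    (h : ∀ z : Z, ∃ (W : Z.Opens) (hW : IsAffineOpen W), z ∈ W ∧
      SheafOfModules.IsQuasicoherent.{u} (M.restrict hW.fromSpec)) :
    SheafOfModules.IsQuasicoherent.{u} M := by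
  refine isQuasicoherent_of_presentation M fun z => ?_
  obtain ⟨W, hW, hz, h⟩ := h z
  refine ⟨W, hz, ?_⟩
  let P := presentationOfIso (@asIso _ _ _ _ (M.restrict hW.fromSpec).fromTildeΓ
    ((isQuasicoherent_iff_isIso_fromTildeΓ _).mp h))
    (presentationTilde _ Set.univ (by simp) _ (Submodule.span_eq _))
  let P' := Scheme.Modules.presentationRestrict hW.isoSpec.hom P
  have e : hW.isoSpec.hom ≫ hW.fromSpec = W.ι := by simp
  exact ⟨presentationOfIso (((Scheme.Modules.restrictFunctorComp _ _).symm ≪≫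
    (Scheme.Modules.restrictFunctorCongr e)).app M) P'⟩

variable {π : Z ⟶ X} {E : X.Modules} {α : Act π E}

/-- The composition of a `π_* 𝒪_Z`-linear map with a morphism. -/
def ActHom.comp {M N : Z.Modules} (η : ActHom α M) (f : M ⟶ N) : ActHom α N where
  map V := (f.app (π ⁻¹ᵁ V)).hom.comp (η.map V)
  res h m := (congr(f.app _ $(η.res h m))).trans (app_resSec f _ _)
  smul V t m := (congr(f.app _ $(η.smul V t m))).trans (f.app_smul t _)

/-- The underlying linear map. -/
def ActHom.lin {N : Z.Modules} (hα : ∀ V a m, α.act V (π.app V a) m = a • m) (h : ActHom α N)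
    (V : X.Opens) : Γ(E, V) →ₗ[Γ(X, V)] Γ((Scheme.Modules.pushforward π).obj N, V) where
  toFun := h.map V
  map_add' := map_add (h.map V)
  map_smul' a m := (congr(h.map V $(hα V a m)).symm.trans (h.smul _ _ _) :)

lemma fromSpec_app_self_apply {W : Z.Opens} (hW : IsAffineOpen W) (t : Γ(Z, W)) :
    hW.fromSpec.app W t = (Spec Γ(Z, W)).presheaf.map (TopologicalSpace.Opens.leTop _).op
      ((Scheme.ΓSpecIso Γ(Z, W)).inv t) := by
  rw [IsAffineOpen.fromSpec_app_self]
  rfl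

section FromSpec
variable {W : Z.Opens} (hW : IsAffineOpen W) (N : (Spec Γ(Z, W)).Modules)

/-- The push-forward along `Spec Γ(Z, W) ⟶ Z`. -/
abbrev pushFromSpec : Z.Modules := (Scheme.Modules.pushforward hW.fromSpec).obj N

lemma preimage_fromSpec_le {O O' : Z.Opens} (h : O ⊓ W ≤ O') :
    hW.fromSpec ⁻¹ᵁ O ≤ hW.fromSpec ⁻¹ᵁ O' := fun z hz =>
  h ⟨hz, hW.opensRange_fromSpec.le ⟨z, rfl⟩⟩

/-- Sections of the push-forward along `Spec Γ(Z, W) ⟶ Z` extend from the intersection with `W`. -/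
def extendSec {O O' : Z.Opens} (h : O ⊓ W ≤ O') :
    Γ(pushFromSpec hW N, O') →+ Γ(pushFromSpec hW N, O) :=
  (N.presheaf.map (homOfLE (preimage_fromSpec_le hW h)).op).hom

lemma extendSec_resSec_self {O O' : Z.Opens} (h : O ⊓ W ≤ O') (h' : O' ≤ O)
    (x : Γ(pushFromSpec hW N, O)) : extendSec hW N h (resSec (pushFromSpec hW N) h' x) = x :=
  (resSec_resSec N (hW.fromSpec.preimage_mono h') (preimage_fromSpec_le hW h) x).trans
    (resSec_self N (U := hW.fromSpec ⁻¹ᵁ O) x)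

lemma extendSec_resSec {O O' O₁ O₁' : Z.Opens} (h : O ⊓ W ≤ O') (h₁ : O₁ ⊓ W ≤ O₁')
    (i' : O₁' ≤ O') (i : O₁ ≤ O) (x : Γ(pushFromSpec hW N, O')) :
    extendSec hW N h₁ (resSec (pushFromSpec hW N) i' x) =
      resSec (pushFromSpec hW N) i (extendSec hW N h x) :=
  (resSec_resSec N (hW.fromSpec.preimage_mono i') (preimage_fromSpec_le hW h₁) x).trans
    (resSec_resSec N (preimage_fromSpec_le hW h) (hW.fromSpec.preimage_mono i) x).symm

lemma extendSec_smul {O O' : Z.Opens} (h : O ⊓ W ≤ O') (h' : O' ≤ O) (t : Γ(Z, O))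
    (x : Γ(pushFromSpec hW N, O')) :
    extendSec hW N h (resFun h' t • x) = t • extendSec hW N h x := by
  refine (resSec_smul N (preimage_fromSpec_le hW h) (hW.fromSpec.app _ (resFun h' t)) x).trans
    (congrArg (fun a => a • resSec N (preimage_fromSpec_le hW h) x) ?_)
  refine congr(resFun (preimage_fromSpec_le hW h) $(app_resFun hW.fromSpec _ t)).trans ?_
  rw [resFun_resFun, resFun_self]
  rfl

lemma resSec_smul_top (t : Γ(Z, W)) (x : Γ(N, ⊤)) :
    resSec N (le_top : hW.fromSpec ⁻¹ᵁ W ≤ ⊤) (t • x) =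
      (show Γ(pushFromSpec hW N, W) from
        t • (show Γ(pushFromSpec hW N, W) from resSec N le_top x)) := by
  rw [Scheme.Modules.smul_Spec_def, resSec_smul]
  refine congrArg (fun a => a • resSec N (le_top : hW.fromSpec ⁻¹ᵁ W ≤ ⊤) x) ?_
  exact (resFun_resFun _ _ _).trans (fromSpec_app_self_apply hW t).symm

end FromSpec

lemma preimage_inf_le (V U : X.Opens) : π ⁻¹ᵁ V ⊓ π ⁻¹ᵁ U ≤ π ⁻¹ᵁ (V ⊓ U) := le_rfl

/-- The target is pushed forward from `π⁻¹(U)`, so its sections over `π⁻¹(V)` and over `π⁻¹(V ⊓ U)`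
agree. This reduces to open subsets of `U`, where `family_ext` applies. -/
lemma actHom_ext [IsAffineHom π] (hE : SheafOfModules.IsQuasicoherent.{u} E)
    (hα : ∀ V a m, α.act V (π.app V a) m = a • m) {U : X.Opens} (hU : IsAffineOpen U)
    (N : (Spec Γ(Z, π ⁻¹ᵁ U)).Modules)
    (h h' : ActHom α (pushFromSpec (hU.preimage π) N))
    (e : ∀ m, h.map U m = h'.map U m) (V : X.Opens) (m : Γ(E, V)) : h.map V m = h'.map V m := by
  have key : h.map (V ⊓ U) (resSec E inf_le_left m) = h'.map (V ⊓ U) (resSec E inf_le_left m) :=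
    family_ext hE _ hU (fun V _ => h.lin hα V) (fun V _ => h'.lin hα V)
      (fun _ _ _ i m => h.res i m) (fun _ _ _ i m => h'.res i m) e (V ⊓ U) inf_le_right
      (resSec E inf_le_left m)
  rw [h.res, h'.res] at key
  rw [← extendSec_resSec_self (hU.preimage π) N (preimage_inf_le V U) (π.preimage_mono inf_le_left)
    (h.map V m), key, extendSec_resSec_self]

/-- On opens inside `U` the map is given by `Act.exists_extend`. For general `V`, restrict the
section to `V ⊓ U`, apply the map there, and use `extendSec` to regard the result as a section over
`π⁻¹(V)`. Together with `actHom_ext`, linear maps into such a push-forward are determined by, and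
can be prescribed by, their effect on `Γ(E, U)`. -/
lemma exists_actHom [IsAffineHom π] (hE : SheafOfModules.IsQuasicoherent.{u} E)
    (hα : ∀ V a m, α.act V (π.app V a) m = a • m) {U : X.Opens} (hU : IsAffineOpen U)
    (N : (Spec Γ(Z, π ⁻¹ᵁ U)).Modules) (k : Γ(E, U) →+ Γ(N, ⊤))
    (hk : ∀ (t : Γ(Z, π ⁻¹ᵁ U)) m, k (α.act U t m) = t • k m) :
    ∃ h : ActHom α (pushFromSpec (hU.preimage π) N),
      ∀ m, h.map U m = resSec N le_top (k m) := by
  let N' := pushFromSpec (hU.preimage π) N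
  let k' : Γ(E, U) →+ Γ(N', π ⁻¹ᵁ U) := AddMonoidHom.comp (N := Γ(N, ⊤)) (N.presheaf.map
    (homOfLE (le_top : (hU.preimage π).fromSpec ⁻¹ᵁ (π ⁻¹ᵁ U) ≤ ⊤)).op).hom k
  have hk' (m) : k' m = resSec N le_top (k m) := rfl
  clear_value k'
  obtain ⟨g, h1, h2, h3⟩ := α.exists_extend hE hα N' hU k' (fun t m => by
    rw [hk', hk', hk]
    exact resSec_smul_top (hU.preimage π) N t (k m))
  let ρ (V : X.Opens) : Γ(N', π ⁻¹ᵁ (V ⊓ U)) →+ Γ(N', π ⁻¹ᵁ V) :=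
    extendSec (hU.preimage π) N (preimage_inf_le V U)
  refine ⟨⟨fun V => (ρ V).comp ((g (V ⊓ U) inf_le_right).comp
    (E.presheaf.map (homOfLE inf_le_left).op).hom), fun {V W} i m => ?_, fun V t m => ?_⟩, fun m => ?_⟩
  · have e := h2 (V ⊓ U) (W ⊓ U) inf_le_right (inf_le_inf_right _ i) (resSec E inf_le_left m)
    rw [resSec_resSec] at e
    refine Eq.trans ?_ (extendSec_resSec (hU.preimage π) N (preimage_inf_le V U)
      (preimage_inf_le W U) (π.preimage_mono (inf_le_inf_right _ i)) (π.preimage_mono i) 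
      (g (V ⊓ U) inf_le_right (resSec E inf_le_left m)))
    refine Eq.trans ?_ congr(ρ W $e)
    exact congr(ρ W (g _ _ $(resSec_resSec E i inf_le_left m)))
  · refine Eq.trans ?_ (extendSec_smul (hU.preimage π) N (preimage_inf_le V U)
      (π.preimage_mono inf_le_left) t (g (V ⊓ U) inf_le_right (resSec E inf_le_left m)))
    exact congr(ρ V $((congr(g (V ⊓ U) _ $(α.res inf_le_left t m))).trans (h3 _ _ _ _)))
  · have e := h2 U (U ⊓ U) le_rfl inf_le_right m
    rw [h1] at e
    have e2 := extendSec_resSec_self (hU.preimage π) N (preimage_inf_le U U) 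
      (π.preimage_mono inf_le_right) (k' m)
    exact (congr(ρ U $e).trans e2).trans (hk' m)

end ActModule

/-! ### Sheaves with an action of `π_* 𝒪_Z` come from `Z` -/

section ActModule
variable {Z X : Scheme.{u}} {π : Z ⟶ X} {E : X.Modules} {α : Act π E}

lemma exists_restrict_hom {W : Z.Opens} (hW : IsAffineOpen W) {M : Z.Modules}
    {N : (Spec Γ(Z, W)).Modules} (a : M ⟶ pushFromSpec hW N) :
    ∃ a' : M.restrict hW.fromSpec ⟶ N, ∀ (O : Z.Opens) (x : Γ(M, O)),
      a'.app (hW.fromSpec ⁻¹ᵁ O) ((M.restrictAppIso hW.fromSpec _).inv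
        (resSec M (hW.fromSpec.image_preimage_le O) x)) = a.app O x := by
  obtain ⟨a', ha', -⟩ := existsUnique_of_adjunction (Scheme.Modules.restrictAdjunction hW.fromSpec) a
  exact ⟨a', fun O x => congr(($ha').app O x)⟩

lemma image_fromSpec_top {W : Z.Opens} (hW : IsAffineOpen W) : hW.fromSpec ''ᵁ ⊤ = W := by simp

/-- The sections of `M` over an affine open `W`, as global sections on `Spec Γ(Z, W)`. -/
def restrictTop {W : Z.Opens} (hW : IsAffineOpen W) (M : Z.Modules) :
    Γ(M, W) ≃+ Γ(M.restrict hW.fromSpec, ⊤) where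
  toFun x := (M.restrictAppIso hW.fromSpec _).inv (resSec M (image_fromSpec_top hW).le x)
  invFun x := resSec M (image_fromSpec_top hW).ge ((M.restrictAppIso hW.fromSpec _).hom x)
  left_inv x := (resSec_resSec M (image_fromSpec_top hW).le (image_fromSpec_top hW).ge x).trans
    (resSec_self M x)
  right_inv x := (resSec_resSec M (U := hW.fromSpec ''ᵁ ⊤) (image_fromSpec_top hW).ge 
    (image_fromSpec_top hW).le x).trans (resSec_self M (U := hW.fromSpec ''ᵁ ⊤) x)
  map_add' x y := resSec_add M _ x y

lemma restrictTop_smul {W : Z.Opens} (hW : IsAffineOpen W) (M : Z.Modules) (t : Γ(Z, W))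
    (x : Γ(M, W)) : restrictTop hW M (t • x) = t • restrictTop hW M x := by
  apply (restrictTop hW M).symm.injective
  refine ((restrictTop hW M).symm_apply_apply _).trans ?_
  refine Eq.trans ?_ congr(resSec M (image_fromSpec_top hW).ge $((smul_restrict_fromSpec M hW ⊤ 
    (image_fromSpec_top hW).le t (restrictTop hW M x)).symm))
  rw [resSec_smul, resFun_resFun, resFun_self]
  exact congrArg (t • ·) ((restrictTop hW M).symm_apply_apply x).symm

lemma restrictTop_resSec {W : Z.Opens} (hW : IsAffineOpen W) (M : Z.Modules) (x : Γ(M, W)) :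
    (M.restrictAppIso hW.fromSpec _).inv (resSec M (hW.fromSpec.image_preimage_le W) x) = 
      resSec (M.restrict hW.fromSpec) le_top (restrictTop hW M x) :=
  (resSec_resSec M (image_fromSpec_top hW).le (hW.fromSpec.image_mono le_top) x).symm

lemma resSec_top_injective {W : Z.Opens} (hW : IsAffineOpen W) (N : (Spec Γ(Z, W)).Modules) :
    Function.Injective (resSec N (le_top : hW.fromSpec ⁻¹ᵁ W ≤ ⊤)) := by
  intro x y h
  have e : ⊤ ≤ hW.fromSpec ⁻¹ᵁ W := by simp
  have := congr(resSec N e $h)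
  simpa using this

/-- An `A`-module as the global sections of a quasi-coherent sheaf. -/
lemma exists_isQuasicoherent_top (A : CommRingCat.{u}) (M : Type u) [AddCommGroup M] [Module A M] :
    ∃ (T : (Spec A).Modules) (e : M ≃+ Γ(T, ⊤)), SheafOfModules.IsQuasicoherent.{u} T ∧
      ∀ (a : A) (m : M), e (a • m) = a • e m := by
  let e := (tilde.isoTop (ModuleCat.of A M)).toLinearEquiv
  exact ⟨tilde (ModuleCat.of A M), e.toAddEquiv, inferInstance, fun a m => e.map_smul a m⟩

/-- Let `j` be the inclusion of `Spec Γ(Z, π⁻¹(U))`. Morphisms from the restriction of `M` to a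
sheaf `N` are morphisms `M ⟶ j_* N`, that is, `π_* 𝒪_Z`-linear maps from `E` to `j_* N`, that is,
linear maps `Γ(E, U) ⟶ Γ(N, ⊤)`. The tilde `T` of `Γ(E, U)` represents the same maps, so it is the
restriction of `M`; the proof writes down the two mutually inverse morphisms. -/
lemma universal_spec [IsAffineHom π] (hE : SheafOfModules.IsQuasicoherent.{u} E)
    (hα : ∀ V a m, α.act V (π.app V a) m = a • m) {M : Z.Modules} (η : ActHom α M)
    (hη : ∀ (N : Z.Modules) (h : ActHom α N),
      ∃! g : M ⟶ N, ∀ (V : X.Opens) (m : Γ(E, V)), g.app (π ⁻¹ᵁ V) (η.map V m) = h.map V m)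
    {U : X.Opens} (hU : IsAffineOpen U) :
    SheafOfModules.IsQuasicoherent.{u} (M.restrict (hU.preimage π).fromSpec) ∧
      Function.Bijective (η.map U) := by
  let hW := hU.preimage π
  let A := Γ(Z, π ⁻¹ᵁ U)
  let : Module A Γ(E, U) := Module.compHom Γ(E, U) (α.act U)
  obtain ⟨T, kT, hT, hkT⟩ := exists_isQuasicoherent_top A Γ(E, U)
  obtain ⟨h, hh⟩ := exists_actHom hE hα hU T kT.toAddMonoidHom hkT
  obtain ⟨a, ha, -⟩ := hη _ h
  obtain ⟨a', ha'⟩ := exists_restrict_hom hW a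
  have ha'' (m) : a'.app ⊤ (restrictTop hW M (η.map U m)) = kT m := by
    apply resSec_top_injective hW
    have e1 := ha' _ (η.map U m)
    rw [restrictTop_resSec, app_resSec, ha, hh] at e1
    exact e1
  obtain ⟨b, hb⟩ := exists_hom_of_linearMap T (M.restrict hW.fromSpec)
    { toFun := fun y => restrictTop hW M (η.map U (kT.symm y))
      map_add' := fun x y => by simp
      map_smul' := fun t y => by
        obtain ⟨m, rfl⟩ := kT.surjective y
        rw [← hkT, kT.symm_apply_apply, kT.symm_apply_apply]
        exact congr(restrictTop hW M $(η.smul U t m)).trans (restrictTop_smul _ _ _ _) }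
  replace hb (m) : b.app ⊤ (kT m) = restrictTop hW M (η.map U m) :=
    (hb _).trans congr(restrictTop hW M (η.map U $(kT.symm_apply_apply m)))
  have hba : b ≫ a' = 𝟙 T := hom_ext_of_app_top hT fun y => by
    obtain ⟨m, rfl⟩ := kT.surjective y
    exact congr(a'.app ⊤ $(hb m)).trans (ha'' m)
  -- Nothing is yet known about quasi-coherence of the restriction of `M`, so equality is tested
  -- after adjunction, by the uniqueness in the universal property of `M`; there it suffices to
  -- compare on `Γ(E, U)`.
  have hab : a' ≫ b = 𝟙 _ := by
    apply ((Scheme.Modules.restrictAdjunction hW.fromSpec).homEquiv _ _).injective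
    let f₁ : M ⟶ pushFromSpec hW (M.restrict hW.fromSpec) :=
      (Scheme.Modules.restrictAdjunction hW.fromSpec).homEquiv _ _ (a' ≫ b)
    let f₂ : M ⟶ pushFromSpec hW (M.restrict hW.fromSpec) :=
      (Scheme.Modules.restrictAdjunction hW.fromSpec).homEquiv _ _ (𝟙 _)
    refine (hη _ (η.comp f₂)).unique (y₁ := f₁) (y₂ := f₂) ?_ (fun V m => rfl)
    refine actHom_ext hE hα hU _ (η.comp f₁) (η.comp f₂) fun m => ?_
    have e1 : (a' ≫ b).app ⊤ (restrictTop hW M (η.map U m)) = 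
        (𝟙 (M.restrict hW.fromSpec) :).app ⊤ (restrictTop hW M (η.map U m)) := 
      congr(b.app ⊤ $(ha'' m)).trans (hb m)
    have e2 := congr(resSec _ (le_top : hW.fromSpec ⁻¹ᵁ (π ⁻¹ᵁ U) ≤ ⊤) $e1)
    rw [← app_resSec, ← app_resSec, ← restrictTop_resSec] at e2
    exact e2
  refine ⟨isQuasicoherent_of_iso ⟨b, a', hba, hab⟩ hT, fun m m' h => ?_, fun x => ?_⟩
  · apply kT.injective
    rw [← ha'', ← ha'', h]
  · obtain ⟨m, hm⟩ := kT.surjective (a'.app ⊤ (restrictTop hW M x))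
    refine ⟨m, (restrictTop hW M).injective ?_⟩
    rw [← hb, hm]
    exact congr(($hab).app ⊤ (restrictTop hW M x))

/-- A quasi-coherent sheaf with an action of `π_* 𝒪_Z`, for `π` affine, is the push-forward of a
quasi-coherent sheaf on `Z`. -/
lemma Act.exists_module [IsAffineHom π] (α : Act π E) (hE : SheafOfModules.IsQuasicoherent.{u} E)
    (hα : ∀ V a m, α.act V (π.app V a) m = a • m) :
    ∃ (M : Z.Modules) (θ : (Scheme.Modules.pushforward π).obj M ≅ E),
      SheafOfModules.IsQuasicoherent.{u} M ∧ ∀ (V : X.Opens) (t : Γ(Z, π ⁻¹ᵁ V))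
        (m : Γ(M, π ⁻¹ᵁ V)), θ.hom.app V (t • m) = α.act V t (θ.hom.app V m) := by
  obtain ⟨M, η, hη⟩ := α.exists_universal
  let g : E ⟶ (Scheme.Modules.pushforward π).obj M := homOfFamily (fun V => η.lin hα V)
    fun _ _ h m => η.res h m
  have hg : IsIso g := isIso_of_bijective g fun U hU => (universal_spec hE hα η hη hU).2
  refine ⟨M, (asIso g).symm, isQuasicoherent_of_fromSpec M fun z => ?_, fun V t m => ?_⟩
  · obtain ⟨U, hU, hz, -⟩ := exists_affine_mem (show π z ∈ (⊤ : X.Opens) from trivial)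
    exact ⟨_, hU.preimage π, hz, (universal_spec hE hα η hη hU).1⟩
  · have h1 (x : Γ(E, V)) : (inv g).app V (g.app V x) = x := congr(($(IsIso.hom_inv_id g)).app V x)
    have h2 : g.app V ((inv g).app V m) = m := congr(($(IsIso.inv_hom_id g)).app V m)
    have h3 := η.smul V t ((inv g).app V m)
    have h4 := congr((inv g).app V $h3)
    refine Eq.trans ?_ (h4.symm.trans (h1 _))
    exact (congrArg (fun y : Γ(M, π ⁻¹ᵁ V) => (inv g).app V (show Γ(M, π ⁻¹ᵁ V) from t • y)) h2.symm)

end ActModule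

/-! ### Full faithfulness of push-forward along an affine morphism -/

section PushforwardHom
variable {Z X : Scheme.{u}} {π : Z ⟶ X}

/-- A morphism that is bijective on sections over arbitrarily small opens is an isomorphism. -/
lemma isIso_of_locally_bijective {E N : X.Modules} (g : E ⟶ N)
    (hg : ∀ (U : X.Opens), ∀ x ∈ U, ∃ W ≤ U, x ∈ W ∧ Function.Bijective (g.app W)) : IsIso g := by
  have inj (U : X.Opens) : Function.Injective (g.app U) := fun s t h => 
    section_ext E s t fun x hx => by
      obtain ⟨W, hWU, hxW, hW⟩ := hg U x hx
      refine ⟨W, hWU, hxW, hW.1 ?_⟩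
      rw [app_resSec, app_resSec, h]
  refine Scheme.Modules.Hom.isIso_iff_isIso_app.mpr fun U =>
    (ConcreteCategory.isIso_iff_bijective _).mpr ⟨inj U, fun s => ?_⟩
  choose W hWU hxW hW using fun x : U => hg U x x.2
  choose t ht using fun x : U => (hW x).2 (resSec N (hWU x) s)
  obtain ⟨t', ht'⟩ := exists_glue E W U hWU (fun x hx => ⟨⟨x, hx⟩, hxW _⟩) t
    fun i j z hz => by
      refine ⟨W i ⊓ W j, inf_le_left, inf_le_right, hz, inj _ ?_⟩
      rw [app_resSec, app_resSec, ht, ht, resSec_resSec, resSec_resSec]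
  refine ⟨t', section_ext N _ _ fun x hx => ⟨W ⟨x, hx⟩, hWU _, hxW ⟨x, hx⟩, ?_⟩⟩
  rw [← app_resSec, ht', ht]

/-- Sections of both sheaves over `D(f)` are fractions of sections over `W`, and clearing
denominators carries injectivity and surjectivity over. -/
lemma bijective_basicOpen {M N : Z.Modules} (hM : SheafOfModules.IsQuasicoherent.{u} M)
    (hN : SheafOfModules.IsQuasicoherent.{u} N) (g : M ⟶ N) {W : Z.Opens} (hW : IsAffineOpen W)
    (hg : Function.Bijective (g.app W)) (f : Γ(Z, W)) :
    Function.Bijective (g.app (Z.basicOpen f)) := by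
  have hD := Z.basicOpen_le f
  refine ⟨(injective_iff_map_eq_zero (g.app (Z.basicOpen f)).hom).mpr fun s hs => ?_, fun s => ?_⟩
  · replace hs : g.app (Z.basicOpen f) s = 0 := hs
    obtain ⟨n, t, ht⟩ := exists_resSec_eq hM hW f rfl hD s
    have h1 : resSec N hD (g.app W t) = 0 := by
      rw [← app_resSec, ht, g.app_smul, hs, smul_zero]
    obtain ⟨k, hk⟩ := exists_pow_smul_eq_zero hN hW f rfl hD _ h1
    rw [← g.app_smul] at hk
    have h2 : f ^ k • t = 0 := hg.1 (hk.trans (map_zero (g.app W).hom).symm)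
    refine smul_pow_cancel M f hD le_rfl (k + n) ?_
    rw [smul_zero, pow_add, map_mul, mul_smul, ← ht, ← resSec_smul, h2, resSec_zero]
  · obtain ⟨n, t, ht⟩ := exists_resSec_eq hN hW f rfl hD s
    obtain ⟨m, rfl⟩ := hg.2 t
    obtain ⟨u, hu⟩ := (isUnit_resFun f hD le_rfl).pow n
    refine ⟨(↑u⁻¹ : Γ(Z, Z.basicOpen f)) • resSec M hD m, ?_⟩
    rw [g.app_smul, app_resSec, ht, map_pow, ← hu, smul_smul, Units.inv_mul, one_smul]

/-- A morphism of quasi-coherent sheaves whose push-forward along an affine morphism is an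
isomorphism is an isomorphism. -/
lemma isIso_of_bijective_preimage [IsAffineHom π] {M N : Z.Modules}
    (hM : SheafOfModules.IsQuasicoherent.{u} M) (hN : SheafOfModules.IsQuasicoherent.{u} N)
    (g : M ⟶ N) (hg : ∀ U : X.Opens, IsAffineOpen U → Function.Bijective (g.app (π ⁻¹ᵁ U))) :
    IsIso g := by
  refine isIso_of_locally_bijective g fun V z hz => ?_
  obtain ⟨U, hU, hzU, -⟩ := exists_affine_mem (show π z ∈ (⊤ : X.Opens) from trivial)
  obtain ⟨f, hfV, hzf⟩ := (hU.preimage π).exists_basicOpen_le ⟨z, hz⟩ hzU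
  exact ⟨_, hfV, hzf, bijective_basicOpen hM hN g (hU.preimage π) (hg U hU) f⟩

/-- The action of `π_* 𝒪_Z` on a push-forward. -/
def Act.pushforward (π : Z ⟶ X) (M : Z.Modules) : Act π ((Scheme.Modules.pushforward π).obj M) where
  act V := Module.toAddMonoidEnd Γ(Z, π ⁻¹ᵁ V) Γ(M, π ⁻¹ᵁ V)
  res h t m := resSec_smul M (π.preimage_mono h) t m

/-- Push-forward along an affine morphism is fully faithful, from quasi-coherent sheaves to sheaves
with an action of `π_* 𝒪_Z`. -/
lemma existsUnique_hom_of_actHom [IsAffineHom π] {M : Z.Modules}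
    (hM : SheafOfModules.IsQuasicoherent.{u} M) {N : Z.Modules} (h : ActHom (Act.pushforward π M) N) :
    ∃! g : M ⟶ N, ∀ (V : X.Opens) (m : Γ(M, π ⁻¹ᵁ V)), g.app (π ⁻¹ᵁ V) m = h.map V m := by
  have hE := isQuasicoherent_pushforward π M hM
  have hα : ∀ V a m, (Act.pushforward π M).act V (π.app V a) m = a • m := fun _ _ _ => rfl
  obtain ⟨M', η, hη⟩ := (Act.pushforward π M).exists_universal
  -- Compare `M` with the universal sheaf `M'` of its own push-forward. Over preimages of affine
  -- opens `c` inverts the bijection `η`, so `c` is an isomorphism and `M` itself has the universal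
  -- property.
  obtain ⟨c, hc, -⟩ := hη M ⟨fun V => AddMonoidHom.id _, fun _ _ => rfl, fun _ _ _ => rfl⟩
  have hM' : SheafOfModules.IsQuasicoherent.{u} M' := isQuasicoherent_of_fromSpec M' fun z => by
    obtain ⟨U, hU, hz, -⟩ := exists_affine_mem (show π z ∈ (⊤ : X.Opens) from trivial)
    exact ⟨_, hU.preimage π, hz, (universal_spec hE hα η hη hU).1⟩
  have hci : IsIso c := isIso_of_bijective_preimage (π := π) hM' hM c fun U hU => by
    have h1 := (universal_spec hE hα η hη hU).2
    refine ⟨fun x y e => ?_, fun m => ⟨η.map U m, hc U m⟩⟩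
    obtain ⟨x, rfl⟩ := h1.2 x
    obtain ⟨y, rfl⟩ := h1.2 y
    exact congr(η.map U $(((hc U x).symm.trans e).trans (hc U y)))
  obtain ⟨g, hg, hu⟩ := hη N h
  refine ⟨inv c ≫ g, fun V m => ?_, fun g' hg' => ?_⟩
  · have e : (c ≫ inv c ≫ g).app (π ⁻¹ᵁ V) (η.map V m) = g.app (π ⁻¹ᵁ V) (η.map V m) := by
      rw [IsIso.hom_inv_id_assoc]
    exact (congr((inv c ≫ g).app _ $(hc V m)).symm.trans e).trans (hg V m)
  · rw [IsIso.eq_inv_comp]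
    exact hu _ fun V m => congr(g'.app _ $(hc V m)).trans (hg' V m)

/-- A morphism of push-forwards that is linear on affine opens comes from a unique morphism. -/
lemma existsUnique_hom_of_pushforward [IsAffineHom π] {M N : Z.Modules}
    (hM : SheafOfModules.IsQuasicoherent.{u} M)
    (h : (Scheme.Modules.pushforward π).obj M ⟶ (Scheme.Modules.pushforward π).obj N)
    (hl : ∀ (U : X.Opens), IsAffineOpen U → ∀ (t : Γ(Z, π ⁻¹ᵁ U)) (m : Γ(M, π ⁻¹ᵁ U)),
      h.app U (show Γ(M, π ⁻¹ᵁ U) from t • m) = t • (show Γ(N, π ⁻¹ᵁ U) from h.app U m)) :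
    ∃! g : M ⟶ N, (Scheme.Modules.pushforward π).map g = h := by
  obtain ⟨g, hg, hu⟩ := existsUnique_hom_of_actHom hM (N := N) (π := π)
    ⟨fun V => (h.app V).hom, fun i m => app_resSec h i m, fun V t m =>
      section_ext ((Scheme.Modules.pushforward π).obj N) (U := V) _ _ fun x hx => by
        obtain ⟨U, hU, hxU, hUV⟩ := exists_affine_mem hx
        refine ⟨U, hUV, hxU, ?_⟩
        refine (app_resSec h hUV _).symm.trans ?_
        refine congr(h.app U $(resSec_smul M (π.preimage_mono hUV) t m)).trans ?_
        refine (hl U hU _ _).trans ?_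
        refine Eq.trans ?_ (resSec_smul N (π.preimage_mono hUV) t (h.app V m)).symm
        exact congrArg (fun y : Γ(N, π ⁻¹ᵁ U) => resFun (π.preimage_mono hUV) t • y)
          (app_resSec h hUV m)⟩
  refine ⟨g, modules_hom_ext hg, fun g' hg' => hu g' fun V m => ?_⟩
  exact congr(($hg').app V m)

/-- An action of the functions over affine opens extends to an action of `π_* 𝒪_Z`. -/
lemma exists_act {E : X.Modules}
    (ρ : ∀ U : X.Opens, IsAffineOpen U → (Γ(Z, π ⁻¹ᵁ U) →+* AddMonoid.End Γ(E, U)))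
    (hρ : ∀ (U V : X.Opens) (hU : IsAffineOpen U) (hV : IsAffineOpen V) (h : V ≤ U)
      (t : Γ(Z, π ⁻¹ᵁ U)) (m : Γ(E, U)),
      resSec E h (ρ U hU t m) = ρ V hV (resFun (π.preimage_mono h) t) (resSec E h m)) :
    ∃ α : Act π E, ∀ U hU, α.act U = ρ U hU := by
  have key (V : X.Opens) (t : Γ(Z, π ⁻¹ᵁ V)) (m : Γ(E, V)) : ∃ s : Γ(E, V),
      ∀ (W : X.Opens) (hW : IsAffineOpen W) (h : W ≤ V),
        resSec E h s = ρ W hW (resFun (π.preimage_mono h) t) (resSec E h m) := by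
    choose W hW hxW hWV using fun x : V => exists_affine_mem x.2
    obtain ⟨s, hs⟩ := exists_glue E W V hWV (fun x hx => ⟨⟨x, hx⟩, hxW _⟩)
      (fun x => ρ (W x) (hW x) (resFun (π.preimage_mono (hWV x)) t) (resSec E (hWV x) m))
      fun i j z hz => by
        obtain ⟨U, hU, hzU, hUle⟩ := exists_affine_mem hz
        refine ⟨U, hUle.trans inf_le_left, hUle.trans inf_le_right, hzU, ?_⟩
        rw [hρ _ _ _ hU, hρ _ _ _ hU]
        simp only [resFun_resFun, resSec_resSec]
    refine ⟨s, fun U hU hUV => section_ext E _ _ fun x hx => ?_⟩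
    obtain ⟨U', hU', hxU', hle⟩ := exists_affine_mem (show x ∈ U ⊓ W ⟨x, hUV hx⟩ from ⟨hx, hxW _⟩)
    refine ⟨U', hle.trans inf_le_left, hxU', ?_⟩
    have e := congr(resSec E (hle.trans inf_le_right) $(hs ⟨x, hUV hx⟩))
    rw [hρ _ _ _ hU'] at e ⊢
    simpa only [resFun_resFun, resSec_resSec] using e
  choose a ha using key
  have ext (V : X.Opens) (s s' : Γ(E, V)) (h : ∀ (W : X.Opens) (_ : IsAffineOpen W) (h : W ≤ V), 
      resSec E h s = resSec E h s') : s = s' := section_ext E _ _ fun x hx => by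
    obtain ⟨W, hW, hxW, hWV⟩ := exists_affine_mem hx
    exact ⟨W, hWV, hxW, h W hW hWV⟩
  let act (V : X.Opens) : Γ(Z, π ⁻¹ᵁ V) →+* AddMonoid.End Γ(E, V) :=
    { toFun := fun t =>
        { toFun := a V t
          map_zero' := ext _ _ _ fun W hW h => by
            rw [ha _ _ _ W hW h, resSec_zero]; exact map_zero (ρ W hW _)
          map_add' := fun x y => ext _ _ _ fun W hW h => by
            rw [resSec_add, ha _ _ _ W hW h, ha _ _ _ W hW h, ha _ _ _ W hW h, resSec_add]
            exact map_add (ρ W hW _) _ _ }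
      map_one' := AddMonoidHom.ext fun m => ext _ _ _ fun W hW h => by
        refine (ha V 1 m W hW h).trans ?_
        rw [map_one, map_one]; rfl
      map_mul' := fun s t => AddMonoidHom.ext fun m => ext _ _ _ fun W hW h => by
        refine (ha V _ m W hW h).trans (Eq.trans ?_ (ha V s (a V t m) W hW h).symm)
        rw [ha V t m W hW h, map_mul, map_mul]; rfl
      map_zero' := AddMonoidHom.ext fun m => ext _ _ _ fun W hW h => by
        refine (ha V 0 m W hW h).trans ?_
        rw [map_zero, map_zero]
        exact (resSec_zero E h).symm
      map_add' := fun s t => AddMonoidHom.ext fun m => ext _ _ _ fun W hW h => by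
        refine (ha V _ m W hW h).trans (Eq.trans ?_ (resSec_add E h (a V s m) (a V t m)).symm)
        rw [ha V t m W hW h, ha V s m W hW h, map_add, map_add]; rfl }
  refine ⟨⟨act, fun {V W} i t m => ext _ _ _ fun U hU h => ?_⟩, fun U hU => ?_⟩
  · refine (resSec_resSec E i h (a V t m)).trans ((ha V t m U hU _).trans ?_)
    refine Eq.trans ?_ (ha W _ _ U hU h).symm
    simp only [resFun_resFun, resSec_resSec]
  · refine RingHom.ext fun t => AddMonoidHom.ext fun m => ?_
    have e := ha U t m U hU le_rfl
    rw [resSec_self, resSec_self, resFun_self] at e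
    exact e

end PushforwardHom

/-! ### Schemes affine over a base, and values of functions at affine test schemes -/

section AffineOver
variable {X Z Z' T : Scheme.{u}}

lemma appLE_resFun (f : T ⟶ Z) {U U' : Z.Opens} {V : T.Opens} (h : U' ≤ U) (e : V ≤ f ⁻¹ᵁ U')
    (s : Γ(Z, U)) : f.appLE U' V e (resFun h s) = f.appLE U V (e.trans (f.preimage_mono h)) s :=
  congr($(Scheme.Hom.map_appLE f e (homOfLE h).op) s)

lemma resFun_appLE (f : T ⟶ Z) {U : Z.Opens} {V V' : T.Opens} (e : V ≤ f ⁻¹ᵁ U) (h : V' ≤ V)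
    (s : Γ(Z, U)) : resFun h (f.appLE U V e s) = f.appLE U V' (h.trans e) s :=
  congr($(Scheme.Hom.appLE_map f e (homOfLE h).op) s)

lemma appLE_appLE (f : T ⟶ Z) (g : Z ⟶ X) {U : X.Opens} {V : Z.Opens} {W : T.Opens}
    (e : V ≤ g ⁻¹ᵁ U) (e' : W ≤ f ⁻¹ᵁ V) (s : Γ(X, U)) :
    f.appLE V W e' (g.appLE U V e s) = (f ≫ g).appLE U W (e'.trans (f.preimage_mono e)) s :=
  congr($(Scheme.Hom.appLE_comp_appLE f g U V W e e') s)

lemma appLE_congr_hom {f g : T ⟶ Z} (h : f = g) {U : Z.Opens} {V : T.Opens} (e : V ≤ f ⁻¹ᵁ U)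
    (s : Γ(Z, U)) : f.appLE U V e s = g.appLE U V (h ▸ e) s := by
  subst h; rfl

/-- Morphisms to a scheme affine over `X` are determined by their action on functions. -/
lemma hom_ext_of_appLE {π : Z ⟶ X} [IsAffineHom π] {f g : T ⟶ Z} {τ : T ⟶ X} (hf : f ≫ π = τ)
    (hg : g ≫ π = τ)
    (h : ∀ (U : X.Opens), IsAffineOpen U → ∀ s : Γ(Z, π ⁻¹ᵁ U),
      f.appLE (π ⁻¹ᵁ U) (τ ⁻¹ᵁ U) (by rw [← hf]; rfl) s =
        g.appLE (π ⁻¹ᵁ U) (τ ⁻¹ᵁ U) (by rw [← hg]; rfl) s) : f = g := by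
  refine Scheme.hom_ext_of_forall f g fun x => ?_
  obtain ⟨U, hU, hxU, -⟩ := exists_affine_mem (show τ x ∈ (⊤ : X.Opens) from trivial)
  refine ⟨τ ⁻¹ᵁ U, hxU, ?_⟩
  have ef : τ ⁻¹ᵁ U ≤ f ⁻¹ᵁ (π ⁻¹ᵁ U) := by rw [← hf]; rfl
  have eg : τ ⁻¹ᵁ U ≤ g ⁻¹ᵁ (π ⁻¹ᵁ U) := by rw [← hg]; rfl
  have : IsAffine (π ⁻¹ᵁ U).toScheme := hU.preimage π
  rw [← Scheme.Hom.resLE_comp_ι f ef, ← Scheme.Hom.resLE_comp_ι g eg]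
  congr 1
  apply ext_of_isAffine
  rw [Scheme.Hom.appTop, Scheme.Hom.appTop, Scheme.Hom.resLE_app_top, Scheme.Hom.resLE_app_top]
  have : f.appLE (π ⁻¹ᵁ U) (τ ⁻¹ᵁ U) ef = g.appLE (π ⁻¹ᵁ U) (τ ⁻¹ᵁ U) eg := by
    ext s; exact h U hU s
  rw [this]

/-- A morphism of schemes affine over `X` is an isomorphism if it is so on functions. -/
lemma isIso_of_appLE {π : Z ⟶ X} {π' : Z' ⟶ X} [IsAffineHom π] [IsAffineHom π'] (f : Z' ⟶ Z)
    (hf : f ≫ π = π') (h : ∀ (U : X.Opens), IsAffineOpen U → Function.Bijective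
      (f.appLE (π ⁻¹ᵁ U) (π' ⁻¹ᵁ U) (by rw [← hf]; rfl))) : IsIso f := by
  subst hf
  have : IsAffineHom f := .of_comp f π
  choose U hU hz using fun z : Z => (exists_affine_mem (show π z ∈ (⊤ : X.Opens) from trivial))
  refine (IsZariskiLocalAtTarget.iff_of_iSup_eq_top (P := .isomorphisms Scheme) (f := f)
    (fun z => π ⁻¹ᵁ (U z)) (top_le_iff.mp fun z _ => TopologicalSpace.Opens.mem_iSup.mpr
    ⟨z, (hz z).1⟩)).mpr fun z => (isIso_morphismRestrict_iff_isIso_app f ((hU z).preimage π)).mpr ?_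
  rw [ConcreteCategory.isIso_iff_bijective, Scheme.Hom.app_eq_appLE]
  exact h _ (hU z)

/-- The value of a function at an affine scheme mapping to its domain. -/
def specEval {R : CommRingCat.{u}} (i : Spec R ⟶ Z) {V : Z.Opens} (h : ⊤ ≤ i ⁻¹ᵁ V) :
    Γ(Z, V) →+* R :=
  (i.appLE V ⊤ h ≫ (Scheme.ΓSpecIso R).hom).hom

lemma specEval_congr {R : CommRingCat.{u}} {i i' : Spec R ⟶ Z} (e : i = i') {V : Z.Opens}
    (h : ⊤ ≤ i ⁻¹ᵁ V) (s : Γ(Z, V)) : specEval i h s = specEval i' (e ▸ h) s := by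
  subst e; rfl

lemma specEval_resFun {R : CommRingCat.{u}} (i : Spec R ⟶ Z) {V V' : Z.Opens} (h : ⊤ ≤ i ⁻¹ᵁ V')
    (h' : V' ≤ V) (s : Γ(Z, V)) :
    specEval i h (resFun h' s) = specEval i (h.trans (i.preimage_mono h')) s :=
  congr((Scheme.ΓSpecIso R).hom $(appLE_resFun i h' h s))

lemma specEval_comp {R : CommRingCat.{u}} (i : Spec R ⟶ T) (f : T ⟶ Z) {V : Z.Opens} {V' : T.Opens}
    (h : ⊤ ≤ i ⁻¹ᵁ V') (h' : V' ≤ f ⁻¹ᵁ V) (s : Γ(Z, V)) :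
    specEval (i ≫ f) (h.trans (i.preimage_mono h')) s = specEval i h (f.appLE V V' h' s) :=
  congr((Scheme.ΓSpecIso R).hom $((appLE_appLE i f h' h s).symm))

lemma specEval_map {R S : CommRingCat.{u}} (φ : R ⟶ S) (i : Spec R ⟶ Z) {V : Z.Opens}
    (h : ⊤ ≤ i ⁻¹ᵁ V) (s : Γ(Z, V)) :
    specEval (Spec.map φ ≫ i) ((Spec.map φ).preimage_mono h) s = φ (specEval i h s) := by
  rw [specEval_comp (Spec.map φ) i (V' := ⊤) le_rfl h]
  have := congr($(Scheme.ΓSpecIso_naturality φ) (i.appLE V ⊤ h s))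
  refine Eq.trans ?_ this
  refine congrArg (Scheme.ΓSpecIso S).hom ?_
  rw [Scheme.Hom.appTop, Scheme.Hom.app_eq_appLE]; rfl

lemma specEval_fromSpec {V : Z.Opens} (hV : IsAffineOpen V) (s : Γ(Z, V)) :
    specEval hV.fromSpec (by simp) s = s := by
  have : hV.fromSpec.appLE V ⊤ (by simp) = (Scheme.ΓSpecIso Γ(Z, V)).inv := by
    rw [Scheme.Hom.appLE, IsAffineOpen.fromSpec_app_self, Category.assoc, ← Functor.map_comp]
    exact (congrArg _ ((Spec Γ(Z, V)).presheaf.map_id _)).trans (Category.comp_id _)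
  change (hV.fromSpec.appLE V ⊤ _ ≫ (Scheme.ΓSpecIso Γ(Z, V)).hom).hom s = s
  rw [this, Iso.inv_hom_id]; rfl

end AffineOver

/-! ### Functions on the surrogate -/

namespace CommSubalgebra
variable {X : Scheme.{u}} {E E₁ E₂ : X.Modules} (A : CommSubalgebra E)
open Scheme.AffineZariskiSite

lemma res_ι {U V : X.AffineZariskiSite} (h : V ≤ U) :
    Spec.map (CommRingCat.ofHom (A.res (toOpens_mono h))) ≫ A.ι U = A.ι V :=
  colimit.w A.gluingData.functor (homOfLE h)

instance (U : X.AffineZariskiSite) : IsOpenImmersion (A.ι U) :=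
  A.gluingData.cover.map_prop U

lemma toBase_preimage (U : X.AffineZariskiSite) : A.toBase ⁻¹ᵁ U.1 = (A.ι U).opensRange := by
  have := A.gluingData.toBase_preimage_eq_opensRange_ι U
  simpa using! this

instance : IsAffineHom A.toBase where
  isAffine_preimage U hU := by
    have key (V : X.AffineZariskiSite) : IsAffineOpen (A.toBase ⁻¹ᵁ V.1) := by
      rw [A.toBase_preimage V]
      exact isAffineOpen_opensRange (A.ι V)
    exact key ⟨U, hU⟩

lemma ι_preimage (U : X.AffineZariskiSite) : A.ι U ⁻¹ᵁ (A.toBase ⁻¹ᵁ U.1) = ⊤ := by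
  rw [toBase_preimage]; simp

lemma eval_eq (U : X.AffineZariskiSite) (s : Γ(A.surrogate, A.toBase ⁻¹ᵁ U.1)) :
    A.eval U s = specEval (A.ι U) (A.ι_preimage U).ge s := rfl

lemma eval_bijective (U : X.AffineZariskiSite) : Function.Bijective (A.eval U) := by
  have h1 := (A.ι U).isIso_app (A.toBase ⁻¹ᵁ U.1) (A.toBase_preimage U).le
  have h2 : IsIso ((A.ι U).appLE (A.toBase ⁻¹ᵁ U.1) ⊤ (A.ι_preimage U).ge) := by
    rw [Scheme.Hom.appLE]
    have : IsIso (homOfLE (A.ι_preimage U).ge) := ⟨homOfLE (A.ι_preimage U).le, rfl, rfl⟩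
    infer_instance
  exact (ConcreteCategory.bijective_of_isIso ((A.ι U).appLE (A.toBase ⁻¹ᵁ U.1) ⊤
    (A.ι_preimage U).ge ≫ (Scheme.ΓSpecIso (A.presheaf.obj (.op U.1))).hom) :)

lemma res_eval_of_le {U V : X.AffineZariskiSite} (h : V ≤ U)
    (s : Γ(A.surrogate, A.toBase ⁻¹ᵁ U.1)) : A.res (toOpens_mono h) (A.eval U s) =
      A.eval V (resFun (A.toBase.preimage_mono (toOpens_mono h)) s) := by
  rw [eval_eq, eval_eq, specEval_resFun, specEval_congr (A.res_ι h).symm]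
  exact (specEval_map (CommRingCat.ofHom (A.res (toOpens_mono h))) (A.ι U) (A.ι_preimage U).ge s).symm

lemma ext_of_locally {U : X.Opens} {s t : A.obj U} (h : ∀ x ∈ U, ∃ (V : X.Opens) (hV : V ≤ U),
    x ∈ V ∧ A.res hV s = A.res hV t) : s = t := by
  refine Subtype.ext (Subtype.ext (funext fun W => LinearMap.ext fun m => ?_))
  refine section_ext E _ _ fun x hx => ?_
  obtain ⟨V, hV, hxV, e⟩ := h x (W.2 hx)
  refine ⟨W.1 ⊓ V, inf_le_left, ⟨hx, hxV⟩, ?_⟩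
  refine (s.1.2 W ⟨W.1 ⊓ V, inf_le_left.trans W.2⟩ inf_le_left m).symm.trans (Eq.trans ?_
    (t.1.2 W ⟨W.1 ⊓ V, inf_le_left.trans W.2⟩ inf_le_left m))
  exact congr(($e).1.1 ⟨W.1 ⊓ V, inf_le_right⟩ (resSec E inf_le_left m))

/-- In `X.AffineZariskiSite` the relation `V ≤ U` means that `V` is a basic open of `U`, and the
gluing data only sees these inclusions. A general inclusion of affine opens is handled by covering
the smaller one with opens that are basic in both. -/
lemma res_eval {U V : X.AffineZariskiSite} (h : V.1 ≤ U.1)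
    (s : Γ(A.surrogate, A.toBase ⁻¹ᵁ U.1)) : A.res h (A.eval U s) =
      A.eval V (resFun (A.toBase.preimage_mono h) s) := by
  refine A.ext_of_locally fun x hx => ?_
  obtain ⟨f, g, e, hxf⟩ := exists_basicOpen_le_affine_inter U.2 V.2 x ⟨h hx, hx⟩
  have h1 : V.basicOpen g ≤ U := ⟨f, e⟩
  have h2 : V.basicOpen g ≤ V := ⟨g, rfl⟩
  refine ⟨X.basicOpen g, toOpens_mono h2, e ▸ hxf, ?_⟩
  refine (A.res_eval_of_le h1 s).trans (Eq.trans ?_ (A.res_eval_of_le h2 _).symm)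
  rw [resFun_resFun]

lemma eval_app (U : X.AffineZariskiSite) (a : Γ(X, U.1)) :
    A.eval U (A.toBase.app U.1 a) = A.scalar U.1 a := by
  rw [eval_eq, Scheme.Hom.app_eq_appLE, ← specEval_comp, specEval_congr (A.ι_toBase U)]
  refine (specEval_map (A.structureMap.app (.op U.1)) U.2.fromSpec (by simp) a).trans ?_
  rw [specEval_fromSpec]; rfl

end CommSubalgebra

/-! ### Morphisms out of a surrogate -/

lemma map_map_fromSpec {Z : Scheme.{u}} {R S : CommRingCat.{u}} {W W' : Z.Opens} (hW : IsAffineOpen W)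
    (hW' : IsAffineOpen W') (h : W' ≤ W) (ψ : Γ(Z, W) ⟶ R) (ψ' : Γ(Z, W') ⟶ S) (φ : R ⟶ S)
    (e : ∀ s, φ (ψ s) = ψ' (resFun h s)) :
    Spec.map φ ≫ Spec.map ψ ≫ hW.fromSpec = Spec.map ψ' ≫ hW'.fromSpec := by
  rw [← hW.map_fromSpec hW' (homOfLE h).op, ← Category.assoc, ← Category.assoc, ← Spec.map_comp,
    ← Spec.map_comp]
  congr 2
  ext s
  exact e s

lemma map_fromSpec_comp {X Z : Scheme.{u}} {τ : Z ⟶ X} [IsAffineHom τ] {R : CommRingCat.{u}}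
    {U : X.Opens} (hU : IsAffineOpen U) (ψ : Γ(Z, τ ⁻¹ᵁ U) ⟶ R) (σ : Γ(X, U) ⟶ R)
    (e : ∀ a, ψ (τ.app U a) = σ a) :
    (Spec.map ψ ≫ (hU.preimage τ).fromSpec) ≫ τ = Spec.map σ ≫ hU.fromSpec := by
  rw [Category.assoc, ← hU.SpecMap_appLE_fromSpec τ (hU.preimage τ) le_rfl, ← Category.assoc,
    ← Spec.map_comp]
  congr 2
  ext a
  rw [Scheme.Hom.appLE_eq_app]
  exact e a

namespace CommSubalgebra
variable {X Z : Scheme.{u}} {E E₁ E₂ : X.Modules}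
open Scheme.AffineZariskiSite

section Spec
variable {A : CommSubalgebra E₁} {B : CommSubalgebra E₂} (t : A.presheaf ⟶ B.presheaf)

lemma ι_specMap (U : X.AffineZariskiSite) :
    B.ι U ≫ specMap t = Spec.map (t.app (.op U.1)) ≫ A.ι U :=
  ι_colimMap _ _

variable (ht : ∀ (U : X.Opens) (a : Γ(X, U)), t.app (.op U) (A.scalar U a) = B.scalar U a)

include ht in
lemma specMap_toBase : specMap t ≫ A.toBase = B.toBase := by
  refine colimit.hom_ext fun U => ?_
  change B.ι U ≫ specMap t ≫ A.toBase = B.ι U ≫ B.toBase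
  rw [← Category.assoc, ι_specMap, Category.assoc, ι_toBase, ι_toBase, ← Category.assoc,
    ← Spec.map_comp]
  congr 2
  ext a
  exact ht _ a

lemma eval_specMap (U : X.AffineZariskiSite) (s : Γ(A.surrogate, A.toBase ⁻¹ᵁ U.1)) :
    B.eval U ((specMap t).appLE (A.toBase ⁻¹ᵁ U.1) (B.toBase ⁻¹ᵁ U.1)
      (by rw [← specMap_toBase t ht]; rfl) s) = t.app (.op U.1) (A.eval U s) := by
  rw [eval_eq, ← specEval_comp, specEval_congr (ι_specMap t U)]
  exact specEval_map (t.app (.op U.1)) (A.ι U) (A.ι_preimage U).ge s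

end Spec

section Desc
variable (A : CommSubalgebra E) {τ : Z ⟶ X} [IsAffineHom τ]
  (ψ : ∀ U : X.AffineZariskiSite, Γ(Z, τ ⁻¹ᵁ U.1) →+* A.obj U.1)
  (hψ : ∀ (U V : X.AffineZariskiSite) (h : V ≤ U) (s : Γ(Z, τ ⁻¹ᵁ U.1)),
    A.res (toOpens_mono h) (ψ U s) = ψ V (resFun (τ.preimage_mono (toOpens_mono h)) s))
  (hs : ∀ (U : X.AffineZariskiSite) (a : Γ(X, U.1)), ψ U (τ.app U.1 a) = A.scalar U.1 a)

include hψ hs in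
/-- Morphisms from a surrogate to a scheme affine over the base. -/
lemma exists_hom_of_ringHom : ∃ (u : A.surrogate ⟶ Z) (hu : u ≫ τ = A.toBase),
    ∀ (U : X.AffineZariskiSite) (s : Γ(Z, τ ⁻¹ᵁ U.1)),
      A.eval U (u.appLE (τ ⁻¹ᵁ U.1) (A.toBase ⁻¹ᵁ U.1) (by rw [← hu]; rfl) s) = ψ U s := by
  let leg (U : X.AffineZariskiSite) : Spec (A.presheaf.obj (.op U.1)) ⟶ Z :=
    Spec.map (CommRingCat.ofHom (ψ U)) ≫ (U.2.preimage τ).fromSpec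
  have hleg {V U : X.AffineZariskiSite} (h : V ≤ U) :
      Spec.map (CommRingCat.ofHom (A.res (toOpens_mono h))) ≫ leg U = leg V := by
    exact map_map_fromSpec (U.2.preimage τ) (V.2.preimage τ) (τ.preimage_mono (toOpens_mono h)) _ _ _
      (hψ U V h)
  let u : A.surrogate ⟶ Z := colimit.desc A.gluingData.functor
    { pt := Z
      ι := { app := leg
             naturality := fun V U i => (hleg i.le).trans (Category.comp_id _).symm } }
  have hι (U : X.AffineZariskiSite) : A.ι U ≫ u = leg U := colimit.ι_desc _ _
  have hu : u ≫ τ = A.toBase := by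
    refine colimit.hom_ext fun U => ?_
    have e := map_fromSpec_comp (τ := τ) U.2 (CommRingCat.ofHom (ψ U)) (A.structureMap.app (.op U.1))
      (hs U)
    exact (Category.assoc _ _ _).symm.trans (congr($(hι U) ≫ τ).trans (e.trans (A.ι_toBase U).symm))
  refine ⟨u, hu, fun U s => ?_⟩
  rw [eval_eq, ← specEval_comp, specEval_congr (hι U)]
  refine (specEval_map (CommRingCat.ofHom (ψ U)) (U.2.preimage τ).fromSpec (by simp) s).trans ?_
  rw [specEval_fromSpec]; rfl

include hψ hs in
lemma exists_iso_of_ringHom (hb : ∀ U, Function.Bijective (ψ U)) :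
    ∃ (u : A.surrogate ≅ Z) (hu : u.hom ≫ τ = A.toBase),
    ∀ (U : X.AffineZariskiSite) (s : Γ(Z, τ ⁻¹ᵁ U.1)),
      A.eval U (u.hom.appLE (τ ⁻¹ᵁ U.1) (A.toBase ⁻¹ᵁ U.1) (by rw [← hu]; rfl) s) = ψ U s := by
  obtain ⟨u, hu, h⟩ := A.exists_hom_of_ringHom ψ hψ hs
  have : IsIso u := isIso_of_appLE (π := τ) (π' := A.toBase) u hu fun U hU => by
    refine (Function.Bijective.of_comp_iff' (A.eval_bijective ⟨U, hU⟩) _).mp ?_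
    convert hb ⟨U, hU⟩ using 1
    exact funext (h ⟨U, hU⟩)
  exact ⟨asIso u, hu, h⟩

end Desc

end CommSubalgebra

/-- Serves to transfer the localization property from functions on a scheme affine over `X` to the
endomorphisms by which they act. -/
lemma isLocalization_away_of_bijective {R S R' S' : Type*} [CommRing R] [CommRing S] [CommRing R']
    [CommRing S'] (ρ : R →+* S) (ρ' : R' →+* S') (r : R →+* R') (q : S →+* S')
    (hr : Function.Bijective r) (hq : Function.Bijective q) (h : ∀ t, ρ' (r t) = q (ρ t)) (f : R)
    (hu : IsUnit (ρ f)) (hs : ∀ s, ∃ (n : ℕ) (t : R), ρ t = ρ (f ^ n) * s)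
    (he : ∀ t, ρ t = 0 → ∃ n : ℕ, f ^ n * t = 0) :
    letI := ρ'.toAlgebra
    IsLocalization.Away (r f) S' := by
  algebraize [ρ']
  refine ⟨?_, fun s => ?_, fun {s t} e => ?_⟩
  · rintro ⟨_, n, rfl⟩
    change IsUnit (ρ' (r f ^ n))
    rw [map_pow, h]
    exact (hu.map q).pow n
  · obtain ⟨s, rfl⟩ := hq.2 s
    obtain ⟨n, t, ht⟩ := hs s
    refine ⟨(r t, ⟨_, n, rfl⟩), ?_⟩
    change q s * ρ' (r f ^ n) = ρ' (r t)
    rw [h, ht, ← map_pow, h, ← map_mul, mul_comm]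
  · obtain ⟨s, rfl⟩ := hr.2 s
    obtain ⟨t, rfl⟩ := hr.2 t
    change ρ' (r s) = ρ' (r t) at e
    rw [h, h] at e
    have e' := hq.1 e
    rw [← sub_eq_zero, ← map_sub] at e'
    obtain ⟨n, hn⟩ := he _ e'
    refine ⟨⟨_, n, rfl⟩, ?_⟩
    change r f ^ n * _ = r f ^ n * _
    rw [mul_sub, sub_eq_zero] at hn
    rw [← map_pow, ← map_mul, ← map_mul, hn]

/-! ### Faithful actions as subalgebras of `ℰnd(E)` -/

section Faithful
variable {X Z : Scheme.{u}} {E : X.Modules} {τ : Z ⟶ X}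

lemma exists_glue_fun {ι : Type u} (V : ι → Z.Opens) (U : Z.Opens) (hV : ∀ i, V i ≤ U)
    (hU : ∀ z ∈ U, ∃ i, z ∈ V i) (s : ∀ i, Γ(Z, V i))
    (h : ∀ i j, resFun inf_le_left (s i) = resFun (inf_le_right : V i ⊓ V j ≤ V j) (s j)) :
    ∃ t : Γ(Z, U), ∀ i, resFun (hV i) t = s i := by
  obtain ⟨t, ht, -⟩ := TopCat.Sheaf.existsUnique_gluing' Z.sheaf V U (fun i => homOfLE (hV i))
    (fun z hz => TopologicalSpace.Opens.mem_iSup.mpr (hU z hz)) s h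
  exact ⟨t, ht⟩

/-- The endomorphisms given by an action. -/
def Act.toEndOn (α : Act τ E) (hα : ∀ V a m, α.act V (τ.app V a) m = a • m) (U : X.Opens) :
    Γ(Z, τ ⁻¹ᵁ U) →+* EndOn E U where
  toFun t := ⟨fun V =>
    { toFun := α.act V.1 (resFun (τ.preimage_mono V.2) t)
      map_add' := map_add (α.act V.1 _)
      map_smul' := fun a m => by
        rw [← hα, ← α.act_mul, mul_comm, α.act_mul, hα]; rfl },
    fun V W h m => by
      refine Eq.trans ?_ (α.res h _ m).symm
      rw [resFun_resFun]; rfl⟩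
  map_one' := Subtype.ext (funext fun V => LinearMap.ext fun m => by
    change α.act V.1 _ m = m
    rw [map_one, map_one]; rfl)
  map_mul' s t := Subtype.ext (funext fun V => LinearMap.ext fun m => by
    change α.act V.1 _ m = α.act V.1 _ (α.act V.1 _ m)
    rw [map_mul, α.act_mul])
  map_zero' := Subtype.ext (funext fun V => LinearMap.ext fun m => by
    change α.act V.1 _ m = 0
    rw [map_zero, map_zero]; rfl)
  map_add' s t := Subtype.ext (funext fun V => LinearMap.ext fun m => by
    change α.act V.1 _ m = α.act V.1 _ m + α.act V.1 _ m
    rw [map_add, map_add]; rfl)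

lemma Act.toEndOn_apply (α : Act τ E) (hα : ∀ V a m, α.act V (τ.app V a) m = a • m) (U : X.Opens)
    (t : Γ(Z, τ ⁻¹ᵁ U)) (V : {V : X.Opens // V ≤ U}) (m : Γ(E, V.1)) :
    (α.toEndOn hα U t).1 V m = α.act V.1 (resFun (τ.preimage_mono V.2) t) m := rfl

lemma Act.res_toEndOn (α : Act τ E) (hα : ∀ V a m, α.act V (τ.app V a) m = a • m) {U V : X.Opens}
    (h : V ≤ U) (t : Γ(Z, τ ⁻¹ᵁ U)) : EndOn.res E h (α.toEndOn hα U t) =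
      α.toEndOn hα V (resFun (τ.preimage_mono h) t) :=
  Subtype.ext (funext fun W => LinearMap.ext fun m => by
    change α.act W.1 _ m = α.act W.1 _ m
    rw [resFun_resFun])

lemma Act.toEndOn_app (α : Act τ E) (hα : ∀ V a m, α.act V (τ.app V a) m = a • m) (U : X.Opens)
    (a : Γ(X, U)) : α.toEndOn hα U (τ.app U a) = EndOn.scalar E U a :=
  Subtype.ext (funext fun W => LinearMap.ext fun m => by
    change α.act W.1 _ m = resFun W.2 a • m
    rw [← app_resFun, hα])

lemma Act.toEndOn_injective (α : Act τ E) (hα : ∀ V a m, α.act V (τ.app V a) m = a • m)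
    (hf : ∀ (U : X.Opens), IsAffineOpen U → ∀ t, (∀ m, α.act U t m = 0) → t = 0) (U : X.Opens) :
    Function.Injective (α.toEndOn hα U) := by
  refine (injective_iff_map_eq_zero _).mpr fun t ht => fun_ext _ _ fun z hz => ?_
  obtain ⟨W, hW, hxW, hWU⟩ := exists_affine_mem (show τ z ∈ U from hz)
  refine ⟨τ ⁻¹ᵁ W, τ.preimage_mono hWU, hxW, ?_⟩
  rw [map_zero]
  exact hf W hW _ fun m => congr(($ht).1 ⟨W, hWU⟩ m)

/-- The commutative subsheaf of algebras given by a faithful action. -/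
def Act.commSubsheaf (α : Act τ E) (hα : ∀ V a m, α.act V (τ.app V a) m = a • m)
    (hf : ∀ (U : X.Opens), IsAffineOpen U → ∀ t, (∀ m, α.act U t m = 0) → t = 0) :
    CommSubsheaf E where
  obj U := (α.toEndOn hα U).range
  res_mem := by
    rintro U V h _ ⟨t, rfl⟩
    exact ⟨_, (α.res_toEndOn hα h t).symm⟩
  mem_of_locally {U} s h := by
    choose V hV hxV t ht using fun x : U => h x x.2
    -- Faithfulness makes the function inducing a given endomorphism unique, so the local choices
    -- agree on overlaps and glue.
    obtain ⟨t', ht'⟩ := exists_glue_fun (fun x => τ ⁻¹ᵁ (V x)) (τ ⁻¹ᵁ U)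
      (fun x => τ.preimage_mono (hV x)) (fun z hz => ⟨⟨τ z, hz⟩, hxV _⟩) t fun x y => by
        apply α.toEndOn_injective hα hf (V x ⊓ V y)
        refine (α.res_toEndOn hα inf_le_left (t x)).symm.trans
          (Eq.trans ?_ (α.res_toEndOn hα inf_le_right (t y)))
        rw [ht, ht]; rfl
    refine ⟨t', Subtype.ext (funext fun W => LinearMap.ext fun m => section_ext E _ _
      fun x hx => ?_)⟩
    let x' : U := ⟨x, W.2 hx⟩
    refine ⟨W.1 ⊓ V x', inf_le_left, ⟨hx, hxV x'⟩, ?_⟩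
    refine ((α.toEndOn hα U t').2 W ⟨W.1 ⊓ V x', inf_le_left.trans W.2⟩ inf_le_left m).symm.trans
      (Eq.trans ?_ (s.2 W ⟨W.1 ⊓ V x', inf_le_left.trans W.2⟩ inf_le_left m))
    have e := (α.res_toEndOn hα (hV x') t').trans (congr(α.toEndOn hα _ $(ht' x')).trans (ht x'))
    exact congr(($e).1 ⟨W.1 ⊓ V x', inf_le_right⟩ (resSec E inf_le_left m))
  scalar_mem U a := ⟨_, α.toEndOn_app hα U a⟩
  comm := by
    rintro U _ _ ⟨s, rfl⟩ ⟨t, rfl⟩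
    rw [← map_mul, mul_comm, map_mul]

lemma Act.isQuasicoherent_commSubsheaf [IsAffineHom τ] (α : Act τ E)
    (hα : ∀ V a m, α.act V (τ.app V a) m = a • m)
    (hf : ∀ (U : X.Opens), IsAffineOpen U → ∀ t, (∀ m, α.act U t m = 0) → t = 0) :
    (α.commSubsheaf hα hf).IsQuasicoherent := by
  intro U hU f
  let B := α.commSubsheaf hα hf
  have hle := X.basicOpen_le f
  have hD := Scheme.preimage_basicOpen τ f
  let r (V : X.Opens) : Γ(Z, τ ⁻¹ᵁ V) →+* B.obj V := (α.toEndOn hα V).rangeRestrict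
  have hr (V : X.Opens) : Function.Bijective (r V) :=
    ⟨fun s t e => α.toEndOn_injective hα hf V congr(($e).1), RingHom.rangeRestrict_surjective _⟩
  have hres (t) : B.res hle (r U t) = r _ (resFun (τ.preimage_mono hle) t) :=
    Subtype.ext (α.res_toEndOn hα hle t)
  have hsc (V : X.Opens) (a) : B.scalar V a = r V (τ.app V a) :=
    Subtype.ext (α.toEndOn_app hα V a).symm
  have key := isLocalization_away_of_bijective (resFun (τ.preimage_mono hle)) (B.res hle) (r U) (r _)
    (hr _) (hr _) hres (τ.app U f) (isUnit_resFun _ _ hD.le)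
    (exists_resFun_eq (hU.preimage τ) (τ.app U f) hD (τ.preimage_mono hle))
    (exists_pow_mul_eq_zero (hU.preimage τ) (τ.app U f) hD (τ.preimage_mono hle))
  rw [← hsc] at key
  exact key

/-- A faithful action of the functions on a scheme `Z` affine over `X` identifies `Z` with the
surrogate of a commutative subalgebra. -/
lemma Act.exists_commSubalgebra [IsAffineHom τ] (α : Act τ E)
    (hα : ∀ V a m, α.act V (τ.app V a) m = a • m)
    (hf : ∀ (U : X.Opens), IsAffineOpen U → ∀ t, (∀ m, α.act U t m = 0) → t = 0) :
    ∃ (A : CommSubalgebra E) (u : A.surrogate ≅ Z) (hu : u.hom ≫ τ = A.toBase),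
      (∀ (U : X.AffineZariskiSite) (t : Γ(Z, τ ⁻¹ᵁ U.1)),
        (A.eval U (u.hom.appLE (τ ⁻¹ᵁ U.1) (A.toBase ⁻¹ᵁ U.1) (by rw [← hu]; rfl) t)).1 =
          α.toEndOn hα U.1 t) ∧
      ∀ U, A.obj U = (α.toEndOn hα U).range := by
  let A : CommSubalgebra E := ⟨α.commSubsheaf hα hf, α.isQuasicoherent_commSubsheaf hα hf⟩
  obtain ⟨u, hu, h⟩ := A.exists_iso_of_ringHom (τ := τ) (fun U => (α.toEndOn hα U.1).rangeRestrict)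
    (fun U V h s => Subtype.ext (α.res_toEndOn hα (Scheme.AffineZariskiSite.toOpens_mono h) s))
    (fun U a => Subtype.ext (α.toEndOn_app hα U.1 a))
    (fun U => ⟨fun s t e => α.toEndOn_injective hα hf U.1 congr(($e).1),
      RingHom.rangeRestrict_surjective _⟩)
  exact ⟨A, u, hu, fun U t => congr(($(h U t)).1), fun U => rfl⟩

end Faithful

lemma appLE_id {X : Scheme.{u}} {V : X.Opens} (h : V ≤ 𝟙 X ⁻¹ᵁ V) (s : Γ(X, V)) :
    (𝟙 X : X ⟶ X).appLE V V h s = s := by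
  rw [Scheme.Hom.appLE, Scheme.Hom.id_app]
  exact resFun_self s

/-! ### Injectivity on functions and kernels of morphisms -/

section Injective
variable {X Z T P : Scheme.{u}}

/-- A morphism between schemes affine over `X` that is injective on functions over affine opens
of `X` is injective on functions. -/
lemma app_injective_of_appLE {π : Z ⟶ X} {τ : T ⟶ X} [IsAffineHom π] [IsAffineHom τ] (f : T ⟶ Z)
    (hf : f ≫ π = τ) (h : ∀ (U : X.Opens), IsAffineOpen U → Function.Injective
      (f.appLE (π ⁻¹ᵁ U) (τ ⁻¹ᵁ U) (by rw [← hf]; rfl))) (V : Z.Opens) :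
    Function.Injective (f.app V) := by
  subst hf
  refine (injective_iff_map_eq_zero _).mpr fun t ht => fun_ext _ _ fun z hz => ?_
  obtain ⟨U, hU, hzU, -⟩ := exists_affine_mem (show π z ∈ (⊤ : X.Opens) from trivial)
  have hW := hU.preimage π
  have hW' := hU.preimage (f ≫ π)
  obtain ⟨a, haV, hza⟩ := hW.exists_basicOpen_le ⟨z, hz⟩ hzU
  refine ⟨_, haV, hza, ?_⟩
  rw [map_zero]
  replace ht : f.app V t = 0 := ht
  have hD := Scheme.preimage_basicOpen f a
  have hle := Z.basicOpen_le a
  -- On `D(a)` the function is `t' / a ^ n`. Its numerator pulls back to something killed by a power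
  -- of `a`, and injectivity over `π⁻¹(U)` brings this back to `t'`.
  obtain ⟨n, t', ht'⟩ := exists_resFun_eq hW a rfl hle (resFun haV t)
  have h1 : resFun (f.preimage_mono hle) (f.app _ t') = 0 := by
    rw [← app_resFun f hle, ht', map_mul, app_resFun f haV, ht, map_zero, mul_zero]
  obtain ⟨k, hk⟩ := exists_pow_mul_eq_zero hW' (f.app _ a) hD (f.preimage_mono hle) _ h1
  have h2 : a ^ k * t' = 0 := by
    refine h U hU ?_
    have := (map_mul (f.app (π ⁻¹ᵁ U)).hom (a ^ k) t').trans
      (congr($(map_pow (f.app (π ⁻¹ᵁ U)).hom a k) * _).trans hk)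
    rw [Scheme.Hom.app_eq_appLE] at this
    exact this.trans (map_zero _).symm
  have h3 : resFun hle (a ^ (k + n)) * resFun haV t = 0 := by
    rw [pow_add, map_mul, mul_assoc, ← ht', ← map_mul, h2, map_zero]
  rw [map_pow] at h3
  exact ((isUnit_resFun a hle le_rfl).pow _).mul_right_eq_zero.mp h3

/-- Precomposing with a morphism injective on functions does not change the scheme-theoretic image.
This makes the ideal of the graph an invariant of refinement. -/
lemma ker_comp_of_injective (w : T ⟶ Z) (i : Z ⟶ P) [QuasiCompact w] [QuasiCompact i]
    (hw : ∀ V, Function.Injective (w.app V)) : (w ≫ i).ker = i.ker := by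
  ext W : 2
  refine Ideal.ext fun t => ?_
  rw [Scheme.Hom.ker_apply, Scheme.Hom.ker_apply, RingHom.mem_ker, RingHom.mem_ker, Scheme.Hom.comp_app]
  exact map_eq_zero_iff _ (hw _)

end Injective

/-! ### Inclusions of subalgebras and the induced morphisms of surrogates -/

namespace CommSubalgebra
variable {X Z : Scheme.{u}} {E E₁ E₂ : X.Modules}

lemma le_of_affine {A B : CommSubalgebra E} (h : ∀ U, IsAffineOpen U → A.obj U ≤ B.obj U) : A ≤ B :=
  fun _ s hs => B.mem_of_locally s fun _ hx => by
    obtain ⟨V, hV, hxV, hVU⟩ := exists_affine_mem hx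
    exact ⟨V, hVU, hxV, h V hV (A.res_mem hVU hs)⟩

lemma ext_obj {A B : CommSubalgebra E} (h : ∀ U, A.obj U = B.obj U) : A = B := by
  obtain ⟨⟨a, _, _, _, _⟩, _⟩ := A
  obtain ⟨⟨b, _, _, _, _⟩, _⟩ := B
  obtain rfl : a = b := funext h
  rfl

lemma le_antisymm' {A B : CommSubalgebra E} (h : A ≤ B) (h' : B ≤ A) : A = B :=
  ext_obj fun U => le_antisymm (h U) (h' U)

section Incl
variable {A B : CommSubalgebra E} (h : A ≤ B)

lemma specMap_incl_toBase : specMap (inclMap h) ≫ A.toBase = B.toBase :=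
  specMap_toBase _ fun _ _ => rfl

lemma incl_le (U : X.Opens) : B.toBase ⁻¹ᵁ U ≤ specMap (inclMap h) ⁻¹ᵁ (A.toBase ⁻¹ᵁ U) := by
  rw [← specMap_incl_toBase h]; rfl

lemma eval_specMap_incl (U : X.AffineZariskiSite) (s : Γ(A.surrogate, A.toBase ⁻¹ᵁ U.1)) :
    (B.eval U ((specMap (inclMap h)).appLE (A.toBase ⁻¹ᵁ U.1) (B.toBase ⁻¹ᵁ U.1)
      (incl_le h U.1) s)).1 = (A.eval U s).1 :=
  congr(($(eval_specMap (inclMap h) (fun _ _ => rfl) U s)).1)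

/-- Both algebras lie in `ℰnd(E)`: a function and its pullback are the same endomorphism. -/
lemma specMap_incl_injective (U : X.AffineZariskiSite) : Function.Injective
    ((specMap (inclMap h)).appLE (A.toBase ⁻¹ᵁ U.1) (B.toBase ⁻¹ᵁ U.1) (incl_le h U.1)) := by
  intro s t e
  exact (A.eval_bijective U).1 (Subtype.ext ((eval_specMap_incl h U s).symm.trans
    ((congrArg (fun y => (B.eval U y).1) e).trans (eval_specMap_incl h U t))))

lemma specMap_incl_app_injective (V : A.surrogate.Opens) :
    Function.Injective ((specMap (inclMap h)).app V) :=
  app_injective_of_appLE (π := A.toBase) (τ := B.toBase) _ (specMap_incl_toBase h)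
    (fun U hU => specMap_incl_injective h ⟨U, hU⟩) V

instance : IsAffineHom (specMap (inclMap h)) := by
  have : IsAffineHom (specMap (inclMap h) ≫ A.toBase) := by
    rw [specMap_incl_toBase]; infer_instance
  exact .of_comp _ A.toBase

/-- Morphisms to a surrogate over `X` are determined by the values of functions. -/
lemma hom_ext_of_eval {τ : Z ⟶ X} [IsAffineHom τ] {f g : B.surrogate ⟶ Z} (hf : f ≫ τ = B.toBase)
    (hg : g ≫ τ = B.toBase)
    (h : ∀ (U : X.AffineZariskiSite) (s : Γ(Z, τ ⁻¹ᵁ U.1)),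
      (B.eval U (f.appLE (τ ⁻¹ᵁ U.1) (B.toBase ⁻¹ᵁ U.1) (by rw [← hf]; rfl) s)).1 =
        (B.eval U (g.appLE (τ ⁻¹ᵁ U.1) (B.toBase ⁻¹ᵁ U.1) (by rw [← hg]; rfl) s)).1) : f = g :=
  hom_ext_of_appLE hf hg fun U hU s => (B.eval_bijective ⟨U, hU⟩).1 (Subtype.ext (h ⟨U, hU⟩ s))

end Incl

lemma specMap_incl_refl (A : CommSubalgebra E) (h : A ≤ A) : specMap (inclMap h) = 𝟙 _ :=
  hom_ext_of_eval (τ := A.toBase) (specMap_incl_toBase h) (Category.id_comp _) fun U s =>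
    (eval_specMap_incl h U s).trans (congrArg (fun y => (A.eval U y).1) (appLE_id _ s).symm)

lemma specMap_incl_comp {A B C : CommSubalgebra E} (h : A ≤ B) (h' : B ≤ C) (h'' : A ≤ C) :
    specMap (inclMap h') ≫ specMap (inclMap h) = specMap (inclMap h'') :=
  hom_ext_of_eval (τ := A.toBase) (by rw [Category.assoc, specMap_incl_toBase, specMap_incl_toBase])
    (specMap_incl_toBase h'') fun U s =>
      (congrArg (fun y => (C.eval U y).1)
        (appLE_appLE _ _ (incl_le h U.1) (incl_le h' U.1) s).symm).trans
      ((eval_specMap_incl h' U _).trans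
        ((eval_specMap_incl h U s).trans (eval_specMap_incl h'' U s).symm))

end CommSubalgebra

/-! ### Refinement, and uniqueness of presentations with closed graph -/

namespace Presentation
variable {S X Y : Scheme.{u}} {sX : X ⟶ S} {sY : Y ⟶ S} {E : X.Modules}
open CommSubalgebra

lemma refines_refl (p : Presentation sX sY E) : p.Refines p :=
  ⟨fun _ => le_rfl, by rw [specMap_incl_refl, Category.id_comp]⟩

lemma Refines.trans {p q t : Presentation sX sY E} (h : p.Refines q) (h' : q.Refines t) :
    p.Refines t := by
  obtain ⟨a, e⟩ := h
  obtain ⟨b, e'⟩ := h'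
  have c : p.alg ≤ t.alg := fun U => (a U).trans (b U)
  exact ⟨c, by rw [e', e, ← Category.assoc, specMap_incl_comp a b c]⟩

lemma Refines.antisymm {p q : Presentation sX sY E} (h : p.Refines q) (h' : q.Refines p) : p = q := by
  obtain ⟨A, f, hf⟩ := p
  obtain ⟨B, g, hg⟩ := q
  obtain ⟨a, e⟩ := h
  obtain ⟨b, -⟩ := h'
  obtain rfl : A = B := le_antisymm' a b
  rw [specMap_incl_refl, Category.id_comp] at e
  cases e
  rfl

lemma Refines.graph_eq {p q : Presentation sX sY E} (h : p.alg ≤ q.alg)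
    (e : q.map = specMap (inclMap h) ≫ p.map) : q.graph = specMap (inclMap h) ≫ p.graph := by
  apply pullback.hom_ext
  · rw [Category.assoc, graph_fst, graph_fst, specMap_incl_toBase]
  · rw [Category.assoc, graph, graph, pullback.lift_snd, pullback.lift_snd, e]

/-- The inclusion of ideals lifts the graph of `p'` to a morphism `v` between the surrogates over `X
× Y`. Compared on the surrogate of `q`, a function and its pullback by `v` act on `E` by the same
endomorphism. Hence `𝒜_p ⊆ 𝒜_{p'}` and `v` is the morphism induced by this inclusion. -/
lemma refines_of_ker_le {p p' q : Presentation sX sY E} [IsClosedImmersion p.graph]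
    [IsClosedImmersion p'.graph] (a : p.alg ≤ q.alg) (g : q.graph = specMap (inclMap a) ≫ p.graph)
    (a' : p'.alg ≤ q.alg) (g' : q.graph = specMap (inclMap a') ≫ p'.graph)
    (hk : p.graph.ker ≤ p'.graph.ker) : p.Refines p' := by
  let v := IsClosedImmersion.lift p.graph p'.graph hk
  have hv : v ≫ p.graph = p'.graph := IsClosedImmersion.lift_fac _ _ _
  clear_value v
  have hvX : v ≫ p.alg.toBase = p'.alg.toBase := by
    rw [← graph_fst, ← graph_fst, ← hv, Category.assoc]
  -- Both sides have the same composition with the monomorphism `p.graph`, namely `q.graph`.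
  have hw : specMap (inclMap a') ≫ v = specMap (inclMap a) := by
    rw [← cancel_mono p.graph, Category.assoc, hv, ← g, ← g']
  have hle' (U : X.Opens) : p'.alg.toBase ⁻¹ᵁ U ≤ v ⁻¹ᵁ (p.alg.toBase ⁻¹ᵁ U) := by
    rw [← hvX]; rfl
  have hev (U : X.AffineZariskiSite) (s) : (p'.alg.eval U (v.appLE (p.alg.toBase ⁻¹ᵁ U.1)
      (p'.alg.toBase ⁻¹ᵁ U.1) (hle' U.1) s)).1 = (p.alg.eval U s).1 :=
    (eval_specMap_incl a' U _).symm.trans ((congrArg (fun y => (q.alg.eval U y).1)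
      ((appLE_appLE _ v (hle' U.1) (incl_le a' U.1) s).trans (appLE_congr_hom hw _ s))).trans
      (eval_specMap_incl a U s))
  have hle : p.alg ≤ p'.alg := le_of_affine fun U hU s hs => by
    obtain ⟨t, ht⟩ := (p.alg.eval_bijective ⟨U, hU⟩).2 ⟨s, hs⟩
    have h1 := (hev ⟨U, hU⟩ t).trans (congrArg Subtype.val ht)
    have h2 := (p'.alg.eval ⟨U, hU⟩ (v.appLE _ _ (hle' U) t)).2
    exact Eq.subst (motive := fun y => y ∈ p'.alg.obj U) h1 h2
  refine ⟨hle, ?_⟩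
  have hv' : v = specMap (inclMap hle) := hom_ext_of_eval (τ := p.alg.toBase) hvX
    (specMap_incl_toBase hle) fun U s => (hev U s).trans (eval_specMap_incl hle U s).symm
  rw [← hv']
  have := congr($hv ≫ pullback.snd sX sY)
  rw [Category.assoc, graph, graph, pullback.lift_snd, pullback.lift_snd] at this
  exact this.symm

/-- Presentations with closed graph that refine the same presentation are equal. -/
lemma eq_of_refines {p p' q : Presentation sX sY E} [IsClosedImmersion p.graph]
    [IsClosedImmersion p'.graph] (h : p.Refines q) (h' : p'.Refines q) : p = p' := by
  obtain ⟨a, e⟩ := h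
  obtain ⟨a', e'⟩ := h'
  have g := Refines.graph_eq a e
  have g' := Refines.graph_eq a' e'
  -- Both ideals equal that of `q.graph`, as `q.graph` factors through either graph by a morphism
  -- injective on functions.
  have hk : p.graph.ker = p'.graph.ker := by
    rw [← ker_comp_of_injective (specMap (inclMap a)) p.graph (specMap_incl_app_injective a),
      ← ker_comp_of_injective (specMap (inclMap a')) p'.graph (specMap_incl_app_injective a'),
      ← g, ← g']
  exact (refines_of_ker_le a g a' g' hk.le).antisymm (refines_of_ker_le a' g' a g hk.ge)

end Presentation

/-! ### Free modules -/

section Free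
variable {Z : Scheme.{u}}

/-- The structure sheaf as a module over itself. -/
abbrev structSheaf (Z : Scheme.{u}) : Z.Modules := SheafOfModules.unit Z.ringCatSheaf

variable {I : Type u}

/-- The free module on `I`. -/
abbrev freeMod (Z : Scheme.{u}) (I : Type u) : Z.Modules :=
  (SheafOfModules.free I : SheafOfModules.{u} Z.ringCatSheaf)

/-- The inclusion of a summand of a free module. -/
def freeι (i : I) : structSheaf Z ⟶ freeMod Z I := SheafOfModules.ιFree (R := Z.ringCatSheaf) i

lemma exists_desc (N : Z.Modules) (g : I → (structSheaf Z ⟶ N)) :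
   ∃ f : freeMod Z I ⟶ N, ∀ i, freeι i ≫ f = g i :=
  ⟨Cofan.IsColimit.desc (SheafOfModules.isColimitFreeCofan (R := Z.ringCatSheaf) I) g, fun i =>
    Cofan.IsColimit.fac (SheafOfModules.isColimitFreeCofan (R := Z.ringCatSheaf) I) g i⟩

lemma free_hom_ext {N : Z.Modules} {f g : freeMod Z I ⟶ N} (h : ∀ i, freeι i ≫ f = freeι i ≫ g) :
    f = g :=
  Cofan.IsColimit.hom_ext (SheafOfModules.isColimitFreeCofan (R := Z.ringCatSheaf) I) _ _ h

/-- Functions as sections of the structure sheaf. -/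
def unitSec (Z : Scheme.{u}) (V : Z.Opens) : Γ(Z, V) ≃ₗ[Γ(Z, V)] Γ(structSheaf Z, V) where
  toFun a := a
  invFun a := a
  map_add' _ _ := rfl
  map_smul' _ _ := rfl
  left_inv _ := rfl
  right_inv _ := rfl

lemma exists_unit_hom (N : Z.Modules) (x : Γ(N, ⊤)) : ∃ f : structSheaf Z ⟶ N,
    ∀ V (a : Γ(Z, V)), f.app V (unitSec Z V a) = a • resSec N le_top x :=
  ⟨homOfFamily (E := structSheaf Z) (fun V =>
    LinearMap.toSpanSingleton Γ(Z, V) _ (resSec N le_top x) ∘ₗ (unitSec Z V).symm.toLinearMap)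
    fun V V' h a => by
      obtain ⟨a, rfl⟩ := (unitSec Z V).surjective a
      change resFun h a • resSec N le_top x = resSec N h (a • resSec N le_top x)
      rw [resSec_smul, resSec_resSec], fun V a => rfl⟩

lemma unit_hom_app {N : Z.Modules} (f : structSheaf Z ⟶ N) (V : Z.Opens) (m : Γ(structSheaf Z, V)) :
    f.app V m = (unitSec Z V).symm m • f.app V (unitSec Z V 1) := by
  refine Eq.trans ?_ (f.app_smul _ _)
  obtain ⟨a, rfl⟩ := (unitSec Z V).surjective m
  rw [← map_smul, LinearEquiv.symm_apply_apply, smul_eq_mul, mul_one]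

/-- The value at a section, as an additive function of the morphism. -/
def appHom {M : Z.Modules} (N : Z.Modules) {V : Z.Opens} (m : Γ(M, V)) : (M ⟶ N) →+ Γ(N, V) where
  toFun f := f.app V m
  map_zero' := rfl
  map_add' _ _ := rfl

/-- A free module is a coproduct of sheaves, whose sections are not visible from the definition. For
finite `I` the coordinate morphisms `p j` and the identity `∑ p j ≫ ι j = 𝟙` make it a biproduct,
and this can be evaluated on any open. -/
lemma exists_basis_free [Finite I] (V : Z.Opens) :
    ∃ b : Module.Basis I Γ(Z, V) Γ(freeMod Z I, V), ∀ i, b i = (freeι i).app V (unitSec Z V 1) := by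
  classical
  cases nonempty_fintype I
  choose p hp using fun j : I => exists_desc (structSheaf Z) (fun i : I => if i = j then 𝟙 _ else 0)
  have hp₁ (j : I) : freeι j ≫ p j = 𝟙 _ := (hp j j).trans (if_pos rfl)
  have hp₀ (i j : I) (h : i ≠ j) : freeι i ≫ p j = 0 := (hp j i).trans (if_neg h)
  have hs : ∑ j, p j ≫ freeι j = 𝟙 (freeMod Z I) := free_hom_ext fun i => by
    rw [Preadditive.comp_sum, Finset.sum_eq_single i]
    · rw [← Category.assoc, hp₁, Category.id_comp, Category.comp_id]
    · intro j _ hj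
      rw [← Category.assoc, hp₀ _ _ hj.symm, zero_comp]
    · simp
  let e i : Γ(freeMod Z I, V) := (freeι i).app V (unitSec Z V 1)
  have hpe₁ (j) : (p j).app V (e j) = unitSec Z V 1 := congr(($(hp₁ j)).app V (unitSec Z V 1))
  have hpe₀ (i j) (h : i ≠ j) : (p j).app V (e i) = 0 := congr(($(hp₀ i j h)).app V (unitSec Z V 1))
  have hm (m : Γ(freeMod Z I, V)) : ∑ j, (unitSec Z V).symm ((p j).app V m) • e j = m := by
    have := congr(appHom _ m $hs)
    rw [map_sum] at this
    exact Eq.trans (Finset.sum_congr rfl fun j _ => (unit_hom_app (freeι j) V ((p j).app V m)).symm) this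
  have hli : LinearIndependent Γ(Z, V) e := by
    rw [Fintype.linearIndependent_iff]
    intro c hc j
    have := congr(appLin (p j) V $hc)
    rw [map_sum, map_zero, Finset.sum_eq_single j] at this
    · rw [map_smul] at this
      have h2 := congr(c j • $(hpe₁ j)).symm.trans this
      rwa [← map_smul, smul_eq_mul, mul_one, map_eq_zero_iff _ (unitSec Z V).injective] at h2
    · intro i _ hij
      rw [map_smul]
      exact congr(c i • $(hpe₀ i j hij)).trans (smul_zero _)
    · simp
  refine ⟨.mk hli fun m _ => ?_, fun i => Module.Basis.mk_apply _ _ _⟩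
  rw [← hm m]
  exact Submodule.sum_mem _ fun j _ => Submodule.smul_mem _ _ (Submodule.subset_span ⟨j, rfl⟩)

end Free

/-! ### Locally free sheaves through bases of sections -/

section LocallyFree
variable {X : Scheme.{u}} {I : Type*} [Fintype I]

lemma restrictAppIso_smul (E : X.Modules) (U : X.Opens) (V : U.toScheme.Opens) (a : Γ(X, U.ι ''ᵁ V))
    (m : Γ(E.restrict U.ι, V)) : (E.restrictAppIso U.ι V).hom ((show Γ(U, V) from a) • m) =
      a • (E.restrictAppIso U.ι V).hom m := by
  have := congr($(E.smul_restrictAppIso_hom (f := U.ι) V a) m)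
  rw [Scheme.Opens.ι_appIso] at this
  exact this

/-- Sections over `U` that form a basis over every open of `U`. -/
def IsSectionBasis {E : X.Modules} {U : X.Opens} (e : I → Γ(E, U)) : Prop :=
  ∀ (V : X.Opens) (h : V ≤ U),
    Function.Bijective (fun c : I → Γ(X, V) => ∑ i, c i • resSec E h (e i))

lemma exists_image_eq {U V : X.Opens} (h : V ≤ U) : ∃ V' : U.toScheme.Opens, U.ι ''ᵁ V' = V :=
  ⟨U.ι ⁻¹ᵁ V, by rw [Scheme.Hom.image_preimage_eq_opensRange_inf]; simpa using h⟩

lemma resSec_freeι {J : Type u} (i : J) (V : X.Opens) : resSec (freeMod X J) (le_top : V ≤ ⊤)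
    ((freeι i).app ⊤ (unitSec X ⊤ 1)) = (freeι i).app V (unitSec X V 1) :=
  (app_resSec (freeι i) le_top _).symm.trans
    (congrArg (fun a => (freeι i).app V (unitSec X V a)) (map_one (resFun le_top)))

lemma isSectionBasis_freeι (J : Type u) [Fintype J] : IsSectionBasis (X := X)
    (fun i : J => (freeι i).app ⊤ (unitSec X ⊤ 1)) := fun V h => by
  obtain ⟨b, hb⟩ := exists_basis_free (I := J) V
  convert b.equivFun.symm.bijective using 2 with c
  rw [Module.Basis.equivFun_symm_apply]
  exact Finset.sum_congr rfl fun i _ => by rw [hb, resSec_freeι]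

lemma exists_isSectionBasis {E : X.Modules} {r : ℕ} (hE : IsLocallyFreeOfRank E r) (x : X) :
    ∃ (U : X.Opens) (e : Fin r → Γ(E, U)), x ∈ U ∧ IsSectionBasis e := by
  obtain ⟨U, hx, ⟨φ⟩⟩ := hE x
  let φ : E.restrict U.ι ≅ freeMod U (ULift (Fin r)) := φ
  let e₀ (i : Fin r) : Γ(E.restrict U.ι, ⊤) := φ.inv.app ⊤ ((freeι ⟨i⟩).app ⊤ (unitSec U ⊤ 1))
  refine ⟨U.ι ''ᵁ ⊤, fun i => (E.restrictAppIso U.ι ⊤).hom (e₀ i), by simpa using hx, fun V h => ?_⟩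
  obtain ⟨V, rfl⟩ := exists_image_eq (h.trans (by simp : U.ι ''ᵁ ⊤ ≤ U))
  obtain ⟨b, hb⟩ := exists_basis_free (Z := U) (I := ULift.{u} (Fin r)) V
  let k : Γ(freeMod U (ULift (Fin r)), V) →+ Γ(E, U.ι ''ᵁ V) :=
    (E.restrictAppIso U.ι V).hom.hom.comp (φ.inv.app V).hom
  have hk : Function.Bijective k :=
    (ConcreteCategory.bijective_of_isIso (φ.inv.app V ≫ (E.restrictAppIso U.ι V).hom))
  have hkb (i) : k (b ⟨i⟩) = resSec E h ((E.restrictAppIso U.ι ⊤).hom (e₀ i)) := by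
    rw [hb, ← resSec_freeι]
    exact congr((E.restrictAppIso U.ι V).hom $(app_resSec φ.inv le_top _))
  have hkl (a : Γ(X, U.ι ''ᵁ V)) (m) : k ((show Γ(U, V) from a) • m) = a • k m := by
    refine Eq.trans ?_ (restrictAppIso_smul E U V a _)
    exact congr((E.restrictAppIso U.ι V).hom $(φ.inv.app_smul _ _))
  let k' (c : Fin r → Γ(X, U.ι ''ᵁ V)) : Γ(E, U.ι ''ᵁ V) :=
    k ((b.reindex Equiv.ulift).equivFun.symm c)
  have hk' : Function.Bijective k' := hk.comp (b.reindex Equiv.ulift).equivFun.symm.bijective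
  refine (iff_of_eq (congrArg Function.Bijective (funext fun c => ?_))).mp hk'
  refine (congrArg k (Module.Basis.equivFun_symm_apply _ _)).trans ((map_sum k _ _).trans ?_)
  exact Finset.sum_congr rfl fun i _ => (hkl _ _).trans (congrArg (fun y => c i • y)
    ((congrArg k (b.reindex_apply _ i)).trans (hkb i)))

/-- In coordinates both conditions reduce to functions. There are finitely many coordinates, so the
sum of their exponents serves as a common exponent. -/
lemma isQuasicoherent_of_isSectionBasis {E : X.Modules}
    (h : ∀ x : X, ∃ (U : X.Opens) (n : ℕ) (e : Fin n → Γ(E, U)), x ∈ U ∧ IsSectionBasis e) :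
    SheafOfModules.IsQuasicoherent.{u} E := by
  refine isQuasicoherent_of_exists E fun x => ?_
  obtain ⟨U, r, e, hx, he⟩ := h x
  obtain ⟨W, hW, hxW, hWU⟩ := exists_affine_mem hx
  refine ⟨W, hxW, hW, fun f => ⟨fun s => ?_, fun t ht => ?_⟩⟩
  · obtain ⟨c, rfl⟩ := (he _ ((X.basicOpen_le f).trans hWU)).2 s
    choose n t ht using fun i => exists_resFun_eq hW f rfl (X.basicOpen_le f) (c i)
    refine ⟨∑ i, n i, ∑ i, (f ^ (∑ i, n i - n i) * t i) • resSec E hWU (e i), ?_⟩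
    refine (map_sum (E.presheaf.map (homOfLE (X.basicOpen_le f)).op).hom _ _).trans ?_
    rw [Finset.smul_sum]
    refine Finset.sum_congr rfl fun i _ => ?_
    refine (resSec_smul E _ _ _).trans ?_
    rw [resSec_resSec, smul_smul, map_mul, ht, ← mul_assoc, ← map_mul, ← pow_add,
      Nat.sub_add_cancel (Finset.single_le_sum (fun _ _ => Nat.zero_le _) (Finset.mem_univ i))]
  · obtain ⟨c, rfl⟩ := (he _ hWU).2 t
    have h0 : (fun i => resFun (X.basicOpen_le f) (c i)) = 0 := by
      refine (he _ ((X.basicOpen_le f).trans hWU)).1 ?_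
      refine Eq.trans ?_ (ht.trans (by simp))
      refine Eq.trans ?_ (map_sum (E.presheaf.map (homOfLE (X.basicOpen_le f)).op).hom _ _).symm
      refine Finset.sum_congr rfl fun i _ => ?_
      refine Eq.trans ?_ (resSec_smul E _ _ _).symm
      rw [resSec_resSec]
    choose n hn using fun i =>
      exists_pow_mul_eq_zero hW f rfl (X.basicOpen_le f) (c i) (congrFun h0 i)
    refine ⟨∑ i, n i, ?_⟩
    rw [Finset.smul_sum]
    refine Finset.sum_eq_zero fun i _ => ?_
    rw [smul_smul, ← Nat.sub_add_cancel (Finset.single_le_sum (f := n) (fun _ _ => Nat.zero_le _)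
      (Finset.mem_univ i)), pow_add, mul_assoc, hn, mul_zero, zero_smul]

lemma IsLocallyFreeOfRank.isQuasicoherent {E : X.Modules} {r : ℕ} (hE : IsLocallyFreeOfRank E r) :
    SheafOfModules.IsQuasicoherent.{u} E :=
  isQuasicoherent_of_isSectionBasis fun x =>
    let ⟨U, e, h⟩ := exists_isSectionBasis hE x
    ⟨U, r, e, h⟩

lemma isQuasicoherent_freeMod (r : ℕ) :
    SheafOfModules.IsQuasicoherent.{u} (freeMod X (ULift.{u} (Fin r))) := by
  refine isQuasicoherent_of_isSectionBasis fun x =>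
    ⟨⊤, r, fun i => (freeι ⟨i⟩).app ⊤ (unitSec X ⊤ 1), trivial, fun V h => ?_⟩
  convert (isSectionBasis_freeι (ULift.{u} (Fin r)) V h).comp
    (Equiv.piCongrLeft (fun _ => Γ(X, V)) (Equiv.ulift.{u} (α := Fin r)).symm).bijective using 2 with c
  refine Fintype.sum_equiv Equiv.ulift.symm _ _ fun i => ?_
  rfl

omit [Fintype I] in
lemma exists_basis_of_eq {E : X.Modules} {U V : X.Opens} (h : U = V)
    (b : Module.Basis I Γ(X, U) Γ(E, U)) : Nonempty (Module.Basis I Γ(X, V) Γ(E, V)) :=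
  h ▸ ⟨b⟩

/-- The basis defines a morphism from the free module to the restriction of `E`, bijective on global
sections of the affine scheme `U`. Both sheaves are quasi-coherent, so it is bijective on basic
opens, hence an isomorphism. -/
lemma isLocallyFreeOfRank_of_basis {E : X.Modules} (hE : SheafOfModules.IsQuasicoherent.{u} E) {r : ℕ}
    (h : ∀ x : X, ∃ U : X.Opens, IsAffineOpen U ∧ x ∈ U ∧
      Nonempty (Module.Basis (Fin r) Γ(X, U) Γ(E, U))) : IsLocallyFreeOfRank E r := fun x => by
  obtain ⟨U, hU, hx, ⟨b⟩⟩ := h x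
  obtain ⟨b⟩ := exists_basis_of_eq (show U = U.ι ''ᵁ ⊤ by simp) b
  refine ⟨U, hx, ?_⟩
  let e (i : ULift.{u} (Fin r)) : Γ(E.restrict U.ι, ⊤) := (E.restrictAppIso U.ι ⊤).inv (b i.down)
  choose g hg using fun i => exists_unit_hom (E.restrict U.ι) (e i)
  obtain ⟨f, hf⟩ := exists_desc (E.restrict U.ι) g
  have : IsAffine U.toScheme := hU
  have hf' (i) : f.app ⊤ ((freeι i).app ⊤ (unitSec U ⊤ 1)) = e i := by
    refine (congr(($(hf i)).app ⊤ (unitSec U ⊤ 1))).trans ((hg i ⊤ 1).trans ?_)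
    rw [one_smul, resSec_self]
  have hb : Function.Bijective (f.app ⊤) := by
    obtain ⟨b', hb'⟩ := exists_basis_free (Z := U) (I := ULift.{u} (Fin r)) ⊤
    have hi : Function.Bijective (E.restrictAppIso U.ι ⊤).hom := ConcreteCategory.bijective_of_isIso _
    refine (Function.Bijective.of_comp_iff' hi _).mp ?_
    refine (Function.Bijective.of_comp_iff _ b'.equivFun.symm.bijective).mp ?_
    refine (iff_of_eq (congrArg Function.Bijective (funext fun c => ?_))).mpr
      (b.reindex Equiv.ulift.symm).equivFun.symm.bijective
    refine Eq.trans ?_ (Module.Basis.equivFun_symm_apply _ _).symm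
    refine (congrArg ((E.restrictAppIso U.ι ⊤).hom.hom.comp (f.app ⊤).hom)
      (Module.Basis.equivFun_symm_apply b' c)).trans ?_
    refine (map_sum ((E.restrictAppIso U.ι ⊤).hom.hom.comp (f.app ⊤).hom) _ _).trans ?_
    refine Finset.sum_congr rfl fun i _ => ?_
    refine (congr((E.restrictAppIso U.ι ⊤).hom $(f.app_smul _ _))).trans ?_
    refine (restrictAppIso_smul E U ⊤ _ _).trans
      (congrArg (fun y : Γ(E, U.ι ''ᵁ ⊤) => (show Γ(X, U.ι ''ᵁ ⊤) from c i) • y) ?_)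
    rw [hb', hf']
    exact congr($((E.restrictAppIso U.ι ⊤).inv_hom_id) (b i.down)).trans
      (b.reindex_apply Equiv.ulift.symm i).symm
  have hqc : SheafOfModules.IsQuasicoherent.{u} (E.restrict U.ι) :=
    Scheme.Modules.isQuasicoherent_restrictFunctor U.ι E
  have : IsIso f := isIso_of_locally_bijective f fun V y hy => by
    obtain ⟨a, ha, hya⟩ := (isAffineOpen_top U.toScheme).exists_basicOpen_le ⟨y, hy⟩ trivial
    exact ⟨_, ha, hya, bijective_basicOpen (isQuasicoherent_freeMod r) hqc f (isAffineOpen_top _) hb a⟩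
  exact ⟨(asIso f).symm⟩

end LocallyFree

/-! ### Finite generation of sections over affine opens -/

section Finite
variable {Z : Scheme.{u}}

/-- For a quasi-coherent module, finite generation of the sections over affine opens is local. -/
lemma finite_of_affine_cover {M : Z.Modules} (hM : SheafOfModules.IsQuasicoherent.{u} M)
    (h : ∀ z : Z, ∃ W : Z.Opens, IsAffineOpen W ∧ z ∈ W ∧ Module.Finite Γ(Z, W) Γ(M, W))
    {W : Z.Opens} (hW : IsAffineOpen W) : Module.Finite Γ(Z, W) Γ(M, W) := by
  choose U hU hz hf using h
  refine of_affine_open_cover (P := fun W : Z.affineOpens => Module.Finite Γ(Z, W.1) Γ(M, W.1))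
    (fun z => ⟨U z, hU z⟩) (top_le_iff.mp fun z _ => TopologicalSpace.Opens.mem_iSup.mpr ⟨z, hz z⟩)
    ⟨W, hW⟩ (fun V f hV => ?_) (fun V s hs hV => ?_) hf
  · obtain ⟨S, hS⟩ := hV.fg_top
    classical
    refine ⟨⟨S.image (resSec M (Z.basicOpen_le f)), top_le_iff.mp fun s _ => ?_⟩⟩
    obtain ⟨n, t, ht⟩ := exists_resSec_eq hM V.2 f rfl (Z.basicOpen_le f) s
    rw [map_pow] at ht
    refine (Submodule.smul_mem_iff_of_isUnit _
      ((isUnit_resFun f (Z.basicOpen_le f) le_rfl).pow n)).mp ?_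
    refine ht ▸ ?_
    clear ht
    induction (show t ∈ Submodule.span Γ(Z, V.1) (S : Set Γ(M, V.1)) from hS.ge trivial) using Submodule.span_induction with
    | mem t h => exact Submodule.subset_span (by simpa using ⟨t, h, rfl⟩)
    | zero => exact (resSec_zero M (Z.basicOpen_le f)).symm ▸ Submodule.zero_mem _
    | add a b _ _ h h' => exact (resSec_add M (Z.basicOpen_le f) a b).symm ▸ Submodule.add_mem _ h h'
    | smul a b _ h =>
      exact (resSec_smul M (Z.basicOpen_le f) a b).symm ▸ Submodule.smul_mem _ _ h
  · have hle (f : s) := Z.basicOpen_le f.1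
    choose S hS using fun f => (hV f).fg_top
    choose n t ht using fun (f : s) (g : Γ(M, Z.basicOpen f.1)) =>
      exists_resSec_eq hM V.2 f.1 rfl (Z.basicOpen_le f.1) g
    classical
    let T : Finset Γ(M, V.1) := Finset.univ.biUnion fun f : s => (S f).image (t f)
    refine ⟨⟨T, top_le_iff.mp fun m _ => ?_⟩⟩
    refine Submodule.mem_of_span_eq_top_of_smul_pow_mem _ _ hs m fun f => ?_
    -- The set `T` consists of lifts, up to powers of `f`, of generators over each `D(f)`. By
    -- induction on the span, every section over `D(f)` lifts to the span of `T` after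
    -- multiplication by a power of `f`.
    have key (y : Γ(M, Z.basicOpen f.1)) : ∃ (n : ℕ) (m' : Γ(M, V.1)),
        m' ∈ Submodule.span Γ(Z, V.1) (T : Set Γ(M, V.1)) ∧
          resSec M (hle f) m' = resFun (hle f) (f.1 ^ n) • y := by
      induction (show y ∈ Submodule.span Γ(Z, Z.basicOpen f.1) (show Set Γ(M, Z.basicOpen f.1) from SetLike.coe (S f)) from
        (hS f).ge trivial) using Submodule.span_induction with
      | mem y h =>
        exact ⟨n f y, t f y, Submodule.subset_span (Finset.mem_coe.mpr (Finset.mem_biUnion.mpr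
          ⟨f, Finset.mem_univ _, Finset.mem_image_of_mem _ h⟩)), ht f y⟩
      | zero => exact ⟨0, 0, zero_mem _, (resSec_zero M (hle f)).trans (smul_zero _).symm⟩
      | add a b _ _ h h' =>
        obtain ⟨n, m, hm, e⟩ := h
        obtain ⟨n', m', hm', e'⟩ := h'
        refine ⟨n + n', f.1 ^ n' • m + f.1 ^ n • m',
          add_mem (Submodule.smul_mem _ _ hm) (Submodule.smul_mem _ _ hm'), ?_⟩
        rw [resSec_add, resSec_smul, resSec_smul, e, e', smul_smul, smul_smul, ← map_mul, ← map_mul,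
          ← pow_add, ← pow_add, add_comm n', ← smul_add]
      | smul c y _ h =>
        obtain ⟨n, m, hm, e⟩ := h
        obtain ⟨k, a, ha⟩ := exists_resFun_eq V.2 f.1 rfl (hle f) c
        refine ⟨n + k, a • m, Submodule.smul_mem _ _ hm, ?_⟩
        refine (resSec_smul M (hle f) a m).trans ?_
        rw [e, ha, smul_smul, smul_smul, pow_add, map_mul]
        congr 1
        ring
    obtain ⟨n, m', hm', e⟩ := key (resSec M (hle f) m)
    have e' : resSec M (hle f) (f.1 ^ n • m - m') = 0 := by
      rw [resSec_sub, resSec_smul, e, sub_self]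
    obtain ⟨k, hk⟩ := exists_pow_smul_eq_zero hM V.2 f.1 rfl (hle f) _ e'
    refine ⟨k + n, ?_⟩
    rw [smul_sub, sub_eq_zero, smul_smul, ← pow_add] at hk
    exact hk ▸ Submodule.smul_mem _ _ hm'

lemma IsLocallyFreeOfRank.exists_basis {E : Z.Modules} {r : ℕ} (hE : IsLocallyFreeOfRank E r) (z : Z) :
    ∃ W : Z.Opens, IsAffineOpen W ∧ z ∈ W ∧ Nonempty (Module.Basis (Fin r) Γ(Z, W) Γ(E, W)) := by
  obtain ⟨U, e, hz, he⟩ := exists_isSectionBasis hE z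
  obtain ⟨W, hW, hzW, hWU⟩ := exists_affine_mem hz
  refine ⟨W, hW, hzW, ⟨.ofEquivFun (LinearEquiv.ofBijective
    (Fintype.linearCombination Γ(Z, W) fun i => resSec E hWU (e i)) (he W hWU)).symm⟩⟩

lemma IsLocallyFreeOfRank.finite {E : Z.Modules} {r : ℕ} (hE : IsLocallyFreeOfRank E r)
    {W : Z.Opens} (hW : IsAffineOpen W) : Module.Finite Γ(Z, W) Γ(E, W) :=
  finite_of_affine_cover hE.isQuasicoherent (fun z =>
    let ⟨W, hW, hz, ⟨b⟩⟩ := hE.exists_basis z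
    ⟨W, hW, hz, .of_basis b⟩) hW

end Finite

/-! ### Endomorphisms over affine opens, and finiteness of the surrogate -/

section EndOn
variable {X Z : Scheme.{u}} {E : X.Modules}

/-- The action of a section of `ℰnd(E)` over `U` on sections of `E` over `U`. -/
def EndOn.toEnd (E : X.Modules) (U : X.Opens) : EndOn E U →+* Module.End Γ(X, U) Γ(E, U) where
  toFun s := s.1 ⟨U, le_rfl⟩
  map_one' := rfl
  map_mul' _ _ := rfl
  map_zero' := rfl
  map_add' _ _ := rfl

/-- The additive endomorphism underlying a linear one. -/
def endToAdd (R M : Type*) [CommRing R] [AddCommGroup M] [Module R M] :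
    Module.End R M →+* AddMonoid.End M where
  toFun s := s.toAddMonoidHom
  map_one' := rfl
  map_mul' _ _ := rfl
  map_zero' := rfl
  map_add' _ _ := rfl

/-- Sections of `ℰnd(E)` over an affine open are determined by their action there. -/
lemma EndOn.toEnd_injective (hE : SheafOfModules.IsQuasicoherent.{u} E) {U : X.Opens}
    (hU : IsAffineOpen U) : Function.Injective (EndOn.toEnd E U) := fun s s' h => by
  apply Subtype.ext
  funext V
  ext m
  exact family_ext hE E hU (fun V hV => s.1 ⟨V, hV⟩) (fun V hV => s'.1 ⟨V, hV⟩)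
    (fun V V' hV hV' m => s.2 ⟨V, hV⟩ ⟨V', hV'.trans hV⟩ hV' m)
    (fun V V' hV hV' m => s'.2 ⟨V, hV⟩ ⟨V', hV'.trans hV⟩ hV' m)
    (fun m => congr($h m)) V.1 V.2 m

lemma appLE_injective_of_app {T : Scheme.{u}} {f : T ⟶ Z} {τ : Z ⟶ X} {π : T ⟶ X} (h : f ≫ τ = π)
    (U : X.Opens) (hf : Function.Injective (f.app (τ ⁻¹ᵁ U))) :
    Function.Injective (f.appLE (τ ⁻¹ᵁ U) (π ⁻¹ᵁ U) (by rw [← h]; rfl)) := by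
  subst h
  change Function.Injective (f.appLE (τ ⁻¹ᵁ U) (f ⁻¹ᵁ (τ ⁻¹ᵁ U)) le_rfl)
  rwa [← Scheme.Hom.app_eq_appLE]

end EndOn

namespace CommSubalgebra
variable {X Z : Scheme.{u}} {E : X.Modules} (A : CommSubalgebra E) {τ : Z ⟶ X}
open Scheme.AffineZariskiSite

/-- Elements of `𝒜(U)` are endomorphisms of `E`, so ring maps into `𝒜` make the functions on `Z`
act; compatibility with `𝒪_X` need only be checked on affine opens. -/
lemma exists_act_of_ringHom (ψ : ∀ U : X.AffineZariskiSite, Γ(Z, τ ⁻¹ᵁ U.1) →+* A.obj U.1)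
    (hψ : ∀ (U V : X.AffineZariskiSite) (h : V.1 ≤ U.1) (s : Γ(Z, τ ⁻¹ᵁ U.1)),
      A.res h (ψ U s) = ψ V (resFun (τ.preimage_mono h) s))
    (hs : ∀ (U : X.AffineZariskiSite) (a : Γ(X, U.1)), ψ U (τ.app U.1 a) = A.scalar U.1 a) :
    ∃ α : Act τ E, (∀ V a m, α.act V (τ.app V a) m = a • m) ∧
      ∀ (U : X.AffineZariskiSite) t m, α.act U.1 t m = (ψ U t).1.1 ⟨U.1, le_rfl⟩ m := by
  obtain ⟨α, hα⟩ := exists_act (E := E) (π := τ)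
    (fun U hU => (endToAdd _ _).comp ((EndOn.toEnd E U).comp ((A.obj U).subtype.comp (ψ ⟨U, hU⟩))))
    fun U V hU hV h t m => by
      have h1 := congr(($(hψ ⟨U, hU⟩ ⟨V, hV⟩ h t)).1.1 ⟨V, le_rfl⟩ (resSec E h m))
      refine Eq.trans ?_ h1
      exact ((ψ ⟨U, hU⟩ t).1.2 ⟨U, le_rfl⟩ ⟨V, h⟩ h m).symm
  have hα' (U : X.AffineZariskiSite) t m : α.act U.1 t m = (ψ U t).1.1 ⟨U.1, le_rfl⟩ m :=
    congr($(hα U.1 U.2) t m)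
  refine ⟨α, fun V a m => ?_, hα'⟩
  refine section_ext _ _ _ fun x hx => ?_
  obtain ⟨W, hW, hxW, hWV⟩ := exists_affine_mem hx
  refine ⟨W, hWV, hxW, ?_⟩
  rw [α.res, resSec_smul, ← app_resFun τ hWV]
  refine (hα' ⟨W, hW⟩ _ _).trans ?_
  exact (congr(($(hs ⟨W, hW⟩ (resFun hWV a))).1.1 ⟨W, le_rfl⟩ (resSec E hWV m))).trans
    congr($(resFun_self (resFun hWV a)) • resSec E hWV m)

lemma eval_ext (hE : SheafOfModules.IsQuasicoherent.{u} E) {U : X.AffineZariskiSite}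
    {s t : Γ(A.surrogate, A.toBase ⁻¹ᵁ U.1)}
    (h : EndOn.toEnd E U.1 (A.eval U s).1 = EndOn.toEnd E U.1 (A.eval U t).1) : s = t :=
  (A.eval_bijective U).1 (Subtype.ext (EndOn.toEnd_injective hE U.2 h))

/-- The functions over an affine `U` embed in `End Γ(E, U)`, a finitely generated module over the
Noetherian ring `Γ(X, U)`, so they are finitely generated as well. -/
lemma isFinite_toBase [IsLocallyNoetherian X] (hE : SheafOfModules.IsQuasicoherent.{u} E)
    (hf : ∀ U : X.Opens, IsAffineOpen U → Module.Finite Γ(X, U) Γ(E, U)) : IsFinite A.toBase := by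
  refine ⟨fun U hU => ?_⟩
  have := hf U hU
  have : IsNoetherianRing Γ(X, U) := IsLocallyNoetherian.component_noetherian ⟨U, hU⟩
  algebraize [(A.toBase.app U).hom]
  let l : Γ(A.surrogate, A.toBase ⁻¹ᵁ U) →ₗ[Γ(X, U)] Module.End Γ(X, U) Γ(E, U) :=
    { toFun t := EndOn.toEnd E U (A.eval ⟨U, hU⟩ t).1
      map_add' a b := congr(EndOn.toEnd E U ($(map_add (A.eval ⟨U, hU⟩) a b)).1)
      map_smul' a b := by
        refine (congr(EndOn.toEnd E U ($(map_mul (A.eval ⟨U, hU⟩) _ b)).1)).trans ?_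
        ext m
        exact (congr(($(A.eval_app ⟨U, hU⟩ a)).1.1 ⟨U, le_rfl⟩
          ((A.eval ⟨U, hU⟩ b).1.1 ⟨U, le_rfl⟩ m))).trans
          congr($(resFun_self a) • (A.eval ⟨U, hU⟩ b).1.1 ⟨U, le_rfl⟩ m) }
  exact Module.Finite.of_injective l fun s t h => A.eval_ext (U := ⟨U, hU⟩) hE h

end CommSubalgebra

/-! ### The scheme-theoretic image of a scheme finite over the base -/

section Image
variable {T P X : Scheme.{u}}

/-- A proper morphism that is locally quasi-finite is finite. -/
lemma isFinite_of_finite_fibres (f : T ⟶ X) [IsProper f] (h : ∀ x, (f ⁻¹' {x}).Finite) : IsFinite f :=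
  have : LocallyQuasiFinite f := .of_finite_preimage_singleton f h
  .of_isProper_of_locallyQuasiFinite f

/-- Since `f` is proper, `T` surjects onto the image. The image therefore inherits from `T` both
universal closedness over `X` and finiteness of the fibres. -/
lemma isFinite_imageι_comp (f : T ⟶ P) (g : P ⟶ X) [IsFinite (f ≫ g)] [IsSeparated g]
    [LocallyOfFiniteType g] : IsFinite (f.imageι ≫ g) := by
  have : IsProper f := .of_comp f g
  have : UniversallyClosed (f.toImage ≫ f.imageι ≫ g) := by
    rw [Scheme.Hom.toImage_imageι_assoc]; infer_instance
  have : UniversallyClosed (f.imageι ≫ g) := .of_comp_surjective f.toImage _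
  have : IsProper (f.imageι ≫ g) := ⟨⟩
  refine isFinite_of_finite_fibres _ fun x =>
    (((f ≫ g).finite_preimage_singleton x).image f.toImage).subset fun z hz => ?_
  obtain ⟨t, rfl⟩ := f.toImage.surjective z
  refine ⟨t, ?_, rfl⟩
  have e : f.toImage ≫ f.imageι ≫ g = f ≫ g := f.toImage_imageι_assoc g
  exact (congr($e t)).symm.trans hz

lemma toImage_app_injective (f : T ⟶ P) [IsAffineHom f] (V : f.image.Opens) :
    Function.Injective (f.toImage.app V) :=
  app_injective_of_appLE (π := f.imageι) (τ := f) f.toImage f.toImage_imageι (fun U hU =>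
    appLE_injective_of_app f.toImage_imageι U (f.toImage_app_injective (U := ⟨U, hU⟩))) V

end Image

/-! ### Existence of refinements with closed graph -/

namespace Presentation
variable {S X Y : Scheme.{u}} {sX : X ⟶ S} {sY : Y ⟶ S} {E : X.Modules}
open CommSubalgebra

lemma graph_snd (p : Presentation sX sY E) : p.graph ≫ pullback.snd sX sY = p.map :=
  pullback.lift_snd _ _ _

/-- A presentation whose graph factors through a closed subscheme affine over the base, by a morphism
injective on functions, is refined by one with graph the closed subscheme. -/
lemma exists_refines_of_factors (hE : SheafOfModules.IsQuasicoherent.{u} E)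
    (q : Presentation sX sY E) {Z : Scheme.{u}} (w : q.alg.surrogate ⟶ Z) (i : Z ⟶ pullback sX sY)
    [IsClosedImmersion i] [IsAffineHom (i ≫ pullback.fst sX sY)] (hwi : w ≫ i = q.graph)
    (hw : ∀ V, Function.Injective (w.app V)) :
    ∃ p : Presentation sX sY E, IsClosedImmersion p.graph ∧ p.Refines q := by
  let τ := i ≫ pullback.fst sX sY
  have hwτ : w ≫ τ = q.alg.toBase := by
    rw [← graph_fst, ← hwi, Category.assoc]
  have : IsAffineHom τ := inferInstanceAs (IsAffineHom (i ≫ pullback.fst sX sY))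
  have hle (U : X.Opens) : q.alg.toBase ⁻¹ᵁ U ≤ w ⁻¹ᵁ (τ ⁻¹ᵁ U) := by rw [← hwτ]; rfl
  let ψ (U : X.AffineZariskiSite) := (q.alg.eval U).comp (w.appLE (τ ⁻¹ᵁ U.1) _ (hle U.1)).hom
  obtain ⟨α, hα, hα'⟩ := q.alg.exists_act_of_ringHom ψ
    (fun U V h s => (q.alg.res_eval h _).trans (congrArg (q.alg.eval V)
      ((resFun_appLE w (hle U.1) (q.alg.toBase.preimage_mono h) s).trans
        (appLE_resFun w (τ.preimage_mono h) (hle V.1) s).symm)))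
    (fun U a => by
      refine Eq.trans (congrArg (q.alg.eval U) ?_) (q.alg.eval_app U a)
      rw [Scheme.Hom.app_eq_appLE, Scheme.Hom.app_eq_appLE]
      exact (appLE_appLE w τ le_rfl (hle U.1) a).trans (appLE_congr_hom hwτ _ a))
  have hval (U : X.AffineZariskiSite) (t) : α.toEndOn hα U.1 t = (ψ U t).1 := by
    refine EndOn.toEnd_injective hE U.2 (LinearMap.ext fun m => ?_)
    refine (α.toEndOn_apply hα U.1 t ⟨U.1, le_rfl⟩ m).trans ?_
    exact (congrArg (fun t => α.act U.1 t m) (resFun_self t)).trans (hα' U t m)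
  -- Functions on `Z` act on `E` through `w` and the algebra of `q`. The action is faithful because
  -- `w` is injective on functions and a function on the surrogate is determined by its
  -- endomorphism.
  obtain ⟨A, u, hu, hA, hA'⟩ := α.exists_commSubalgebra hα fun U hU t ht => by
    refine appLE_injective_of_app hwτ U (hw _) ((q.alg.eval_ext (U := ⟨U, hU⟩) hE ?_).trans
      (map_zero (w.appLE _ _ (hle U)).hom).symm)
    refine LinearMap.ext fun m => (hα' ⟨U, hU⟩ t m).symm.trans ((ht m).trans ?_)
    exact congrArg (fun y => EndOn.toEnd E U y.1 m) (map_zero (q.alg.eval ⟨U, hU⟩)).symm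
  let p : Presentation sX sY E := ⟨A, u.hom ≫ i ≫ pullback.snd sX sY, by
    rw [Category.assoc, Category.assoc, ← pullback.condition, ← hu]
    simp only [τ, Category.assoc]⟩
  have hp : p.graph = u.hom ≫ i := by
    apply pullback.hom_ext
    · rw [graph_fst, Category.assoc]; exact hu.symm
    · rw [graph_snd, Category.assoc]
  have hpq : p.alg ≤ q.alg := le_of_affine fun U hU s hs => by
    have hs' : s ∈ (α.toEndOn hα U).range := (hA' U).le hs
    obtain ⟨t, ht⟩ := RingHom.mem_range.mp hs'
    have h2 := (ψ ⟨U, hU⟩ t).2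
    exact Eq.subst (motive := fun y => y ∈ q.alg.obj U) ((hval ⟨U, hU⟩ t).symm.trans ht) h2
  have hw' : specMap (inclMap hpq) ≫ u.hom = w := by
    have hu' : (specMap (inclMap hpq) ≫ u.hom) ≫ τ = q.alg.toBase := by
      rw [Category.assoc, hu]; exact specMap_incl_toBase hpq
    refine hom_ext_of_eval (τ := τ) hu' hwτ fun U s => ?_
    have hleu : A.toBase ⁻¹ᵁ U.1 ≤ u.hom ⁻¹ᵁ (τ ⁻¹ᵁ U.1) := by rw [← hu]; rfl
    refine (congrArg (fun y => (q.alg.eval U y).1)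
      (appLE_appLE _ u.hom hleu (incl_le hpq U.1) s).symm).trans ?_
    exact (eval_specMap_incl hpq U _).trans ((hA U s).trans (hval U s))
  refine ⟨p, by rw [hp]; infer_instance, hpq, ?_⟩
  rw [← graph_snd q, ← hwi, ← hw', Category.assoc, Category.assoc]

/-- Every presentation is refined by one with closed graph. -/
lemma exists_refines [IsLocallyNoetherian X] [IsProper sY] (hE : SheafOfModules.IsQuasicoherent.{u} E)
    (hf : ∀ U : X.Opens, IsAffineOpen U → Module.Finite Γ(X, U) Γ(E, U))
    (q : Presentation sX sY E) :
    ∃ p : Presentation sX sY E, IsClosedImmersion p.graph ∧ p.Refines q := by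
  have : IsFinite (q.graph ≫ pullback.fst sX sY) := by
    rw [graph_fst]; exact q.alg.isFinite_toBase hE hf
  have hτ : IsFinite (q.graph.imageι ≫ pullback.fst sX sY) := isFinite_imageι_comp _ _
  have : IsAffineHom q.graph := .of_comp q.graph (pullback.fst sX sY)
  exact exists_refines_of_factors hE q q.graph.toImage q.graph.imageι q.graph.toImage_imageι
    (toImage_app_injective q.graph)

end Presentation

/-! ### Canonical presentations -/

namespace Presentation
variable {S X Y : Scheme.{u}} {sX : X ⟶ S} {sY : Y ⟶ S} {E : X.Modules}
open CommSubalgebra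

section Canonical
variable [IsLocallyNoetherian X] [IsProper sY] (hE : SheafOfModules.IsQuasicoherent.{u} E)
    (hf : ∀ U : X.Opens, IsAffineOpen U → Module.Finite Γ(X, U) Γ(E, U))

include hE hf in
-- Choose a closed-graph refinement `c p` of every presentation `p`. If `t` refines `p` and `q`,
-- then `c t` refines both, so `c p = c t = c q` by `eq_of_refines`. Thus `c` descends to the
-- quotient by the generated equivalence relation, and `c p = p` when `p` already has closed graph.
lemma refines_of_toMorphism_eq {p q : Presentation sX sY E} [IsClosedImmersion p.graph]
    (h : p.toMorphism = q.toMorphism) : p.Refines q := by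
  choose c hc hcr using exists_refines (sX := sX) (sY := sY) hE hf
  have key : ∀ p q, (∃ t : Presentation sX sY E, t.Refines p ∧ t.Refines q) → c p = c q := by
    rintro p q ⟨t, hp, hq⟩
    have := hc p
    have := hc q
    have := hc t
    exact (eq_of_refines (hcr p) ((hcr t).trans hp)).trans
      (eq_of_refines ((hcr t).trans hq) (hcr q))
  have h1 : c p = c q := congrArg (Quot.lift c key) h
  have := hc p
  rw [eq_of_refines p.refines_refl (hcr p), h1]
  exact hcr q

include hE hf in
lemma isCanonical_of_isClosedImmersion (p : Presentation sX sY E) [IsClosedImmersion p.graph] :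
    p.IsCanonical p.toMorphism :=
  ⟨rfl, fun _ hq => refines_of_toMorphism_eq hE hf hq.symm⟩

omit [IsLocallyNoetherian X] [IsProper sY] in
lemma IsCanonical.eq {p q : Presentation sX sY E} {φ : AzumayaMorphism sX sY E}
    (hp : p.IsCanonical φ) (hq : q.IsCanonical φ) : p = q :=
  (hp.refines q hq.toMorphism_eq).antisymm (hq.refines p hp.toMorphism_eq)

include hE hf in
lemma exists_isCanonical (φ : AzumayaMorphism sX sY E) :
    ∃ p : Presentation sX sY E, IsClosedImmersion p.graph ∧ p.IsCanonical φ := by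
  obtain ⟨q, rfl⟩ := Quot.exists_rep φ
  obtain ⟨p, hp, hpq⟩ := exists_refines hE hf q
  have e : p.toMorphism = q.toMorphism := Quot.sound ⟨p, p.refines_refl, hpq⟩
  refine ⟨p, hp, ?_⟩
  change p.IsCanonical q.toMorphism
  exact e ▸ isCanonical_of_isClosedImmersion hE hf p

include hE hf in
lemma IsCanonical.isClosedImmersion {p : Presentation sX sY E} {φ : AzumayaMorphism sX sY E}
    (hp : p.IsCanonical φ) : IsClosedImmersion p.graph := by
  obtain ⟨q, hq, hqφ⟩ := exists_isCanonical hE hf φ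
  rwa [hp.eq hqφ]

end Canonical

lemma exists_isModuleOver (A : CommSubalgebra E) (hE : SheafOfModules.IsQuasicoherent.{u} E) :
    ∃ (M : A.surrogate.Modules) (θ : (Scheme.Modules.pushforward A.toBase).obj M ≅ E),
      IsModuleOver A M θ := by
  obtain ⟨α, hα, hα'⟩ := A.exists_act_of_ringHom A.eval (fun U V h s => A.res_eval h s)
    (fun U a => A.eval_app U a)
  obtain ⟨M, θ, hM, h⟩ := α.exists_module hE hα
  exact ⟨M, θ, hM, fun U t m => (h U.1 t m).trans (hα' U t _)⟩

lemma IsCanonical.exists_corresponds {p : Presentation sX sY E} {φ : AzumayaMorphism sX sY E}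
    (hp : p.IsCanonical φ) (hE : SheafOfModules.IsQuasicoherent.{u} E) :
    ∃ (F : (pullback sX sY).Modules)
        (θ : (Scheme.Modules.pushforward (pullback.fst sX sY)).obj F ≅ E), Corresponds φ F θ := by
  obtain ⟨M, η, h⟩ := exists_isModuleOver p.alg hE
  exact ⟨_, _, p, hp, M, η, Iso.refl _, h, rfl⟩

end Presentation

/-! ### Finite generation along semilinear maps -/

section Algebra

lemma finite_of_semilinear {R S M N : Type*} [CommRing R] [CommRing S] [AddCommGroup M] [AddCommGroup N]
    [Module R M] [Module S N] [Module.Finite R M] (φ : R →+* S) (f : M →+ N)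
    (hf : Function.Surjective f) (h : ∀ r m, f (r • m) = φ r • f m) : Module.Finite S N := by
  algebraize [φ]
  let : Module R N := Module.compHom N φ
  have : IsScalarTower R S N := .of_algebraMap_smul fun _ _ => rfl
  have : Module.Finite R N :=
    .of_surjective ({ f with map_smul' := h } : M →ₗ[R] N) hf
  exact .of_restrictScalars_finite R S N

lemma finite_of_ringHom_finite {R S M N : Type*} [CommRing R] [CommRing S] [AddCommGroup M]
    [AddCommGroup N] [Module R M] [Module S N] [Module.Finite S N] (φ : R →+* S) (hφ : φ.Finite)
    (f : M ≃+ N) (h : ∀ r m, f (r • m) = φ r • f m) : Module.Finite R M := by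
  algebraize [φ]
  let : Module R N := Module.compHom N φ
  have : IsScalarTower R S N := .of_algebraMap_smul fun _ _ => rfl
  have : Module.Finite R N := .trans S N
  exact .equiv ({ f with map_smul' := h } : M ≃ₗ[R] N).symm

end Algebra

/-! ### Annihilators of coherent sheaves -/

section Annihilator
variable {Z P X : Scheme.{u}} {M : Z.Modules}

lemma resFun_smul_eq_zero (hM : SheafOfModules.IsQuasicoherent.{u} M) {W V : Z.Opens}
    (hW : IsAffineOpen W) (hV : V ≤ W) {t : Γ(Z, W)} (ht : ∀ m : Γ(M, W), t • m = 0) (m : Γ(M, V)) :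
    resFun hV t • m = 0 :=
  family_ext hM M hW (fun V hV => LinearMap.lsmul Γ(Z, V) Γ(M, V) (resFun hV t)) (fun _ _ => 0)
    (fun V V' hV hV' m => by
      refine Eq.trans ?_ (resSec_smul M hV' (resFun hV t) m).symm
      rw [resFun_resFun]; rfl)
    (fun V V' hV hV' m => (resSec_zero M hV').symm)
    (fun m => (congr($(resFun_self t) • m)).trans (ht m)) V hV m

/-- Lift `t` up to a power of `a`; each generator times the lift is killed by some power of `a`.
Finite generation allows one exponent for all generators, which is why annihilators localize. -/
lemma exists_resFun_eq_of_annihilates (hM : SheafOfModules.IsQuasicoherent.{u} M) {W D : Z.Opens}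
    (hW : IsAffineOpen W) (hf : Module.Finite Γ(Z, W) Γ(M, W)) (a : Γ(Z, W)) (hD : D = Z.basicOpen a)
    (hDW : D ≤ W) (t : Γ(Z, D)) (ht : ∀ m : Γ(M, D), t • m = 0) :
    ∃ (n : ℕ) (t' : Γ(Z, W)), resFun hDW t' = resFun hDW (a ^ n) * t ∧ ∀ m : Γ(M, W), t' • m = 0 := by
  obtain ⟨n, t', h⟩ := exists_resFun_eq hW a hD hDW t
  obtain ⟨S, hS⟩ := hf.fg_top
  have h0 (m : Γ(M, W)) : resSec M hDW (t' • m) = 0 := by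
    rw [resSec_smul, h, mul_smul, ht, smul_zero]
  choose k hk using fun m => exists_pow_smul_eq_zero hM hW a hD hDW (t' • m) (h0 m)
  refine ⟨∑ m ∈ S, k m + n, a ^ (∑ m ∈ S, k m) * t', by rw [map_mul, h, pow_add, map_mul, mul_assoc], ?_⟩
  have : LinearMap.lsmul Γ(Z, W) Γ(M, W) (a ^ (∑ m ∈ S, k m) * t') = 0 :=
    LinearMap.ext_on hS fun m hm => by
      change (a ^ (∑ m ∈ S, k m) * t') • m = 0
      rw [← Nat.sub_add_cancel (Finset.single_le_sum (f := k) (fun _ _ => Nat.zero_le _) hm),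
        pow_add, mul_assoc, mul_smul, mul_smul, hk, smul_zero]
  exact fun m => congr($this m)

/-- The annihilators of a coherent module form an ideal sheaf. -/
def annihilatorOfCoherent (hM : IsCoherent M) : Z.IdealSheafData where
  ideal W := Module.annihilator Γ(Z, W.1) Γ(M, W.1)
  map_ideal_basicOpen W f := by
    refine le_antisymm (Ideal.map_le_iff_le_comap.mpr fun t ht => ?_) fun t ht => ?_
    · refine Module.mem_annihilator.mpr fun m => ?_
      exact resFun_smul_eq_zero hM.1 W.2 (Z.basicOpen_le f) (Module.mem_annihilator.mp ht) m
    · obtain ⟨n, t', h, ht'⟩ := exists_resFun_eq_of_annihilates hM.1 W.2 (hM.2 _ W.2) f rfl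
        (Z.basicOpen_le f) t (Module.mem_annihilator.mp ht)
      rw [map_pow] at h
      refine (Ideal.unit_mul_mem_iff_mem _ ((isUnit_resFun f (Z.basicOpen_le f) le_rfl).pow n)).mp ?_
      exact h ▸ Ideal.mem_map_of_mem _ (Module.mem_annihilator.mpr ht')

lemma annihilator_ideal (hM : IsCoherent M) (W : Z.affineOpens) :
    (annihilator M).ideal W = Module.annihilator Γ(Z, W.1) Γ(M, W.1) := by
  have : annihilator M = annihilatorOfCoherent hM :=
    Scheme.IdealSheafData.ofIdeals_ideal (annihilatorOfCoherent hM)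
  rw [this]; rfl

/-- Faithfulness of a coherent module can be checked over an affine cover. -/
lemma eq_zero_of_annihilates (hM : SheafOfModules.IsQuasicoherent.{u} M)
    (h : ∀ z : Z, ∃ W : Z.Opens, IsAffineOpen W ∧ z ∈ W ∧ Module.Finite Γ(Z, W) Γ(M, W) ∧
      ∀ t : Γ(Z, W), (∀ m : Γ(M, W), t • m = 0) → t = 0) {V : Z.Opens} (hV : IsAffineOpen V)
    {t : Γ(Z, V)} (ht : ∀ m : Γ(M, V), t • m = 0) : t = 0 := by
  refine fun_ext _ _ fun z hz => ?_
  obtain ⟨W, hW, hzW, hf, h⟩ := h z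
  obtain ⟨a, haV, hza⟩ := hW.exists_basicOpen_le ⟨z, hz⟩ hzW
  refine ⟨_, haV, hza, ?_⟩
  obtain ⟨n, t', h', ht'⟩ := exists_resFun_eq_of_annihilates hM hW hf a rfl (Z.basicOpen_le a)
    (resFun haV t) (resFun_smul_eq_zero hM hV haV ht)
  rw [h t' ht', map_zero, map_pow] at h'
  rw [map_zero]
  exact ((isUnit_resFun a (Z.basicOpen_le a) le_rfl).pow n).mul_right_eq_zero.mp h'.symm

lemma IsCoherent.of_iso {N : Z.Modules} (e : M ≅ N) (hM : IsCoherent M) : IsCoherent N :=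
  ⟨isQuasicoherent_of_iso e hM.1, fun W hW =>
    have := hM.2 W hW
    Module.Finite.of_surjective (appLin e.hom W)
      (ConcreteCategory.bijective_of_isIso (e.hom.app W)).2⟩

/-- The annihilator of the push-forward of a coherent faithful module along a closed immersion. -/
lemma ker_eq_annihilator (i : Z ⟶ P) [IsClosedImmersion i] {F : P.Modules} (hF : IsCoherent F)
    (e : F ≅ (Scheme.Modules.pushforward i).obj M)
    (h : ∀ (V : Z.Opens), IsAffineOpen V → ∀ t : Γ(Z, V), (∀ m : Γ(M, V), t • m = 0) → t = 0) :
    i.ker = annihilator F := by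
  ext W : 2
  rw [annihilator_ideal hF, Scheme.Hom.ker_apply]
  ext t
  rw [RingHom.mem_ker, Module.mem_annihilator]
  have hb := ConcreteCategory.bijective_of_isIso (e.hom.app W.1)
  have hs (m) : e.hom.app W.1 (t • m) = (i.app W.1 t) • (show Γ(M, i ⁻¹ᵁ W.1) from e.hom.app W.1 m) :=
    e.hom.app_smul t m
  constructor
  · intro h0 m
    refine hb.1 ((hs m).trans ?_)
    rw [map_zero]
    exact (congrArg (· • (show Γ(M, i ⁻¹ᵁ W.1) from e.hom.app W.1 m)) h0).trans (zero_smul _ _)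
  · intro h0
    refine h _ (W.2.preimage i) _ fun m => ?_
    obtain ⟨m, rfl⟩ := hb.2 m
    exact (hs m).symm.trans ((congrArg (e.hom.app W.1) (h0 m)).trans (map_zero (e.hom.app W.1).hom))

lemma isCoherent_pushforward (i : Z ⟶ P) [IsClosedImmersion i] (hM : IsCoherent M) :
    IsCoherent ((Scheme.Modules.pushforward i).obj M) := by
  refine ⟨isQuasicoherent_pushforward i M hM.1, fun W hW => ?_⟩
  have hf := hM.2 _ (hW.preimage i)
  exact finite_of_ringHom_finite (i.app W).hom (.of_surjective _ (i.app_surjective W hW))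
    (AddEquiv.refl Γ(M, i ⁻¹ᵁ W)) fun r m => rfl

end Annihilator

/-! ### Faithfulness and coherence of the module on the surrogate -/

section ModuleOver
variable {X : Scheme.{u}} {E : X.Modules} {A : CommSubalgebra E} {M : A.surrogate.Modules}
  {θ : (Scheme.Modules.pushforward A.toBase).obj M ≅ E}

/-- A function acts on `M` as the endomorphism of `E` that it is, and over an affine open it is
determined by the action on sections. -/
lemma IsModuleOver.eq_zero (h : IsModuleOver A M θ) (hE : SheafOfModules.IsQuasicoherent.{u} E)
    {U : X.Opens} (hU : IsAffineOpen U) (t : Γ(A.surrogate, A.toBase ⁻¹ᵁ U))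
    (ht : ∀ m : Γ(M, A.toBase ⁻¹ᵁ U), t • m = 0) : t = 0 := by
  refine A.eval_ext (U := ⟨U, hU⟩) hE (LinearMap.ext fun m => ?_)
  obtain ⟨m, rfl⟩ := (ConcreteCategory.bijective_of_isIso (θ.hom.app U)).2 m
  refine (h.smul ⟨U, hU⟩ t m).symm.trans ?_
  refine ((congrArg (θ.hom.app U) (ht m)).trans (map_zero (θ.hom.app U).hom)).trans ?_
  exact congrArg (fun y => EndOn.toEnd E U y.1 (θ.hom.app U m)) (map_zero (A.eval ⟨U, hU⟩)).symm

lemma finite_of_pushforward_iso {Z : Scheme.{u}} {π : Z ⟶ X} {M : Z.Modules}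
    (θ : (Scheme.Modules.pushforward π).obj M ≅ E) {U : X.Opens}
    (hf : Module.Finite Γ(X, U) Γ(E, U)) : Module.Finite Γ(Z, π ⁻¹ᵁ U) Γ(M, π ⁻¹ᵁ U) :=
  finite_of_semilinear (π.app U).hom (θ.inv.app U).hom
    (ConcreteCategory.bijective_of_isIso (θ.inv.app U)).2 fun r m => θ.inv.app_smul r m

/-- The module over the surrogate attached to a locally free sheaf is coherent. -/
lemma IsModuleOver.isCoherent (h : IsModuleOver A M θ)
    (hf : ∀ U : X.Opens, IsAffineOpen U → Module.Finite Γ(X, U) Γ(E, U)) : IsCoherent M :=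
  ⟨h.quasicoherent, fun _ hW => finite_of_affine_cover h.quasicoherent (fun z => by
    obtain ⟨U, hU, hzU, -⟩ := exists_affine_mem (show A.toBase z ∈ (⊤ : X.Opens) from trivial)
    exact ⟨_, hU.preimage A.toBase, hzU, finite_of_pushforward_iso θ (hf U hU)⟩) hW⟩

lemma IsModuleOver.eq_zero_of_annihilates (h : IsModuleOver A M θ)
    (hE : SheafOfModules.IsQuasicoherent.{u} E)
    (hf : ∀ U : X.Opens, IsAffineOpen U → Module.Finite Γ(X, U) Γ(E, U)) {V : A.surrogate.Opens}
    (hV : IsAffineOpen V) (t : Γ(A.surrogate, V)) (ht : ∀ m : Γ(M, V), t • m = 0) : t = 0 :=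
  AzumayaBrane.eq_zero_of_annihilates h.quasicoherent (fun z => by
    obtain ⟨U, hU, hzU, -⟩ := exists_affine_mem (show A.toBase z ∈ (⊤ : X.Opens) from trivial)
    exact ⟨_, hU.preimage A.toBase, hzU, finite_of_pushforward_iso θ (hf U hU), h.eq_zero hE hU⟩) hV ht

end ModuleOver

/-! ### Dimension of a finite-dimensional module as a sum over primes -/

section TorsionAt
variable {R B K D : Type*} [CommRing R] [CommRing B] [Algebra R B] [Field K] [Algebra R K]
  [AddCommGroup D] [Module K D]

/-- The elements of a `K`-vector space `D` with an action of `B` that vanish in the localization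
at `q`. -/
def torsionAt (β : B →+* Module.End K D) (q : PrimeSpectrum B) : Submodule K D where
  carrier := {d | ∃ s ∉ q.asIdeal, β s d = 0}
  zero_mem' := ⟨1, q.2.one_notMem, map_zero _⟩
  add_mem' := by
    rintro a b ⟨s, hs, ha⟩ ⟨t, ht, hb⟩
    refine ⟨s * t, q.2.mul_notMem hs ht, ?_⟩
    have h : β (s * t) a = 0 := by rw [mul_comm, map_mul, Module.End.mul_apply, ha, map_zero]
    rw [map_add, h, map_mul, Module.End.mul_apply, hb, map_zero, add_zero]
  smul_mem' := by
    rintro c a ⟨s, hs, ha⟩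
    exact ⟨s, hs, by rw [map_smul, ha, smul_zero]⟩

/-- The restriction of an action to an invariant subspace. -/
def restrictAction (β : B →+* Module.End K D) (V : Submodule K D) (hV : ∀ b, ∀ v ∈ V, β b v ∈ V) :
    B →+* Module.End K V where
  toFun b := (β b).restrict (hV b)
  map_one' := by ext; simp
  map_mul' a b := by ext; simp
  map_zero' := by ext; simp
  map_add' a b := by ext; simp

lemma torsionAt_restrictAction (β : B →+* Module.End K D) (V : Submodule K D)
    (hV : ∀ b, ∀ v ∈ V, β b v ∈ V) (q : PrimeSpectrum B) :
    torsionAt (restrictAction β V hV) q = (torsionAt β q).comap V.subtype := by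
  ext v
  refine exists_congr fun s => and_congr_right fun _ => ?_
  exact Subtype.ext_iff

/-- If `s` kills `v + w` with `v ∈ V` and `w ∈ W`, then `s v = -s w` lies in `V ⊓ W = 0`. So the
torsion at `q` splits along the decomposition, and the rest is a dimension count. -/
lemma finrank_quotient_torsionAt [FiniteDimensional K D] (β : B →+* Module.End K D)
    {V W : Submodule K D} (hV : ∀ b, ∀ v ∈ V, β b v ∈ V) (hW : ∀ b, ∀ v ∈ W, β b v ∈ W)
    (h : IsCompl V W) (q : PrimeSpectrum B) :
    Module.finrank K (V ⧸ torsionAt (restrictAction β V hV) q) +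
      Module.finrank K (W ⧸ torsionAt (restrictAction β W hW) q) =
        Module.finrank K (D ⧸ torsionAt β q) := by
  have e : (V ⊓ torsionAt β q) ⊔ (W ⊓ torsionAt β q) = torsionAt β q := by
    refine le_antisymm (sup_le inf_le_right inf_le_right) ?_
    rintro d ⟨s, hs, hd⟩
    obtain ⟨v, hv, w, hw, rfl⟩ := Submodule.mem_sup.mp (h.sup_eq_top.ge (Submodule.mem_top : d ∈ ⊤))
    rw [map_add] at hd
    have hv0 : β s v = 0 := by
      refine (Submodule.disjoint_def.mp h.disjoint) _ (hV s v hv) ?_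
      rw [eq_neg_of_add_eq_zero_left hd]
      exact W.neg_mem (hW s w hw)
    rw [hv0, zero_add] at hd
    exact Submodule.add_mem_sup ⟨hv, s, hs, hv0⟩ ⟨hw, s, hs, hd⟩
  have h1 := Submodule.finrank_sup_add_finrank_inf_eq (V ⊓ torsionAt β q) (W ⊓ torsionAt β q)
  have h2 : (V ⊓ torsionAt β q) ⊓ (W ⊓ torsionAt β q) = ⊥ :=
    eq_bot_iff.mpr (h.inf_eq_bot ▸ inf_le_inf inf_le_left inf_le_left)
  rw [e, h2, finrank_bot, add_zero] at h1
  have h3 := Submodule.finrank_add_eq_of_isCompl h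
  have a (V : Submodule K D) (hV : ∀ b, ∀ v ∈ V, β b v ∈ V) :
      Module.finrank K (V ⧸ torsionAt (restrictAction β V hV) q) +
        Module.finrank K (V ⊓ torsionAt β q : Submodule K D) = Module.finrank K V := by
    rw [← Submodule.map_comap_subtype, Submodule.finrank_map_subtype_eq, ← torsionAt_restrictAction β V hV]
    exact Submodule.finrank_quotient_add_finrank _
  have := a V hV
  have := a W hW
  have := Submodule.finrank_quotient_add_finrank (torsionAt β q)
  omega

/-- Incomparability of the primes over a given prime in an integral extension. -/
lemma eq_of_le_of_comap_eq [Algebra.IsIntegral R B] {q q' : PrimeSpectrum B}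
    (h : q.asIdeal ≤ q'.asIdeal)
    (e : q.asIdeal.comap (algebraMap R B) = q'.asIdeal.comap (algebraMap R B)) : q = q' := by
  by_contra hne
  have hlt : q.asIdeal < q'.asIdeal := lt_of_le_of_ne h fun h => hne (PrimeSpectrum.ext h)
  exact (Ideal.comap_lt_comap_of_integral_mem_sdiff hlt.le
    (Set.exists_of_ssubset hlt).choose_spec (Algebra.IsIntegral.isIntegral _)).ne e

/-- The base case, where the module sits at one prime. The elements acting nilpotently form a prime
`q₀`, because all others act invertibly. Outside `q₀` nothing kills a nonzero vector. Another prime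
`q` over the kernel cannot contain `q₀` by incomparability, so some element outside `q` is nilpotent
on `D` and everything is torsion at `q`. -/
lemma exists_finset_of_forall [Algebra.IsIntegral R B] [Nontrivial D] (β : B →+* Module.End K D)
    (hβ : ∀ a : R, β (algebraMap R B a) = algebraMap K _ (algebraMap R K a))
    (h : ∀ b, IsNilpotent (β b) ∨ IsUnit (β b)) :
    ∃ q₀ : PrimeSpectrum B, q₀.asIdeal.comap (algebraMap R B) = RingHom.ker (algebraMap R K) ∧
      (∀ q : PrimeSpectrum B, q.asIdeal.comap (algebraMap R B) = RingHom.ker (algebraMap R K) →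
        q ≠ q₀ → torsionAt β q = ⊤) ∧ torsionAt β q₀ = ⊥ := by
  have hc (a b : B) : Commute (β a) (β b) := (Commute.all a b).map β
  have hnu {b : B} (hb : IsNilpotent (β b)) : ¬ IsUnit (β b) := hb.not_isUnit
  let I : Ideal B :=
    { carrier := {b | IsNilpotent (β b)}
      zero_mem' := by simp
      add_mem' := fun {a b} ha hb => by
        change IsNilpotent _
        rw [map_add]; exact (hc a b).isNilpotent_add ha hb
      smul_mem' := fun c b hb => by
        change IsNilpotent (β (c * b))
        rw [map_mul]; exact (hc c b).isNilpotent_mul_left hb }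
  have hI (b) : b ∈ I ↔ IsNilpotent (β b) := Iff.rfl
  have hI' (b) (hb : b ∉ I) : IsUnit (β b) := (h b).resolve_left hb
  have hprime : I.IsPrime := by
    refine ⟨fun e => ?_, fun {a b} hab => ?_⟩
    · have : IsNilpotent (β 1) := (hI 1).mp (e ▸ trivial)
      exact hnu this (by rw [map_one]; exact isUnit_one)
    · by_contra! hn
      refine hnu ((hI _).mp hab) ?_
      rw [map_mul]
      exact (hI' a hn.1).mul (hI' b hn.2)
  have hover : I.comap (algebraMap R B) = RingHom.ker (algebraMap R K) := by
    ext a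
    rw [Ideal.mem_comap, hI, hβ, RingHom.mem_ker,
      IsNilpotent.map_iff (FaithfulSMul.algebraMap_injective K (Module.End K D)), isNilpotent_iff_eq_zero]
  refine ⟨⟨I, hprime⟩, hover, fun q hq hne => ?_, ?_⟩
  · obtain ⟨b, hb, hbq⟩ : ∃ b ∈ I, b ∉ q.asIdeal := by
      by_contra! hle
      exact hne (eq_of_le_of_comap_eq (R := R) (q := ⟨I, hprime⟩) hle (hover.trans hq.symm)).symm
    obtain ⟨n, hn⟩ := hb
    refine top_le_iff.mp fun d _ => ⟨b ^ n, fun hm => hbq (q.2.mem_of_pow_mem n hm), ?_⟩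
    rw [map_pow, hn, LinearMap.zero_apply]
  · refine eq_bot_iff.mpr ?_
    rintro d ⟨s, hs, hd⟩
    exact (Module.End.isUnit_iff _).mp (hI' s hs) |>.1 (hd.trans (map_zero _).symm)

/-- A finite-dimensional vector space with an action of a ring integral over `R`, on which `R` acts
through scalars, is the sum of its localizations at the primes over the kernel of `R ⟶ K`. -/
theorem exists_finset_sum_finrank [Algebra.IsIntegral R B] (n : ℕ) :
    ∀ (D : Type u) [AddCommGroup D] [Module K D] [FiniteDimensional K D] (β : B →+* Module.End K D),
    (∀ a : R, β (algebraMap R B a) = algebraMap K _ (algebraMap R K a)) → Module.finrank K D = n →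
    ∃ Q : Finset (PrimeSpectrum B),
      (∀ q ∈ Q, q.asIdeal.comap (algebraMap R B) = RingHom.ker (algebraMap R K)) ∧
      (∀ q : PrimeSpectrum B, q.asIdeal.comap (algebraMap R B) = RingHom.ker (algebraMap R K) →
        q ∉ Q → torsionAt β q = ⊤) ∧
      ∑ q ∈ Q, Module.finrank K (D ⧸ torsionAt β q) = n := by
  induction n using Nat.strong_induction_on with
  | _ n ih =>
  intro D _ _ _ β hβ hn
  classical
  cases subsingleton_or_nontrivial D
  · refine ⟨∅, by simp, fun q _ _ => Subsingleton.elim _ _, ?_⟩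
    rw [← hn, Module.finrank_zero_of_subsingleton]; rfl
  by_cases h : ∀ b, IsNilpotent (β b) ∨ IsUnit (β b)
  · obtain ⟨q, hq, hq', hbot⟩ := exists_finset_of_forall β hβ h
    refine ⟨{q}, by simpa using hq, fun q' h h' => hq' q' h (by simpa using h'), ?_⟩
    rw [Finset.sum_singleton, hbot, ← hn]
    exact (Submodule.quotEquivOfEqBot _ rfl).finrank_eq
  push Not at h
  obtain ⟨b, hb, hb'⟩ := h
  -- Fitting decomposition: the kernel and range of a power of `b` are complementary, and invariant
  -- since `B` is commutative. Both are nonzero, as `b` acts neither nilpotently nor invertibly, so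
  -- induction applies to each. The exponent must be positive for invertibility of `b ^ m` to give
  -- that of `b`.
  obtain ⟨m, hm0, hm⟩ := ((Filter.eventually_gt_atTop 0).and
    (β b).eventually_isCompl_ker_pow_range_pow).exists
  have hc (a b : B) (d : D) : β a (β b d) = β b (β a d) := by
    rw [← Module.End.mul_apply, ← Module.End.mul_apply, ← map_mul, ← map_mul, mul_comm]
  rw [← map_pow] at hm
  set c := b ^ m with hcdef
  have hV (a : B) (v : D) (hv : v ∈ LinearMap.ker (β c)) : β a v ∈ LinearMap.ker (β c) := by
    rw [LinearMap.mem_ker] at hv ⊢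
    rw [hc, hv, map_zero]
  have hW (a : B) (v : D) (hv : v ∈ LinearMap.range (β c)) : β a v ∈ LinearMap.range (β c) := by
    obtain ⟨w, rfl⟩ := hv
    exact ⟨β a w, hc c a w⟩
  have hV0 : 0 < Module.finrank K (LinearMap.ker (β c)) := by
    refine Module.finrank_pos_iff.mpr (Submodule.nontrivial_iff_ne_bot.mpr fun e => hb' ?_)
    have : IsUnit (β c) := (LinearMap.isUnit_iff_ker_eq_bot _).mpr e
    rw [hcdef, map_pow] at this
    exact (isUnit_pow_iff hm0.ne').mp this
  have hW0 : 0 < Module.finrank K (LinearMap.range (β c)) := by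
    refine Module.finrank_pos_iff.mpr (Submodule.nontrivial_iff_ne_bot.mpr fun e => hb ⟨m, ?_⟩)
    rw [← map_pow]
    exact LinearMap.range_eq_bot.mp e
  have hd := Submodule.finrank_add_eq_of_isCompl hm
  have hr (V : Submodule K D) (hV) (a : R) : restrictAction β V hV (algebraMap R B a) =
      algebraMap K _ (algebraMap R K a) := by
    ext v
    exact congr($(hβ a) v.1)
  obtain ⟨Q₁, h₁, h₁', h₁''⟩ := ih _ (by omega) _ (restrictAction β _ hV) (hr _ hV) rfl
  obtain ⟨Q₂, h₂, h₂', h₂''⟩ := ih _ (by omega) _ (restrictAction β _ hW) (hr _ hW) rfl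
  have hu (q) (hq : q ∈ Q₁ ∪ Q₂) :
      q.asIdeal.comap (algebraMap R B) = RingHom.ker (algebraMap R K) :=
    (Finset.mem_union.mp hq).elim (h₁ q) (h₂ q)
  have hz {V : Type u} [AddCommGroup V] [Module K V] {U : Submodule K V} (h : U = ⊤) :
      Module.finrank K (V ⧸ U) = 0 := by
    subst h
    exact Module.finrank_zero_of_subsingleton
  refine ⟨Q₁ ∪ Q₂, hu, fun q hq hn' => ?_, ?_⟩
  · rw [Finset.mem_union, not_or] at hn'
    have e := finrank_quotient_torsionAt β hV hW hm q
    rw [hz (h₁' q hq hn'.1), hz (h₂' q hq hn'.2)] at e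
    have := Module.finrank_zero_iff.mp e.symm
    exact Submodule.Quotient.subsingleton_iff.mp this
  · rw [Finset.sum_congr rfl fun q _ => (finrank_quotient_torsionAt β hV hW hm q).symm,
      Finset.sum_add_distrib, ← hn, ← hd]
    congr 1
    · rw [← h₁'']
      exact (Finset.sum_subset Finset.subset_union_left fun q hq hq' => hz (h₁' q (hu q hq) hq')).symm
    · rw [← h₂'']
      exact (Finset.sum_subset Finset.subset_union_right fun q hq hq' => hz (h₂' q (hu q hq) hq')).symm

end TorsionAt

/-! ### Localization after base change to a field -/

section Localized
variable {R B K : Type*} [CommRing R] [CommRing B] [Algebra R B] [Field K] [Algebra R K]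
  {N L : Type*} [AddCommGroup N] [Module R N] [Module B N] [IsScalarTower R B N]
  [AddCommGroup L] [Module R L] [Module B L] [IsScalarTower R B L]

variable (R B K N) in
/-- The action of `B` on the base change to `K` of a `B`-module. -/
def baseChangeAction : B →+* Module.End K (K ⊗[R] N) where
  toFun b := (Module.toModuleEnd R (S := B) N b).baseChange K
  map_one' := by ext; simp
  map_mul' a b := by ext; simp [mul_smul]
  map_zero' := by ext; simp
  map_add' a b := by ext; simp [add_smul, tmul_add]

lemma baseChangeAction_tmul (b : B) (k : K) (n : N) :
    baseChangeAction R B K N b (k ⊗ₜ n) = k ⊗ₜ (b • n) := rfl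

lemma baseChangeAction_algebraMap (a : R) :
    baseChangeAction R B K N (algebraMap R B a) = algebraMap K _ (algebraMap R K a) := by
  ext n
  simp [baseChangeAction_tmul, Algebra.algebraMap_eq_smul_one, smul_tmul']

lemma baseChangeAction_comm (b : B) (x : N ⊗[R] K) :
    TensorProduct.comm R N K (b • x) = baseChangeAction R B K N b (TensorProduct.comm R N K x) := by
  induction x with
  | zero => simp
  | add x y hx hy => rw [smul_add, map_add, hx, hy, map_add, map_add]
  | tmul n k => rfl

lemma comm_rTensor (l : N →ₗ[B] L) (x : N ⊗[R] K) :
    TensorProduct.comm R L K (AlgebraTensorModule.rTensor R K l x) =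
      (l.restrictScalars R).baseChange K (TensorProduct.comm R N K x) := by
  induction x with
  | zero => simp
  | add x y hx hy => rw [map_add, map_add, hx, hy, map_add, map_add]
  | tmul n k => rfl

/-- A localization of a finite-dimensional space is a quotient. -/
lemma length_baseChange_localized (l : N →ₗ[B] L) (q : PrimeSpectrum B)
    [IsLocalizedModule q.asIdeal.primeCompl l] [FiniteDimensional K (K ⊗[R] N)] :
    Module.length K (K ⊗[R] L) =
      Module.finrank K ((K ⊗[R] N) ⧸ torsionAt (baseChangeAction R B K N) q) := by
  let g := (l.restrictScalars R).baseChange K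
  -- The localization is visible on `N ⊗ K`, where `B` acts on the left factor; `TensorProduct.comm`
  -- carries it to `K ⊗ N`, where `K` acts on the left factor.
  let G := AlgebraTensorModule.rTensor R K l
  have hG : IsLocalizedModule q.asIdeal.primeCompl G := inferInstance
  have hgG (x) : TensorProduct.comm R L K (G x) = g (TensorProduct.comm R N K x) := comm_rTensor l x
  have hker : LinearMap.ker g = torsionAt (baseChangeAction R B K N) q := by
    ext d
    obtain ⟨x, rfl⟩ := (TensorProduct.comm R N K).surjective d
    rw [LinearMap.mem_ker, ← hgG, LinearEquiv.map_eq_zero_iff, IsLocalizedModule.eq_zero_iff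
      q.asIdeal.primeCompl G]
    refine ⟨fun ⟨⟨s, hs⟩, h⟩ => ⟨s, hs, ?_⟩, fun ⟨s, hs, h⟩ => ⟨⟨s, hs⟩, ?_⟩⟩
    · rw [← baseChangeAction_comm]
      exact (congrArg _ h).trans (map_zero _)
    · rw [← baseChangeAction_comm] at h
      exact (LinearEquiv.map_eq_zero_iff _).mp h
  have hginv (s : B) (d) : baseChangeAction R B K L s (g d) = g (baseChangeAction R B K N s d) := by
    obtain ⟨x, rfl⟩ := (TensorProduct.comm R N K).surjective d
    rw [← hgG, ← baseChangeAction_comm, ← baseChangeAction_comm, ← hgG]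
    exact congrArg _ (LinearMap.map_smul G s x).symm
  have hinj (s : B) (hs : s ∈ q.asIdeal.primeCompl) : Function.Injective (baseChangeAction R B K L s) := by
    refine (injective_iff_map_eq_zero _).mpr fun t ht => ?_
    obtain ⟨x, rfl⟩ := (TensorProduct.comm R L K).surjective t
    rw [← baseChangeAction_comm, LinearEquiv.map_eq_zero_iff] at ht
    rw [IsLocalizedModule.smul_injective G ⟨s, hs⟩ (ht.trans (smul_zero _).symm), map_zero]
  -- A denominator `s` acts injectively on the range of `g`, which is finite-dimensional, so it acts
  -- bijectively there. Hence fractions already lie in the range.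
  have hsurj : Function.Surjective g := fun t => by
    obtain ⟨x, rfl⟩ := (TensorProduct.comm R L K).surjective t
    obtain ⟨⟨d, s⟩, hd⟩ := IsLocalizedModule.surj q.asIdeal.primeCompl G x
    have hr : ∀ v ∈ LinearMap.range g, baseChangeAction R B K L s.1 v ∈ LinearMap.range g := by
      rintro _ ⟨d, rfl⟩
      exact ⟨_, (hginv s.1 d).symm⟩
    let c : LinearMap.range g →ₗ[K] LinearMap.range g := (baseChangeAction R B K L s.1).restrict hr
    have hs' : Function.Injective c :=
      fun v w h => Subtype.ext (hinj s.1 s.2 (Subtype.ext_iff.mp h))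
    have hs := @LinearMap.surjective_of_injective K (LinearMap.range g) _ _ _ inferInstance c hs'
    obtain ⟨⟨_, d', rfl⟩, h⟩ := hs ⟨g (TensorProduct.comm R N K d), ⟨_, rfl⟩⟩
    refine ⟨d', hinj s.1 s.2 ((Subtype.ext_iff.mp h).trans ?_)⟩
    change g (TensorProduct.comm R N K d) = _
    rw [← hgG, ← baseChangeAction_comm]
    exact congrArg _ hd.symm
  rw [← hker, ← (g.quotKerEquivOfSurjective hsurj).length_eq, Module.length_eq_finrank]

lemma iSup_sum_eq_sum {ι : Type*} (f : ι → ℕ∞) (Q : Finset ι) (h : ∀ i ∉ Q, f i = 0) :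
    ⨆ s : Finset ι, ∑ i ∈ s, f i = ∑ i ∈ Q, f i := by
  classical
  refine le_antisymm (iSup_le fun s => ?_) (le_iSup (fun s : Finset ι => ∑ i ∈ s, f i) Q)
  rw [Finset.sum_subset (Finset.subset_union_right : Q ⊆ s ∪ Q) fun i _ hi => h i hi]
  exact Finset.sum_le_sum_of_subset Finset.subset_union_left

/-- The lengths of the localizations at the primes over the kernel of `R ⟶ K` add up to the
dimension. -/
lemma iSup_sum_length {N : Type u} [AddCommGroup N] [Module R N] [Module B N] [IsScalarTower R B N]
    {K : Type u} [Field K] [Algebra R K]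
    [Algebra.IsIntegral R B] [FiniteDimensional K (K ⊗[R] N)] {ι : Type*} (q : ι → PrimeSpectrum B)
    (hq : Function.Injective q) (hr : ∀ p : PrimeSpectrum B,
      (∃ i, q i = p) ↔ p.asIdeal.comap (algebraMap R B) = RingHom.ker (algebraMap R K))
    (f : ι → ℕ∞)
    (hf : ∀ i, f i = Module.finrank K ((K ⊗[R] N) ⧸ torsionAt (baseChangeAction R B K N) (q i))) :
    ⨆ s : Finset ι, ∑ i ∈ s, f i = Module.finrank K (K ⊗[R] N) := by
  classical
  obtain ⟨Q, hQ, hQ', hs⟩ := exists_finset_sum_finrank (R := R) _ (K ⊗[R] N)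
    (baseChangeAction R B K N) baseChangeAction_algebraMap rfl
  rw [iSup_sum_eq_sum f (Q.preimage q hq.injOn), ← hs, Nat.cast_sum,
    ← Finset.sum_preimage q Q hq.injOn
      (fun p => (Module.finrank K ((K ⊗[R] N) ⧸ torsionAt (baseChangeAction R B K N) p) : ℕ∞))
      fun p hp hp' => absurd ((hr p).mpr (hQ p hp)) hp']
  · exact Finset.sum_congr rfl fun i _ => hf i
  · intro i hi
    rw [hf, hQ' (q i) ((hr _).mp ⟨i, rfl⟩) (by simpa using hi)]
    have : Module.finrank K ((K ⊗[R] N) ⧸ (⊤ : Submodule K (K ⊗[R] N))) = 0 :=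
      Module.finrank_zero_of_subsingleton
    rw [this]; rfl

lemma lTensor_smul_left (P : Type*) [AddCommGroup P] [Module R P] [Module B P]
    [IsScalarTower R B P] {I J : Type*} [AddCommGroup I] [Module R I] [AddCommGroup J] [Module R J]
    (j : I →ₗ[R] J) (s : B) (x : P ⊗[R] I) : j.lTensor P (s • x) = s • j.lTensor P x := by
  induction x with
  | zero => simp
  | add x y hx hy => rw [smul_add, map_add, hx, hy, map_add, smul_add]
  | tmul n k => rfl

/-- A localization over `B` of a module flat over `R` is flat over `R`. -/
lemma flat_of_isLocalizedModule (S : Submonoid B) (l : N →ₗ[B] L) [IsLocalizedModule S l]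
    [Module.Flat R N] : Module.Flat R L := by
  refine Module.Flat.iff_lTensor_injective'.mpr fun I => (injective_iff_map_eq_zero _).mpr
    fun t ht => ?_
  let G₁ := AlgebraTensorModule.rTensor R I l
  let G₂ := AlgebraTensorModule.rTensor R R l
  have hcomp (x) : I.subtype.lTensor L (G₁ x) = G₂ (I.subtype.lTensor N x) := by
    induction x with
    | zero => simp
    | add x y hx hy => rw [map_add, map_add, hx, hy, map_add, map_add]
    | tmul n k => rfl
  obtain ⟨⟨x, s⟩, hx⟩ := IsLocalizedModule.surj S G₁ t
  have h0 : G₂ (I.subtype.lTensor N x) = 0 := by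
    rw [← hcomp, ← hx]
    exact (lTensor_smul_left L _ s.1 t).trans (by rw [ht, smul_zero])
  obtain ⟨s', hs'⟩ := (IsLocalizedModule.eq_zero_iff S G₂).mp h0
  have h1 : s'.1 • x = 0 := by
    refine (injective_iff_map_eq_zero _).mp (Module.Flat.iff_lTensor_injective'.mp ‹_› I) _ ?_
    exact (lTensor_smul_left N _ s'.1 x).trans hs'
  refine IsLocalizedModule.smul_injective G₁ (s' * s) ?_
  change (s' * s) • t = (s' * s) • 0
  rw [smul_zero, mul_smul, hx]
  exact (LinearMap.map_smul G₁ s'.1 x).symm.trans (by rw [h1, map_zero])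

end Localized

/-! ### Stalks of modules through germs -/

section Germs
variable {Z X : Scheme.{u}} (f : Z ⟶ X) (F : Z.Modules)

/-- The germ at `z` of a section of `F`. -/
def germOver (z : Z) {W : Z.Opens} (hz : z ∈ W) : Γ(F, W) →+ StalkOver f F z :=
  (TopCat.Presheaf.germ F.presheaf W z hz).hom

lemma germOver_resSec (z : Z) {V W : Z.Opens} (hz : z ∈ W) (h : W ≤ V) (m : Γ(F, V)) :
    germOver f F z hz (resSec F h m) = germOver f F z (h hz) m :=
  TopCat.Presheaf.germ_res_apply F.presheaf (homOfLE h) z hz m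

lemma exists_germOver (z : Z) {U : Z.Opens} (hz : z ∈ U) (v : StalkOver f F z) :
    ∃ (W : Z.Opens) (_ : W ≤ U) (hzW : z ∈ W) (m : Γ(F, W)), germOver f F z hzW m = v := by
  obtain ⟨W, hW, m, hm⟩ := TopCat.Presheaf.exists_germ_eq F.presheaf v
  exact ⟨W ⊓ U, inf_le_right, ⟨hW, hz⟩, resSec F inf_le_left m,
    (germOver_resSec f F z _ _ m).trans hm⟩

lemma exists_resSec_eq_zero (z : Z) {V : Z.Opens} (hz : z ∈ V) (m : Γ(F, V))
    (h : germOver f F z hz m = 0) : ∃ (W : Z.Opens) (hW : W ≤ V), z ∈ W ∧ resSec F hW m = 0 := by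
  obtain ⟨W, hW, i, j, e⟩ := TopCat.Presheaf.germ_eq F.presheaf z hz hz m 0
    (h.trans (map_zero (germOver f F z hz)).symm)
  exact ⟨W, i.le, hW, e.trans (resSec_zero F j.le)⟩

lemma germOver_smul (z : Z) {W : Z.Opens} (hz : z ∈ W) (a : Γ(Z, W)) (m : Γ(F, W)) :
    letI := stalkModule f F z
    germOver f F z hz (a • m) = Z.presheaf.germ W z hz a • germOver f F z hz m :=
  PresheafOfModules.germ_smul (R := Z.presheaf) F.val z W hz a m

lemma germ_appLE (z : Z) {U : X.Opens} {W : Z.Opens} (h : W ≤ f ⁻¹ᵁ U) (hz : z ∈ W) (a : Γ(X, U)) :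
    Z.presheaf.germ W z hz (f.appLE U W h a) = f.stalkMap z (X.presheaf.germ U (f z) (h hz) a) := by
  refine Eq.trans ?_ (f.germ_stalkMap_apply U z (h hz) a).symm
  exact TopCat.Presheaf.germ_res_apply Z.presheaf (homOfLE h) z hz (f.app U a)

lemma germ_smul_germOver (z : Z) {U : X.Opens} {W : Z.Opens} (h : W ≤ f ⁻¹ᵁ U) (hz : z ∈ W)
    (a : Γ(X, U)) (m : Γ(F, W)) : X.presheaf.germ U (f z) (h hz) a • germOver f F z hz m =
      germOver f F z hz (f.appLE U W h a • m) := by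
  let := stalkModule f F z
  refine Eq.trans ?_ (germOver_smul f F z hz (f.appLE U W h a) m).symm
  rw [germ_appLE]; rfl

end Germs

/-! ### Stalks, flatness and lengths along a closed immersion -/

section Pushforward
variable {Z P X : Scheme.{u}} (i : Z ⟶ P) (f : P ⟶ X) {M : Z.Modules} {F : P.Modules}

/-- The map on stalks induced by `F ≅ i_* M`. -/
def stalkPushforwardHom (e : F ≅ (Scheme.Modules.pushforward i).obj M) (z : Z) :
    StalkOver f F (i z) →+ StalkOver (i ≫ f) M z :=
  ((TopCat.Presheaf.stalkFunctor Ab (i z)).map e.hom.mapPresheaf ≫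
    M.presheaf.stalkPushforward Ab i.base z).hom

lemma stalkPushforwardHom_germOver (e : F ≅ (Scheme.Modules.pushforward i).obj M) (z : Z)
    {W : P.Opens} (hz : i z ∈ W) (m : Γ(F, W)) :
    stalkPushforwardHom i f e z (germOver f F (i z) hz m) =
      germOver (i ≫ f) M z (W := i ⁻¹ᵁ W) hz (e.hom.app W m) := by
  refine Eq.trans (congrArg (M.presheaf.stalkPushforward Ab i.base z)
    (TopCat.Presheaf.stalkFunctor_map_germ_apply W (i z) hz e.hom.mapPresheaf m)) ?_
  exact TopCat.Presheaf.stalkPushforward_germ_apply Ab i.base M.presheaf W z hz _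

lemma stalkPushforwardHom_smul (e : F ≅ (Scheme.Modules.pushforward i).obj M) (z : Z)
    (a : X.presheaf.stalk (f (i z))) (v : StalkOver f F (i z)) :
    stalkPushforwardHom i f e z (a • v) =
      (show X.presheaf.stalk ((i ≫ f) z) from a) • stalkPushforwardHom i f e z v := by
  obtain ⟨U, hU, a, rfl⟩ := TopCat.Presheaf.exists_germ_eq X.presheaf a
  obtain ⟨W, hWU, hW, m, rfl⟩ := exists_germOver f F (i z) (U := f ⁻¹ᵁ U) hU v
  refine (congrArg _ (germ_smul_germOver f F (i z) hWU hW a m)).trans ?_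
  rw [stalkPushforwardHom_germOver, stalkPushforwardHom_germOver]
  refine Eq.trans ?_ (germ_smul_germOver (i ≫ f) M z (W := i ⁻¹ᵁ W) (fun _ h => hWU h) hW a _).symm
  refine congrArg _ ((e.hom.app_smul _ m).trans ?_)
  refine congrArg (fun b : Γ(Z, i ⁻¹ᵁ W) => b • (show Γ(M, i ⁻¹ᵁ W) from e.hom.app W m)) ?_
  rw [← appLE_appLE i f hWU le_rfl a, Scheme.Hom.appLE_eq_app]
  rfl

lemma stalkPushforwardHom_bijective [IsClosedImmersion i]
    (e : F ≅ (Scheme.Modules.pushforward i).obj M) (z : Z) :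
    Function.Bijective (stalkPushforwardHom i f e z) := by
  have h₂ := TopCat.Presheaf.stalkPushforward.stalkPushforward_iso_of_isInducing Ab
    (i.isClosedEmbedding.isInducing) M.presheaf z
  have : IsIso e.hom.mapPresheaf := inferInstanceAs (IsIso ((Scheme.Modules.toPresheaf _).map e.hom))
  have h₁ : IsIso ((TopCat.Presheaf.stalkFunctor Ab (i z)).map e.hom.mapPresheaf) := inferInstance
  have := IsIso.comp_isIso' h₁ h₂
  exact ConcreteCategory.bijective_of_isIso ((TopCat.Presheaf.stalkFunctor Ab (i z)).map e.hom.mapPresheaf ≫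
    M.presheaf.stalkPushforward Ab i.base z)

/-- The isomorphism of stalks induced by `F ≅ i_* M`, for a closed immersion `i`. -/
def stalkPushforwardEquiv [IsClosedImmersion i] (e : F ≅ (Scheme.Modules.pushforward i).obj M)
    (z : Z) : letI : Module (X.presheaf.stalk (f (i z))) (StalkOver (i ≫ f) M z) :=
      inferInstanceAs (Module (X.presheaf.stalk ((i ≫ f) z)) (StalkOver (i ≫ f) M z))
    StalkOver f F (i z) ≃ₗ[X.presheaf.stalk (f (i z))] StalkOver (i ≫ f) M z :=
  letI : Module (X.presheaf.stalk (f (i z))) (StalkOver (i ≫ f) M z) :=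
    inferInstanceAs (Module (X.presheaf.stalk ((i ≫ f) z)) (StalkOver (i ≫ f) M z))
  { AddEquiv.ofBijective _ (stalkPushforwardHom_bijective i f e z) with
    map_smul' := stalkPushforwardHom_smul i f e z }

lemma flat_stalk_iff [IsClosedImmersion i] (e : F ≅ (Scheme.Modules.pushforward i).obj M) (z : Z) :
    Module.Flat (X.presheaf.stalk (f (i z))) (StalkOver f F (i z)) ↔
      Module.Flat (X.presheaf.stalk ((i ≫ f) z)) (StalkOver (i ≫ f) M z) :=
  letI : Module (X.presheaf.stalk (f (i z))) (StalkOver (i ≫ f) M z) :=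
    inferInstanceAs (Module (X.presheaf.stalk ((i ≫ f) z)) (StalkOver (i ≫ f) M z))
  Module.Flat.equiv_iff (stalkPushforwardEquiv i f e z)

lemma fibreLengthAt_eq [IsClosedImmersion i] (e : F ≅ (Scheme.Modules.pushforward i).obj M)
    (z : Z) : fibreLengthAt f F (i z) = fibreLengthAt (i ≫ f) M z := by
  let : Module (X.presheaf.stalk (f (i z))) (StalkOver (i ≫ f) M z) :=
    inferInstanceAs (Module (X.presheaf.stalk ((i ≫ f) z)) (StalkOver (i ≫ f) M z))
  have h := ((stalkPushforwardEquiv i f e z).baseChange (X.presheaf.stalk (f (i z)))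
    (IsLocalRing.ResidueField (X.presheaf.stalk (f (i z)))) _ _).length_eq
  exact h

/-- The stalks of `i_* M` vanish off the image of `i`. -/
lemma subsingleton_stalk [IsClosedImmersion i] (e : F ≅ (Scheme.Modules.pushforward i).obj M)
    {z : P} (hz : z ∉ Set.range i) : Subsingleton (StalkOver f F z) := by
  refine subsingleton_of_forall_eq 0 fun v => ?_
  obtain ⟨W, hWU, hW, m, rfl⟩ := exists_germOver f F z
    (U := ⟨(Set.range i)ᶜ, i.isClosedEmbedding.isClosed_range.isOpen_compl⟩) hz v
  have h : i ⁻¹ᵁ W = ⊥ := eq_bot_iff.mpr fun y hy => hWU hy ⟨y, rfl⟩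
  have h0 : e.hom.app W m = 0 :=
    section_ext M (U := i ⁻¹ᵁ W) _ _ fun y hy => (hWU hy ⟨y, rfl⟩).elim
  have : m = 0 := (ConcreteCategory.bijective_of_isIso (e.hom.app W)).1
    (h0.trans (map_zero (e.hom.app W).hom).symm)
  rw [this, map_zero]

lemma isFlatOver_iff [IsClosedImmersion i] (e : F ≅ (Scheme.Modules.pushforward i).obj M) :
    IsFlatOver f F ↔ IsFlatOver (i ≫ f) M := by
  refine ⟨fun h z => (flat_stalk_iff i f e z).mp (h _), fun h z => ?_⟩
  by_cases hz : z ∈ Set.range i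
  · obtain ⟨z, rfl⟩ := hz
    exact (flat_stalk_iff i f e z).mpr (h _)
  · have := subsingleton_stalk i f e hz
    infer_instance

lemma iSup_sum_eq_of_injective {ι κ : Type*} (j : ι → κ) (hj : Function.Injective j) (g : κ → ℕ∞)
    (hg : ∀ k ∉ Set.range j, g k = 0) :
    ⨆ s : Finset κ, ∑ k ∈ s, g k = ⨆ s : Finset ι, ∑ k ∈ s, g (j k) := by
  classical
  refine le_antisymm (iSup_le fun s => ?_) (iSup_le fun s => ?_)
  · refine le_trans (le_of_eq ?_)
      (le_iSup (fun s : Finset ι => ∑ k ∈ s, g (j k)) (s.preimage j hj.injOn))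
    exact (Finset.sum_preimage j s hj.injOn g fun k _ h => hg k h).symm
  · refine le_trans (le_of_eq ?_)
      (le_iSup (fun s : Finset κ => ∑ k ∈ s, g k) (s.map ⟨j, hj⟩))
    exact (Finset.sum_map s ⟨j, hj⟩ g).symm

lemma hasRelativeLength_iff [IsClosedImmersion i] (e : F ≅ (Scheme.Modules.pushforward i).obj M)
    (r : ℕ) : HasRelativeLength f F r ↔ HasRelativeLength (i ≫ f) M r := by
  refine forall_congr' fun x => ?_
  rw [iSup_sum_eq_of_injective (fun y : {y : Z // (i ≫ f) y = x} =>
    (⟨i y.1, y.2⟩ : {z : P // f z = x})) (fun y y' h => Subtype.ext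
      (i.isClosedEmbedding.injective (Subtype.ext_iff.mp h))) (fun z => fibreLengthAt f F z.1)]
  · simp_rw [fibreLengthAt_eq i f e]
  · intro z hz
    have := subsingleton_stalk i f e (z := z.1) fun ⟨y, hy⟩ => hz ⟨⟨y, by
      rw [← z.2, ← hy]; rfl⟩, Subtype.ext hy⟩
    exact Module.length_eq_zero_iff.mpr inferInstance

end Pushforward

/-! ### Stalks at points of an affine open as localizations -/

section Germs
variable {Z X : Scheme.{u}} (f : Z ⟶ X) (M : Z.Modules) (z : Z) {W : Z.Opens} (hz : z ∈ W)

/-- The structure of a module over the functions on a neighbourhood of `z` on the stalk at `z`. -/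
abbrev stalkModuleOn : Module Γ(Z, W) (StalkOver f M z) :=
  letI := stalkModule f M z
  Module.compHom _ (Z.presheaf.germ W z hz).hom

/-- The germ at `z` as a linear map. -/
def germLin : letI := stalkModuleOn f M z hz
    Γ(M, W) →ₗ[Γ(Z, W)] StalkOver f M z :=
  letI := stalkModuleOn f M z hz
  { germOver f M z hz with map_smul' := germOver_smul f M z hz }

lemma mem_basicOpen_iff (hW : IsAffineOpen W) (s : Γ(Z, W)) :
    z ∈ Z.basicOpen s ↔ s ∈ (hW.primeIdealOf ⟨z, hz⟩).asIdeal.primeCompl := by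
  let := Z.presheaf.algebra_section_stalk ⟨z, hz⟩
  have := hW.isLocalization_stalk ⟨z, hz⟩
  rw [Scheme.mem_basicOpen _ s z hz]
  exact IsLocalization.AtPrime.isUnit_to_map_iff (Z.presheaf.stalk z)
    (hW.primeIdealOf ⟨z, hz⟩).asIdeal s

/-- Every germ, and every vanishing of a germ, is realized on a basic open `D(a)` around `z`. There
quasi-coherence provides the denominator `a ^ n`, and `a` lies outside the prime of `z`. -/
lemma isLocalizedModule_germLin (hM : SheafOfModules.IsQuasicoherent.{u} M) (hW : IsAffineOpen W) :
    letI := stalkModuleOn f M z hz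
    IsLocalizedModule (hW.primeIdealOf ⟨z, hz⟩).asIdeal.primeCompl (germLin f M z hz) := by
  let := stalkModule f M z
  let := stalkModuleOn f M z hz
  refine ⟨fun s => ?_, fun v => ?_, fun {t t'} h => ?_⟩
  · have hs := (Scheme.mem_basicOpen _ s.1 z hz).mp ((mem_basicOpen_iff z hz hW s.1).mpr s.2)
    exact (Module.End.isUnit_iff _).mpr hs.smul_bijective
  · obtain ⟨V, hVW, hzV, m, rfl⟩ := exists_germOver f M z hz v
    obtain ⟨a, haV, hza⟩ := hW.exists_basicOpen_le ⟨z, hzV⟩ hz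
    obtain ⟨n, t, ht⟩ := exists_resSec_eq hM hW a rfl (Z.basicOpen_le a) (resSec M haV m)
    refine ⟨⟨t, ⟨a, (mem_basicOpen_iff z hz hW a).mp hza⟩ ^ n⟩, ?_⟩
    change Z.presheaf.germ W z hz (a ^ n) • germOver f M z hzV m = germOver f M z hz t
    rw [← germOver_resSec f M z hza (Z.basicOpen_le a) t, ht, ← germOver_resSec f M z hza haV m]
    refine Eq.trans ?_ (germOver_smul f M z hza _ _).symm
    exact congrArg (fun b : Z.presheaf.stalk z => b • germOver f M z hza (resSec M haV m))
      (TopCat.Presheaf.germ_res_apply Z.presheaf (homOfLE (Z.basicOpen_le a)) z hza (a ^ n)).symm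
  · have h0 : germOver f M z hz (t - t') = 0 := (map_sub _ _ _).trans (sub_eq_zero.mpr h)
    obtain ⟨V, hVW, hzV, h1⟩ := exists_resSec_eq_zero f M z hz _ h0
    obtain ⟨a, haV, hza⟩ := hW.exists_basicOpen_le ⟨z, hzV⟩ hz
    have h2 : resSec M (Z.basicOpen_le a) (t - t') = 0 := by
      rw [← resSec_resSec M hVW haV, h1, resSec_zero]
    obtain ⟨n, hn⟩ := exists_pow_smul_eq_zero hM hW a rfl (Z.basicOpen_le a) _ h2
    refine ⟨⟨a, (mem_basicOpen_iff z hz hW a).mp hza⟩ ^ n, sub_eq_zero.mp ?_⟩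
    exact (smul_sub _ _ _).symm.trans hn

end Germs

/-! ### Flatness over `R` is local over an `R`-algebra -/

section Flat
variable {R B N L : Type*} [CommRing R] [CommRing B] [Algebra R B] [AddCommGroup N] [Module R N]
  [Module B N] [IsScalarTower R B N] [AddCommGroup L] [Module R L] [Module B L]
  [IsScalarTower R B L]

/-- The element `x` dies in `L ⊗ I` because `L` is flat, and that module is the localization of `N ⊗
I`. -/
lemma exists_smul_eq_zero_of_flat (S : Submonoid B) (l : N →ₗ[B] L) [IsLocalizedModule S l]
    [Module.Flat R L] (I : Ideal R) (x : N ⊗[R] I) (hx : I.subtype.lTensor N x = 0) :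
    ∃ s ∈ S, s • x = 0 := by
  let G := AlgebraTensorModule.rTensor R I l
  have hcomp (x) : I.subtype.lTensor L (G x) = (l.restrictScalars R).rTensor R
      (I.subtype.lTensor N x) := by
    induction x with
    | zero => simp
    | add x y hx hy => rw [map_add, map_add, hx, hy, map_add, map_add]
    | tmul n k => rfl
  have h : G x = 0 := (injective_iff_map_eq_zero _).mp
    (Module.Flat.iff_lTensor_injective'.mp ‹_› I) _ (by rw [hcomp, hx, map_zero])
  obtain ⟨s, hs⟩ := (IsLocalizedModule.eq_zero_iff S G).mp h
  exact ⟨s.1, s.2, hs⟩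

/-- A nonzero `x` in the kernel would have a proper annihilator in `B`, contained in some maximal
ideal `P`, against the existence of `s` outside `P` killing `x`. -/
lemma flat_of_forall_isMaximal (h : ∀ (P : Ideal B) [P.IsMaximal] (I : Ideal R) (x : N ⊗[R] I),
    I.subtype.lTensor N x = 0 → ∃ s ∈ P.primeCompl, s • x = 0) : Module.Flat R N := by
  refine Module.Flat.iff_lTensor_injective'.mpr fun I => (injective_iff_map_eq_zero _).mpr
    fun x hx => ?_
  by_contra hne
  obtain ⟨P, hP, hle⟩ := Ideal.exists_le_maximal (LinearMap.ker (LinearMap.toSpanSingleton B _ x))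
    fun h => hne (by simpa using (Ideal.eq_top_iff_one _).mp h)
  obtain ⟨s, hs, h0⟩ := h P I x hx
  exact hs (hle h0)

end Flat

/-! ### Flatness over the base read on sections -/

section Affine
variable {Z X : Scheme.{u}} (π : Z ⟶ X) (M : Z.Modules) {U : X.Opens}

/-- The residue field at a point of `U` as an algebra over the functions on `U`. -/
abbrev residueAlgebra (x : X) (hx : x ∈ U) :
    Algebra Γ(X, U) (IsLocalRing.ResidueField (X.presheaf.stalk x)) :=
  ((IsLocalRing.residue (X.presheaf.stalk x)).comp (X.presheaf.germ U x hx).hom).toAlgebra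

lemma ker_residueAlgebra (hU : IsAffineOpen U) (x : X) (hx : x ∈ U) : letI := residueAlgebra x hx
    RingHom.ker (algebraMap Γ(X, U) (IsLocalRing.ResidueField (X.presheaf.stalk x))) =
      (hU.primeIdealOf ⟨x, hx⟩).asIdeal := by
  ext s
  rw [← not_iff_not]
  refine Iff.trans ?_ ((Scheme.mem_basicOpen _ s x hx).symm.trans (mem_basicOpen_iff x hx hU s))
  exact (IsLocalRing.residue_eq_zero_iff _).not.trans (IsLocalRing.notMem_maximalIdeal)

lemma exists_primeIdealOf (hU : IsAffineOpen U) (p : PrimeSpectrum Γ(X, U)) :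
    ∃ x : U, hU.primeIdealOf x = p :=
  ⟨hU.isoSpec.inv p, congr($(hU.isoSpec.inv_hom_id) p)⟩

lemma primeIdealOf_injective (hU : IsAffineOpen U) : Function.Injective hU.primeIdealOf :=
  fun x y h => Subtype.ext (by rw [← hU.fromSpec_primeIdealOf x, h, hU.fromSpec_primeIdealOf])

variable (U) in
/-- The algebra of functions on the preimage of `U`. -/
abbrev preimageAlgebra : Algebra Γ(X, U) Γ(Z, π ⁻¹ᵁ U) := (π.app U).hom.toAlgebra

variable (U) in
/-- The structure of a module over the functions on `U` on the sections over its preimage. -/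
abbrev pushforwardModule : Module Γ(X, U) Γ(M, π ⁻¹ᵁ U) :=
  inferInstanceAs (Module Γ(X, U) Γ((Scheme.Modules.pushforward π).obj M, U))

variable (U) in
lemma isScalarTower_pushforward :
    letI := preimageAlgebra π U
    letI := pushforwardModule π M U
    IsScalarTower Γ(X, U) Γ(Z, π ⁻¹ᵁ U) Γ(M, π ⁻¹ᵁ U) :=
  letI := preimageAlgebra π U
  letI := pushforwardModule π M U
  .of_algebraMap_smul fun _ _ => rfl

/-- The structure of a module over the functions on `U` on the stalk. -/
abbrev stalkBaseModule (y : Z) (hy : π y ∈ U) : Module Γ(X, U) (StalkOver π M y) :=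
  Module.compHom _ (X.presheaf.germ U (π y) hy).hom

lemma isScalarTower_stalk (y : Z) (hy : π y ∈ U) :
    letI := preimageAlgebra π U
    letI := stalkBaseModule π M y hy
    letI := stalkModuleOn π M y (W := π ⁻¹ᵁ U) hy
    IsScalarTower Γ(X, U) Γ(Z, π ⁻¹ᵁ U) (StalkOver π M y) := by
  let := preimageAlgebra π U
  let := stalkBaseModule π M y hy
  let := stalkModule π M y
  let := stalkModuleOn π M y (W := π ⁻¹ᵁ U) hy
  refine .of_algebraMap_smul fun a v => ?_
  exact congrArg (fun b : Z.presheaf.stalk y => b • v) (π.germ_stalkMap_apply U y hy a).symm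

variable (hU : IsAffineOpen U)
include hU

/-- The local ring is a localization of `Γ(X, U)`, and flatness over a ring and over its
localization agree for modules over the latter. -/
lemma flat_stalk_iff_flat (y : Z) (hy : π y ∈ U) :
    letI := stalkBaseModule π M y hy
    Module.Flat (X.presheaf.stalk (π y)) (StalkOver π M y) ↔
      Module.Flat Γ(X, U) (StalkOver π M y) := by
  let := stalkBaseModule π M y hy
  have := hU.isLocalization_stalk ⟨π y, hy⟩
  let := X.presheaf.algebra_section_stalk ⟨π y, hy⟩
  have : IsScalarTower Γ(X, U) (X.presheaf.stalk (π y)) (StalkOver π M y) :=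
    .of_algebraMap_smul fun _ _ => rfl
  exact Module.flat_iff_of_isLocalization (R := Γ(X, U)) (X.presheaf.stalk (π y))
    (hU.primeIdealOf ⟨π y, hy⟩).asIdeal.primeCompl (StalkOver π M y)

variable [IsAffineHom π] {M}

lemma flat_stalk_of_flat (hM : SheafOfModules.IsQuasicoherent.{u} M)
    (h : Module.Flat Γ(X, U) Γ((Scheme.Modules.pushforward π).obj M, U)) (y : Z) (hy : π y ∈ U) :
    Module.Flat (X.presheaf.stalk (π y)) (StalkOver π M y) := by
  let := preimageAlgebra π U
  let := pushforwardModule π M U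
  have := isScalarTower_pushforward π M U
  have h : Module.Flat Γ(X, U) Γ(M, π ⁻¹ᵁ U) := h
  let := stalkBaseModule π M y hy
  let := stalkModuleOn π M y (W := π ⁻¹ᵁ U) hy
  have := isScalarTower_stalk π M y hy
  have := isLocalizedModule_germLin π M y hy hM (hU.preimage π)
  exact (flat_stalk_iff_flat π M hU y hy).mpr (flat_of_isLocalizedModule (R := Γ(X, U))
    (B := Γ(Z, π ⁻¹ᵁ U))
    (N := Γ(M, π ⁻¹ᵁ U))
    ((hU.preimage π).primeIdealOf ⟨y, hy⟩).asIdeal.primeCompl (germLin π M y (W := π ⁻¹ᵁ U) hy))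

lemma flat_of_isFlatOver (hM : SheafOfModules.IsQuasicoherent.{u} M) (h : IsFlatOver π M) :
    Module.Flat Γ(X, U) Γ((Scheme.Modules.pushforward π).obj M, U) := by
  let := preimageAlgebra π U
  let := pushforwardModule π M U
  have := isScalarTower_pushforward π M U
  suffices Module.Flat Γ(X, U) Γ(M, π ⁻¹ᵁ U) from this
  refine flat_of_forall_isMaximal (B := Γ(Z, π ⁻¹ᵁ U)) fun P hP I x hx => ?_
  obtain ⟨⟨y, hy⟩, hyP⟩ := exists_primeIdealOf (hU.preimage π) ⟨P, hP.isPrime⟩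
  obtain rfl : _ = P := congrArg PrimeSpectrum.asIdeal hyP
  let := stalkBaseModule π M y hy
  let := stalkModuleOn π M y (W := π ⁻¹ᵁ U) hy
  have := isScalarTower_stalk π M y hy
  have := isLocalizedModule_germLin π M y hy hM (hU.preimage π)
  have := (flat_stalk_iff_flat π M hU y hy).mp (h y)
  exact exists_smul_eq_zero_of_flat (B := Γ(Z, π ⁻¹ᵁ U))
    (N := Γ(M, π ⁻¹ᵁ U)) _
    (germLin π M y (W := π ⁻¹ᵁ U) hy) I x hx

end Affine

/-- The tensor products over `R` and over its localization `A` are isomorphic as `A`-modules.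
Lengths over `κ` equal lengths over `A` since `A` surjects onto `κ`. -/
lemma length_tensor_of_isLocalization {R κ L : Type*} [CommRing R] [Field κ] [Algebra R κ]
    [AddCommGroup L] [Module R L] (S : Submonoid R) (A : Type*) [CommRing A] [Algebra R A]
    [IsLocalization S A] [Algebra A κ] [IsScalarTower R A κ] [Module A L] [IsScalarTower R A L]
    (hs : Function.Surjective (algebraMap A κ)) :
    Module.length κ (κ ⊗[A] L) = Module.length κ (κ ⊗[R] L) :=
  (Module.length_eq_of_surjective hs).symm.trans
    ((IsLocalization.moduleTensorEquiv S A κ L).length_eq.trans (Module.length_eq_of_surjective hs))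

/-! ### Fibre lengths of a finite morphism -/

section Length
variable {Z X : Scheme.{u}} (π : Z ⟶ X) [IsAffineHom π] {M : Z.Modules} {U : X.Opens}
  (hU : IsAffineOpen U)
include hU

/-- The length of the fibre of a stalk, in terms of the action of functions on the sections. -/
lemma fibreLengthAt_eq_finrank (hM : SheafOfModules.IsQuasicoherent.{u} M) (x : X) (hx : x ∈ U)
    (y : Z) (hy : π y = x) :
    letI := residueAlgebra x hx
    letI := preimageAlgebra π U
    letI := pushforwardModule π M U
    haveI := isScalarTower_pushforward π M U
    letI K := IsLocalRing.ResidueField (X.presheaf.stalk x)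
    Module.Finite Γ(X, U) Γ(M, π ⁻¹ᵁ U) →
    fibreLengthAt π M y = Module.finrank K ((K ⊗[Γ(X, U)] Γ(M, π ⁻¹ᵁ U)) ⧸
      torsionAt (baseChangeAction Γ(X, U) Γ(Z, π ⁻¹ᵁ U) K Γ(M, π ⁻¹ᵁ U))
        ((hU.preimage π).primeIdealOf ⟨y, show π y ∈ U from hy ▸ hx⟩)) := by
  subst hy
  let := residueAlgebra (π y) hx
  let := preimageAlgebra π U
  let := pushforwardModule π M U
  have := isScalarTower_pushforward π M U
  intro hf
  let := stalkBaseModule π M y hx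
  let := stalkModuleOn π M y (W := π ⁻¹ᵁ U) hx
  have := isScalarTower_stalk π M y hx
  have := isLocalizedModule_germLin π M y hx hM (hU.preimage π)
  refine Eq.trans ?_ (length_baseChange_localized (R := Γ(X, U)) (B := Γ(Z, π ⁻¹ᵁ U))
    (N := Γ(M, π ⁻¹ᵁ U)) (germLin π M y (W := π ⁻¹ᵁ U) hx) _)
  have := hU.isLocalization_stalk ⟨π y, hx⟩
  let := X.presheaf.algebra_section_stalk ⟨π y, hx⟩
  have : IsScalarTower Γ(X, U) (X.presheaf.stalk (π y)) (StalkOver π M y) :=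
    .of_algebraMap_smul fun _ _ => rfl
  have : IsScalarTower Γ(X, U) (X.presheaf.stalk (π y))
    (IsLocalRing.ResidueField (X.presheaf.stalk (π y))) := .of_algebraMap_smul fun _ _ => rfl
  exact length_tensor_of_isLocalization (hU.primeIdealOf ⟨π y, hx⟩).asIdeal.primeCompl
    (X.presheaf.stalk (π y)) IsLocalRing.residue_surjective

end Length

section Finite
variable {Z X : Scheme.{u}} (π : Z ⟶ X) [IsFinite π] {M : Z.Modules} {U : X.Opens}
  (hU : IsAffineOpen U)
include hU

/-- For a finite morphism, the length of the fibres is the rank of the push-forward. -/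
lemma iSup_sum_fibreLengthAt (hM : IsCoherent M) (x : X) (hx : x ∈ U) :
    letI := residueAlgebra x hx
    letI K := IsLocalRing.ResidueField (X.presheaf.stalk x)
    ⨆ s : Finset {z : Z // π z = x}, ∑ z ∈ s, fibreLengthAt π M z.1 =
      Module.finrank K (K ⊗[Γ(X, U)] Γ((Scheme.Modules.pushforward π).obj M, U)) := by
  let := residueAlgebra x hx
  let := preimageAlgebra π U
  let := pushforwardModule π M U
  have := isScalarTower_pushforward π M U
  have hW := hU.preimage π
  have hfin := hM.2 _ hW
  have hB : Module.Finite Γ(X, U) Γ(Z, π ⁻¹ᵁ U) := π.finite_app U hU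
  have hf : Module.Finite Γ(X, U) Γ(M, π ⁻¹ᵁ U) := .trans Γ(Z, π ⁻¹ᵁ U) _
  have hmem (y : {z : Z // π z = x}) : π y.1 ∈ U := by rw [y.2]; exact hx
  refine iSup_sum_length (R := Γ(X, U)) (B := Γ(Z, π ⁻¹ᵁ U)) (N := Γ(M, π ⁻¹ᵁ U))
    (K := IsLocalRing.ResidueField (X.presheaf.stalk x))
    (fun y : {z : Z // π z = x} => hW.primeIdealOf ⟨y.1, hmem y⟩)
    (fun y y' h => Subtype.ext (congrArg (fun w : π ⁻¹ᵁ U => w.1) (primeIdealOf_injective hW h))) (fun p => ?_) _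
    fun y => fibreLengthAt_eq_finrank π hU hM.1 x hx y.1 y.2 hf
  -- The points of the fibre over `x` correspond to the primes of `Γ(Z, π⁻¹(U))` that contract to
  -- the prime of `x`.
  have hcomap (y : Z) (hy : π y ∈ U) : (hW.primeIdealOf ⟨y, hy⟩).comap (π.app U).hom =
      hU.primeIdealOf ⟨π y, hy⟩ := by
    have := IsAffineOpen.comap_primeIdealOf_appLE (f := π) (x := y) U hU (π ⁻¹ᵁ U) hW le_rfl hy
    rwa [Scheme.Hom.appLE_eq_app] at this
  rw [ker_residueAlgebra hU x hx]
  constructor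
  · rintro ⟨⟨y, rfl⟩, rfl⟩
    exact congrArg PrimeSpectrum.asIdeal (hcomap y hx)
  · intro hp
    obtain ⟨⟨y, hy⟩, rfl⟩ := exists_primeIdealOf hW p
    have h := (congrArg PrimeSpectrum.asIdeal (hcomap y hy)).symm.trans hp
    exact ⟨⟨y, congrArg Subtype.val (primeIdealOf_injective hU (PrimeSpectrum.ext h))⟩, rfl⟩

end Finite

/-! ### Local freeness of flat coherent sheaves -/

section Rank
variable {R R' N N' I : Type*} [CommRing R] [CommRing R'] [Algebra R R'] [AddCommGroup N] [Module R N]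
  [AddCommGroup N'] [Module R N'] [Module R' N'] [IsScalarTower R R' N']

lemma nonempty_basis_of_isLocalizedModule (S : Submonoid R) [IsLocalization S R'] (g : N →ₗ[R] N')
    [IsLocalizedModule S g] (b : Module.Basis I (Localization S) (LocalizedModule S N)) :
    Nonempty (Module.Basis I R' N') := by
  let e : Localization S ≃ₐ[R] R' := IsLocalization.algEquiv S _ _
  let : Module (Localization S) N' := Module.compHom N' e.toRingEquiv.toRingHom
  have : IsScalarTower R (Localization S) N' := .of_algebraMap_smul fun a n => by
    change e (algebraMap _ _ a) • n = a • n
    rw [e.commutes, algebraMap_smul]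
  exact ⟨(b.map (LinearEquiv.extendScalarsOfIsLocalization S (Localization S)
    (IsLocalizedModule.iso S g))).mapCoeffs e.toRingEquiv fun _ _ => rfl⟩

end Rank

section Basis
variable {X : Scheme.{u}} {E : X.Modules} (hE : SheafOfModules.IsQuasicoherent.{u} E)
include hE

lemma exists_basis_basicOpen {U : X.Opens} (hU : IsAffineOpen U) (f : Γ(X, U)) {I : Type*}
    (b : Module.Basis I (Localization (.powers f)) (LocalizedModule.Away f Γ(E, U))) :
    Nonempty (Module.Basis I Γ(X, X.basicOpen f) Γ(E, X.basicOpen f)) := by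
  have hD := X.basicOpen_le f
  let := (resFun hD).toAlgebra
  have := hU.isLocalization_basicOpen f
  let : Module Γ(X, U) Γ(E, X.basicOpen f) := Module.compHom _ (resFun hD)
  have : IsScalarTower Γ(X, U) Γ(X, X.basicOpen f) Γ(E, X.basicOpen f) :=
    .of_algebraMap_smul fun _ _ => rfl
  let g : Γ(E, U) →ₗ[Γ(X, U)] Γ(E, X.basicOpen f) :=
    { toFun := resSec E hD
      map_add' := resSec_add E hD
      map_smul' := resSec_smul E hD }
  have : IsLocalizedModule (.powers f) g := by
    refine ⟨fun s => ?_, fun s => ?_, fun {t t'} h => ?_⟩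
    · obtain ⟨_, n, rfl⟩ := s
      have hs : IsUnit (resFun hD (f ^ n)) := by
        rw [map_pow]
        exact (isUnit_resFun f hD le_rfl).pow n
      exact (Module.End.isUnit_iff _).mpr hs.smul_bijective
    · obtain ⟨n, t, h⟩ := exists_resSec_eq hE hU f rfl hD s
      exact ⟨⟨t, ⟨_, n, rfl⟩⟩, h.symm⟩
    · obtain ⟨n, hn⟩ := exists_pow_smul_eq_zero hE hU f rfl hD (t - t')
        ((resSec_sub E hD t t').trans (sub_eq_zero.mpr h))
      exact ⟨⟨_, n, rfl⟩, sub_eq_zero.mp ((smul_sub _ _ _).symm.trans hn)⟩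
  exact nonempty_basis_of_isLocalizedModule (.powers f) g b

/-- A flat coherent sheaf on a locally Noetherian scheme is locally free. -/
lemma exists_basis_of_flat [IsLocallyNoetherian X] {U : X.Opens} (hU : IsAffineOpen U)
    (hf : Module.Finite Γ(X, U) Γ(E, U)) (hfl : Module.Flat Γ(X, U) Γ(E, U)) (x : X) (hx : x ∈ U) :
    ∃ (V : X.Opens) (n : ℕ), IsAffineOpen V ∧ x ∈ V ∧
      Nonempty (Module.Basis (Fin n) Γ(X, V) Γ(E, V)) := by
  have : IsNoetherianRing Γ(X, U) := IsLocallyNoetherian.component_noetherian ⟨U, hU⟩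
  have := Module.finitePresentation_of_finite Γ(X, U) Γ(E, U)
  let p := hU.primeIdealOf ⟨x, hx⟩
  -- A finitely generated flat module over a local ring is free; finite presentation then spreads
  -- freeness from the point to a basic open.
  have : Module.Free (Localization.AtPrime p.asIdeal) (LocalizedModule p.asIdeal.primeCompl Γ(E, U)) :=
    Module.free_of_flat_of_isLocalRing
  obtain ⟨f, hf, _, -⟩ := Module.FinitePresentation.exists_free_localizedModule_powers
    p.asIdeal.primeCompl (LocalizedModule.mkLinearMap p.asIdeal.primeCompl Γ(E, U))
    (Localization.AtPrime p.asIdeal)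
  have : Module.Finite (Localization (.powers f)) (LocalizedModule.Away f Γ(E, U)) := inferInstance
  exact ⟨X.basicOpen f, _, hU.basicOpen f, (mem_basicOpen_iff x hx hU f).mpr hf,
    exists_basis_basicOpen hE hU f
      ((Module.Free.chooseBasis _ _).reindex (Fintype.equivFin _))⟩

end Basis

/-! ### Flat families and locally free push-forwards -/

section Family
variable {Z X : Scheme.{u}} {π : Z ⟶ X} {M : Z.Modules} {E : X.Modules} {r : ℕ}

lemma finrank_residue_of_basis {U : X.Opens} {x : X} (hx : x ∈ U) {n : ℕ}
    (b : Module.Basis (Fin n) Γ(X, U) Γ(E, U)) :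
    letI := residueAlgebra x hx
    letI K := IsLocalRing.ResidueField (X.presheaf.stalk x)
    Module.finrank K (K ⊗[Γ(X, U)] Γ(E, U)) = n := by
  let := residueAlgebra x hx
  have := (algebraMap Γ(X, U) (IsLocalRing.ResidueField (X.presheaf.stalk x))).domain_nontrivial
  have := Module.Free.of_basis b
  rw [Module.finrank_baseChange, Module.finrank_eq_card_basis b, Fintype.card_fin]

/-- A coherent sheaf, finite over `X` and flat of relative length `r`, has a push-forward which is
locally free of rank `r`. -/
lemma isLocallyFreeOfRank_pushforward [IsLocallyNoetherian X] [IsFinite π] (hM : IsCoherent M)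
    (hfl : IsFlatOver π M) (hl : HasRelativeLength π M r) :
    IsLocallyFreeOfRank ((Scheme.Modules.pushforward π).obj M) r := by
  have hE := isQuasicoherent_pushforward π M hM.1
  refine isLocallyFreeOfRank_of_basis hE fun x => ?_
  obtain ⟨U, hU, hx, -⟩ := exists_affine_mem (show x ∈ (⊤ : X.Opens) from trivial)
  have hf : Module.Finite Γ(X, U) Γ((Scheme.Modules.pushforward π).obj M, U) :=
    have := hM.2 _ (hU.preimage π)
    finite_of_ringHom_finite (π.app U).hom (π.finite_app U hU) (AddEquiv.refl Γ(M, π ⁻¹ᵁ U))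
      fun r m => rfl
  obtain ⟨V, n, hV, hxV, ⟨b⟩⟩ := exists_basis_of_flat hE hU hf (flat_of_isFlatOver π hU hM.1 hfl) x hx
  have h := (iSup_sum_fibreLengthAt π hV hM x hxV).symm.trans (hl x)
  -- The rank of the local basis is the dimension of the fibre at `x`, which is the total length at
  -- `x`. The same point serves as centre of the neighbourhood and as test for the rank.
  have h' : n = r := by
    have := Nat.cast_injective h
    rwa [finrank_residue_of_basis hxV b] at this
  exact ⟨V, hV, hxV, h' ▸ ⟨b⟩⟩

lemma isFlatOver_of_pushforward_iso [IsAffineHom π] (hM : SheafOfModules.IsQuasicoherent.{u} M)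
    (hE : IsLocallyFreeOfRank E r) (θ : (Scheme.Modules.pushforward π).obj M ≅ E) :
    IsFlatOver π M := fun y => by
  obtain ⟨U, hU, hy, ⟨b⟩⟩ := hE.exists_basis (π y)
  have := Module.Free.of_basis b
  have : Module.Flat Γ(X, U) Γ((Scheme.Modules.pushforward π).obj M, U) :=
    Module.Flat.of_linearEquiv (LinearEquiv.ofBijective (appLin θ.hom U)
      (ConcreteCategory.bijective_of_isIso (θ.hom.app U)))
  exact flat_stalk_of_flat π hU hM this y hy

lemma hasRelativeLength_of_pushforward_iso [IsFinite π] (hM : IsCoherent M)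
    (hE : IsLocallyFreeOfRank E r) (θ : (Scheme.Modules.pushforward π).obj M ≅ E) :
    HasRelativeLength π M r := fun x => by
  obtain ⟨U, hU, hx, ⟨b⟩⟩ := hE.exists_basis x
  rw [iSup_sum_fibreLengthAt π hU hM x hx, finrank_residue_of_basis hx (b.map
    (LinearEquiv.ofBijective (appLin θ.hom U)
      (ConcreteCategory.bijective_of_isIso (θ.hom.app U))).symm)]

end Family

/-! ### The sheaf of a canonical presentation and its support -/

section Support
variable {S X Y : Scheme.{u}} {sX : X ⟶ S} {sY : Y ⟶ S} {E : X.Modules} {r : ℕ}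
  [IsLocallyNoetherian X] [IsProper sY] (hE : IsLocallyFreeOfRank E r)
include hE

variable {p : Presentation sX sY E} {φ : AzumayaMorphism sX sY E} (hp : p.IsCanonical φ)
  {M : p.alg.surrogate.Modules} {η : (Scheme.Modules.pushforward p.alg.toBase).obj M ≅ E}
  (hM : IsModuleOver p.alg M η) {F : (pullback sX sY).Modules}
  (κ : F ≅ (Scheme.Modules.pushforward p.graph).obj M)
include hp hM κ

/-- Flatness and length of `M` over `X` follow from its push-forward being `E`; the closed graph
then transfers them, and coherence, to `F`. -/
lemma Presentation.IsCanonical.isFlatFamily : IsFlatFamily (pullback.fst sX sY) F r := by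
  have hf (U : X.Opens) (hU : IsAffineOpen U) := hE.finite hU
  have := hp.isClosedImmersion hE.isQuasicoherent hf
  have := p.alg.isFinite_toBase hE.isQuasicoherent hf
  have hMc := hM.isCoherent hf
  have hfl := isFlatOver_of_pushforward_iso hM.1 hE η
  have hl := hasRelativeLength_of_pushforward_iso hMc hE η
  rw [← p.graph_fst] at hfl hl
  exact ⟨.of_iso κ.symm (isCoherent_pushforward p.graph hMc),
    (isFlatOver_iff p.graph (pullback.fst sX sY) κ).mpr hfl,
    (hasRelativeLength_iff p.graph (pullback.fst sX sY) κ r).mpr hl⟩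

/-- Functions on the surrogate act faithfully on `M`, so those on `X × Y` that kill `F` are exactly
those vanishing on the closed graph. -/
lemma Presentation.IsCanonical.ker_graph : p.graph.ker = annihilator F := by
  have hf (U : X.Opens) (hU : IsAffineOpen U) := hE.finite hU
  have := hp.isClosedImmersion hE.isQuasicoherent hf
  exact ker_eq_annihilator p.graph (hp.isFlatFamily hE hM κ).coherent κ
    fun V hV t ht => hM.eq_zero_of_annihilates hE.isQuasicoherent hf hV t ht

lemma Presentation.IsCanonical.exists_iso_schemeSupport :
    ∃ u : p.alg.surrogate ≅ schemeSupport F,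
      u.hom ≫ schemeSupportι F ≫ pullback.fst sX sY = p.alg.toBase ∧
      u.hom ≫ schemeSupportι F ≫ pullback.snd sX sY = p.map := by
  have hf (U : X.Opens) (hU : IsAffineOpen U) := hE.finite hU
  have := hp.isClosedImmersion hE.isQuasicoherent hf
  have hk : (schemeSupportι F).ker = p.graph.ker := by
    rw [Scheme.IdealSheafData.ker_subschemeι, hp.ker_graph hE hM κ]
  have := IsClosedImmersion.isIso_lift _ _ hk
  have h := IsClosedImmersion.lift_fac _ _ hk.le
  refine ⟨asIso (IsClosedImmersion.lift _ _ hk.le), ?_, ?_⟩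
  · rw [asIso_hom, ← Category.assoc, h, p.graph_fst]
  · rw [asIso_hom, ← Category.assoc, h, p.graph_snd]

end Support

/-! ### Morphisms between push-forwards from closed subschemes -/

section Semilinear
variable {Z Z' P X : Scheme.{u}} (i : Z ⟶ P) (v : Z' ⟶ Z) {M : Z.Modules} {M' : Z'.Modules}

/-- A linear map between push-forwards along closed immersions is linear over the functions on the
closed subschemes. -/
lemma app_smul_of_isClosedImmersion [IsClosedImmersion i]
    (G : (Scheme.Modules.pushforward i).obj M ⟶ (Scheme.Modules.pushforward (v ≫ i)).obj M')
    (W : P.Opens) (t : Γ(Z, i ⁻¹ᵁ W)) (m : Γ(M, i ⁻¹ᵁ W)) :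
    G.app W (show Γ(M, i ⁻¹ᵁ W) from t • m) =
      v.app (i ⁻¹ᵁ W) t • (show Γ(M', v ⁻¹ᵁ (i ⁻¹ᵁ W)) from G.app W m) := by
  refine section_ext ((Scheme.Modules.pushforward (v ≫ i)).obj M') (U := W) _ _ fun x hx => ?_
  obtain ⟨V, hV, hxV, hVW⟩ := exists_affine_mem hx
  refine ⟨V, hVW, hxV, ?_⟩
  obtain ⟨a, ha⟩ := i.app_surjective V hV (resFun (i.preimage_mono hVW) t)
  refine (app_resSec G hVW _).symm.trans ?_
  refine (congrArg (G.app V) (resSec_smul M (i.preimage_mono hVW) t m)).trans ?_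
  refine Eq.trans ?_ (resSec_smul M' (v.preimage_mono (i.preimage_mono hVW)) _ _).symm
  rw [← app_resFun v (i.preimage_mono hVW), ← ha]
  refine (G.app_smul a (resSec ((Scheme.Modules.pushforward i).obj M) hVW m)).trans ?_
  exact congrArg (fun y : Γ((Scheme.Modules.pushforward (v ≫ i)).obj M', V) => a • y)
    (app_resSec G hVW m)

lemma inv_app_hom_app {A B : Z.Modules} (e : A ≅ B) (U : Z.Opens) (m : Γ(A, U)) :
    e.inv.app U (e.hom.app U m) = m :=
  congr(($e.hom_inv_id).app U m)

lemma hom_app_inv_app {A B : Z.Modules} (e : A ≅ B) (U : Z.Opens) (m : Γ(B, U)) :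
    e.hom.app U (e.inv.app U m) = m :=
  inv_app_hom_app e.symm U m

variable (f : P ⟶ X) {F : P.Modules} {F' : P.Modules}
  (κ : F ≅ (Scheme.Modules.pushforward i).obj M)
  (κ' : F' ≅ (Scheme.Modules.pushforward (v ≫ i)).obj M')
include κ κ'

/-- A morphism over `P` is automatically linear over functions on the closed subscheme, so it
descends by full faithfulness of `i_*`. -/
lemma exists_hom_of_isClosedImmersion [IsClosedImmersion i] (hM : SheafOfModules.IsQuasicoherent.{u} M)
    (g : F ⟶ F') : ∃ c : M ⟶ (Scheme.Modules.pushforward v).obj M',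
      g = κ.hom ≫ (Scheme.Modules.pushforward i).map c ≫
        (Scheme.Modules.pushforwardComp v i).hom.app M' ≫ κ'.inv := by
  let G := κ.inv ≫ g ≫ κ'.hom
  obtain ⟨c, hc, -⟩ := existsUnique_hom_of_pushforward hM (π := i)
    (G ≫ (Scheme.Modules.pushforwardComp v i).inv.app M')
    fun U hU t m => app_smul_of_isClosedImmersion i v G U t m
  refine ⟨c, ?_⟩
  rw [hc]
  simp [G]

/-- Both morphisms come from morphisms on `Z`, and these are determined by their push-forward along
the affine morphism `i ≫ f`. -/
lemma hom_ext_of_pushforward [IsClosedImmersion i] [IsAffineHom (i ≫ f)]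
    (hM : SheafOfModules.IsQuasicoherent.{u} M) {g g' : F ⟶ F'}
    (h : (Scheme.Modules.pushforward f).map g = (Scheme.Modules.pushforward f).map g') : g = g' := by
  obtain ⟨c, rfl⟩ := exists_hom_of_isClosedImmersion i v κ κ' hM g
  obtain ⟨c', rfl⟩ := exists_hom_of_isClosedImmersion i v κ κ' hM g'
  suffices c = c' by rw [this]
  refine (existsUnique_hom_of_pushforward hM ((Scheme.Modules.pushforward (i ≫ f)).map c')
    fun U hU t m => (c'.app_smul t m)).unique ?_ rfl
  refine Scheme.Modules.hom_ext _ _ fun U => ?_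
  ext m
  have h := congr(κ'.hom.app (f ⁻¹ᵁ U) (($h).app U (κ.inv.app (f ⁻¹ᵁ U) m)))
  have key (c : M ⟶ (Scheme.Modules.pushforward v).obj M') :
      κ'.hom.app (f ⁻¹ᵁ U) (κ'.inv.app (f ⁻¹ᵁ U) (c.app (i ⁻¹ᵁ (f ⁻¹ᵁ U)) (κ.hom.app (f ⁻¹ᵁ U)
        (κ.inv.app (f ⁻¹ᵁ U) m)))) = c.app (i ⁻¹ᵁ (f ⁻¹ᵁ U)) m :=
    (hom_app_inv_app κ' _ _).trans (congrArg (c.app _) (hom_app_inv_app κ (f ⁻¹ᵁ U) m))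
  exact (key c).symm.trans (h.trans (key c'))

/-- Hypothesis `hl` says that `h'` is linear over functions on `Z`, so it comes from a morphism `c`
on `Z`. Being bijective over preimages of affine opens, `c` is an isomorphism. -/
lemma exists_iso_of_pushforward [IsClosedImmersion i] [IsAffineHom (i ≫ f)]
    [IsAffineHom v] (hM : SheafOfModules.IsQuasicoherent.{u} M)
    (hM' : SheafOfModules.IsQuasicoherent.{u} M')
    (h' : (Scheme.Modules.pushforward f).obj F ≅ (Scheme.Modules.pushforward f).obj F')
    (hl : ∀ (U : X.Opens), IsAffineOpen U → ∀ (t : Γ(Z, i ⁻¹ᵁ (f ⁻¹ᵁ U))) (m : Γ(M, i ⁻¹ᵁ (f ⁻¹ᵁ U))),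
      κ'.hom.app (f ⁻¹ᵁ U) (h'.hom.app U (κ.inv.app (f ⁻¹ᵁ U)
          (show Γ(M, i ⁻¹ᵁ (f ⁻¹ᵁ U)) from t • m))) =
        v.app _ t • (show Γ(M', v ⁻¹ᵁ (i ⁻¹ᵁ (f ⁻¹ᵁ U))) from
          κ'.hom.app (f ⁻¹ᵁ U) (h'.hom.app U (κ.inv.app (f ⁻¹ᵁ U) m)))) :
    ∃ g : F ≅ F', (Scheme.Modules.pushforward f).mapIso g = h' := by
  let H : (Scheme.Modules.pushforward (i ≫ f)).obj M ⟶
      (Scheme.Modules.pushforward (i ≫ f)).obj ((Scheme.Modules.pushforward v).obj M') :=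
    (Scheme.Modules.pushforwardComp i f).inv.app M ≫ (Scheme.Modules.pushforward f).map κ.inv ≫
    h'.hom ≫ (Scheme.Modules.pushforward f).map κ'.hom ≫
    (Scheme.Modules.pushforward f).map ((Scheme.Modules.pushforwardComp v i).inv.app M') ≫
    (Scheme.Modules.pushforwardComp i f).hom.app ((Scheme.Modules.pushforward v).obj M')
  obtain ⟨c, hc, -⟩ := existsUnique_hom_of_pushforward hM H fun U hU t m => hl U hU t m
  have : IsIso c := isIso_of_bijective_preimage (π := i ≫ f) hM (isQuasicoherent_pushforward v M' hM')
    c fun U hU => by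
      have h := ConcreteCategory.bijective_of_isIso (H.app U)
      rwa [← hc] at h
  refine ⟨κ ≪≫ (Scheme.Modules.pushforward i).mapIso (asIso c) ≪≫
        (Scheme.Modules.pushforwardComp v i).app M' ≪≫ κ'.symm, ?_⟩
  ext : 1
  refine Scheme.Modules.hom_ext _ _ fun U => ?_
  ext m
  have h := congr(κ'.inv.app (f ⁻¹ᵁ U) (($hc).app U (κ.hom.app (f ⁻¹ᵁ U) m)))
  refine Eq.trans h ((inv_app_hom_app κ' _ _).trans ?_)
  exact congrArg (h'.hom.app U) (inv_app_hom_app κ _ m)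

end Semilinear

/-! ### The same with the factorization given by an equation -/

section Transport
variable {Z Z' P X : Scheme.{u}} (i : Z ⟶ P) {i' : Z' ⟶ P} (v : Z' ⟶ Z) (hv : v ≫ i = i')
  {M : Z.Modules} {M' : Z'.Modules}
include hv

lemma preimage_le_of_comp_eq (W : P.Opens) : i' ⁻¹ᵁ W ≤ v ⁻¹ᵁ (i ⁻¹ᵁ W) := by rw [← hv]; rfl

lemma app_smul_of_comp_eq [IsClosedImmersion i]
    (G : (Scheme.Modules.pushforward i).obj M ⟶ (Scheme.Modules.pushforward i').obj M')
    (W : P.Opens) (t : Γ(Z, i ⁻¹ᵁ W)) (m : Γ(M, i ⁻¹ᵁ W)) :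
    G.app W (show Γ(M, i ⁻¹ᵁ W) from t • m) =
      v.appLE _ _ (preimage_le_of_comp_eq i v hv W) t • (show Γ(M', i' ⁻¹ᵁ W) from G.app W m) := by
  subst hv
  refine (app_smul_of_isClosedImmersion i v G W t m).trans ?_
  exact congrArg (fun y : Γ(Z', v ⁻¹ᵁ (i ⁻¹ᵁ W)) => y • (show Γ(M', v ⁻¹ᵁ (i ⁻¹ᵁ W)) from G.app W m))
    congr($(v.appLE_eq_app (U := i ⁻¹ᵁ W)) t).symm

variable (f : P ⟶ X) {F : P.Modules} {F' : P.Modules}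
  (κ : F ≅ (Scheme.Modules.pushforward i).obj M)
  (κ' : F' ≅ (Scheme.Modules.pushforward i').obj M')
include κ κ'

lemma hom_ext_of_comp_eq [IsClosedImmersion i] [IsAffineHom (i ≫ f)]
    (hM : SheafOfModules.IsQuasicoherent.{u} M) {g g' : F ⟶ F'}
    (h : (Scheme.Modules.pushforward f).map g = (Scheme.Modules.pushforward f).map g') : g = g' := by
  subst hv
  exact hom_ext_of_pushforward i v f κ κ' hM h

lemma exists_iso_of_comp_eq [IsClosedImmersion i] [IsAffineHom (i ≫ f)]
    [IsAffineHom v] (hM : SheafOfModules.IsQuasicoherent.{u} M)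
    (hM' : SheafOfModules.IsQuasicoherent.{u} M')
    (h : (Scheme.Modules.pushforward f).obj F ≅ (Scheme.Modules.pushforward f).obj F')
    (hl : ∀ (U : X.Opens), IsAffineOpen U → ∀ (t : Γ(Z, i ⁻¹ᵁ (f ⁻¹ᵁ U))) (m : Γ(M, i ⁻¹ᵁ (f ⁻¹ᵁ U))),
      κ'.hom.app (f ⁻¹ᵁ U) (h.hom.app U (κ.inv.app (f ⁻¹ᵁ U)
          (show Γ(M, i ⁻¹ᵁ (f ⁻¹ᵁ U)) from t • m))) =
        v.appLE _ _ (preimage_le_of_comp_eq i v hv (f ⁻¹ᵁ U)) t •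
          (show Γ(M', i' ⁻¹ᵁ (f ⁻¹ᵁ U)) from
            κ'.hom.app (f ⁻¹ᵁ U) (h.hom.app U (κ.inv.app (f ⁻¹ᵁ U) m)))) :
    ∃ g : F ≅ F', (Scheme.Modules.pushforward f).mapIso g = h := by
  subst hv
  refine exists_iso_of_pushforward i v f κ κ' hM hM' h fun U hU t m => (hl U hU t m).trans ?_
  exact congrArg (fun y : Γ(Z', v ⁻¹ᵁ (i ⁻¹ᵁ (f ⁻¹ᵁ U))) => y • (show Γ(M', v ⁻¹ᵁ (i ⁻¹ᵁ (f ⁻¹ᵁ U)))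
      from κ'.hom.app (f ⁻¹ᵁ U) (h.hom.app U (κ.inv.app (f ⁻¹ᵁ U) m))))
    congr($(v.appLE_eq_app (U := i ⁻¹ᵁ (f ⁻¹ᵁ U))) t)

end Transport

lemma resFun_bijective {Z : Scheme.{u}} {V W : Z.Opens} (h : V ≤ W) (h' : V = W) :
    Function.Bijective (resFun h) := by
  subst h'
  refine ⟨fun s t e => ?_, fun s => ⟨s, resFun_self s⟩⟩
  exact (resFun_self s).symm.trans (e.trans (resFun_self t))

/-! ### Functions on the surrogate acting on `E` through `θ` -/

namespace Presentation
variable {S X Y : Scheme.{u}} {sX : X ⟶ S} {sY : Y ⟶ S} {E : X.Modules} (p : Presentation sX sY E)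

lemma preimage_eq (U : X.Opens) :
    p.alg.toBase ⁻¹ᵁ U = p.graph ⁻¹ᵁ (pullback.fst sX sY ⁻¹ᵁ U) := by
  rw [← p.graph_fst]; rfl

/-- The action of functions on the surrogate, for sections over preimages under the graph. -/
def evalGraph (U : X.AffineZariskiSite) :
    Γ(p.alg.surrogate, p.graph ⁻¹ᵁ (pullback.fst sX sY ⁻¹ᵁ U.1)) →+* p.alg.obj U.1 :=
  (p.alg.eval U).comp (resFun (p.preimage_eq U.1).le)

lemma evalGraph_bijective (U : X.AffineZariskiSite) : Function.Bijective (p.evalGraph U) :=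
  (p.alg.eval_bijective U).comp (resFun_bijective _ (p.preimage_eq U.1))

variable {p} {M : p.alg.surrogate.Modules} {η : (Scheme.Modules.pushforward p.alg.toBase).obj M ≅ E}
  (hM : IsModuleOver p.alg M η) {F : (pullback sX sY).Modules}
  (κ : F ≅ (Scheme.Modules.pushforward p.graph).obj M)
  {θ : (Scheme.Modules.pushforward (pullback.fst sX sY)).obj F ≅ E}
  (hθ : θ = (Scheme.Modules.pushforward (pullback.fst sX sY)).mapIso κ ≪≫
        (Scheme.Modules.pushforwardComp p.graph (pullback.fst sX sY)).app M ≪≫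
        (Scheme.Modules.pushforwardCongr p.graph_fst).app M ≪≫ η)
include hM hθ

lemma app_smul_eq_evalGraph (U : X.AffineZariskiSite)
    (s : Γ(p.alg.surrogate, p.graph ⁻¹ᵁ (pullback.fst sX sY ⁻¹ᵁ U.1)))
    (m : Γ(M, p.graph ⁻¹ᵁ (pullback.fst sX sY ⁻¹ᵁ U.1))) :
    θ.hom.app U.1 (κ.inv.app (pullback.fst sX sY ⁻¹ᵁ U.1) (show Γ(M, _) from s • m)) =
      EndOn.toEnd E U.1 (p.evalGraph U s).1
        (θ.hom.app U.1 (κ.inv.app (pullback.fst sX sY ⁻¹ᵁ U.1) m)) := by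
  have key (m : Γ(M, p.graph ⁻¹ᵁ (pullback.fst sX sY ⁻¹ᵁ U.1))) :
      θ.hom.app U.1 (κ.inv.app (pullback.fst sX sY ⁻¹ᵁ U.1) m) =
        η.hom.app U.1 (resSec M (p.preimage_eq U.1).le m) := by
    subst hθ
    exact congrArg (fun m => η.hom.app U.1 (resSec M (p.preimage_eq U.1).le m)) (hom_app_inv_app κ _ m)
  refine (key _).trans ((congrArg (η.hom.app U.1) (resSec_smul M _ s m)).trans ?_)
  refine (hM.smul U _ _).trans ?_
  exact (congrArg (EndOn.toEnd E U.1 (p.evalGraph U s).1) (key m)).symm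

end Presentation

/-! ### Conjugation of subalgebras -/

section Conj
variable {X : Scheme.{u}} {E₁ E₂ : X.Modules} (e : E₁ ≅ E₂)

lemma EndOn.toEnd_conj (U : X.Opens) (s : EndOn E₁ U) (m : Γ(E₁, U)) :
    EndOn.toEnd E₂ U (EndOn.conj e U s) (e.hom.app U m) = e.hom.app U (EndOn.toEnd E₁ U s m) :=
  congrArg (fun m => e.hom.app U (EndOn.toEnd E₁ U s m)) (inv_app_hom_app e U m)

lemma EndOn.conj_symm_conj (U : X.Opens) (s : EndOn E₁ U) :
    EndOn.conj e.symm U (EndOn.conj e U s) = s :=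
  Subtype.ext (funext fun V => LinearMap.ext fun m =>
    (inv_app_hom_app e V.1 _).trans (congrArg (s.1 V) (inv_app_hom_app e V.1 m)))

lemma EndOn.conj_scalar (U : X.Opens) (a : Γ(X, U)) :
    EndOn.conj e U (EndOn.scalar E₁ U a) = EndOn.scalar E₂ U a :=
  Subtype.ext (funext fun V => LinearMap.ext fun m =>
    (e.hom.app_smul (resFun V.2 a) (e.inv.app V.1 m)).trans
      (congrArg (fun m : Γ(E₂, V.1) => resFun V.2 a • m) (hom_app_inv_app e V.1 m)))

variable {A₁ : CommSubalgebra E₁} {A₂ : CommSubalgebra E₂} {e}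

namespace CommSubalgebra

lemma conj_mem_of_affine
    (h : ∀ U : X.AffineZariskiSite, ∀ s ∈ A₁.obj U.1, EndOn.conj e U.1 s ∈ A₂.obj U.1)
    {U : X.Opens} {s : EndOn E₁ U} (hs : s ∈ A₁.obj U) : EndOn.conj e U s ∈ A₂.obj U :=
  A₂.mem_of_locally _ fun _ hx => by
    obtain ⟨V, hV, hxV, hVU⟩ := exists_affine_mem hx
    exact ⟨V, hVU, hxV, h ⟨V, hV⟩ _ (A₁.res_mem hVU hs)⟩

variable (h : ∀ U, ∀ s ∈ A₁.obj U, EndOn.conj e U s ∈ A₂.obj U)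

lemma specMap_conj_toBase : specMap (conjMap e h) ≫ A₁.toBase = A₂.toBase :=
  specMap_toBase _ fun U a => Subtype.ext (EndOn.conj_scalar e U a)

lemma eval_specMap_conj (U : X.AffineZariskiSite) (s : Γ(A₁.surrogate, A₁.toBase ⁻¹ᵁ U.1)) :
    (A₂.eval U ((specMap (conjMap e h)).appLE (A₁.toBase ⁻¹ᵁ U.1) (A₂.toBase ⁻¹ᵁ U.1)
      (by rw [← specMap_conj_toBase h]; rfl) s)).1 = EndOn.conj e U.1 (A₁.eval U s).1 :=
  congr(($(eval_specMap (conjMap e h) (fun U a => Subtype.ext (EndOn.conj_scalar e U a)) U s)).1)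

end CommSubalgebra

end Conj

/-! ### Isomorphisms of sheaves as conjugations -/

section Iso
variable {S X Y : Scheme.{u}} {sX : X ⟶ S} {sY : Y ⟶ S} {E₁ E₂ : X.Modules}
  {p₁ : Presentation sX sY E₁} {p₂ : Presentation sX sY E₂}
  (v : p₂.alg.surrogate ⟶ p₁.alg.surrogate) (hv : v ≫ p₁.graph = p₂.graph)
include hv

lemma toBase_of_graph : v ≫ p₁.alg.toBase = p₂.alg.toBase := by
  rw [← p₁.graph_fst, ← p₂.graph_fst, ← hv, Category.assoc]

lemma map_of_graph : v ≫ p₁.map = p₂.map := by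
  rw [← p₁.graph_snd, ← p₂.graph_snd, ← hv, Category.assoc]

lemma evalGraph_appLE (U : X.AffineZariskiSite)
    (s : Γ(p₁.alg.surrogate, p₁.graph ⁻¹ᵁ (pullback.fst sX sY ⁻¹ᵁ U.1))) :
    p₂.evalGraph U (v.appLE _ _ (preimage_le_of_comp_eq p₁.graph v hv _) s) =
      p₂.alg.eval U (v.appLE (p₁.alg.toBase ⁻¹ᵁ U.1) (p₂.alg.toBase ⁻¹ᵁ U.1)
        (by rw [← toBase_of_graph v hv]; rfl) (resFun (p₁.preimage_eq U.1).le s)) :=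
  congrArg (p₂.alg.eval U) ((resFun_appLE v _ _ s).trans (appLE_resFun v _ _ s).symm)

variable {M₁ : p₁.alg.surrogate.Modules}
  {η₁ : (Scheme.Modules.pushforward p₁.alg.toBase).obj M₁ ≅ E₁}
  (hM₁ : IsModuleOver p₁.alg M₁ η₁) {F₁ : (pullback sX sY).Modules}
  (κ₁ : F₁ ≅ (Scheme.Modules.pushforward p₁.graph).obj M₁)
  {θ₁ : (Scheme.Modules.pushforward (pullback.fst sX sY)).obj F₁ ≅ E₁}
  (hθ₁ : θ₁ = (Scheme.Modules.pushforward (pullback.fst sX sY)).mapIso κ₁ ≪≫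
        (Scheme.Modules.pushforwardComp p₁.graph (pullback.fst sX sY)).app M₁ ≪≫
        (Scheme.Modules.pushforwardCongr p₁.graph_fst).app M₁ ≪≫ η₁)
  {M₂ : p₂.alg.surrogate.Modules}
  {η₂ : (Scheme.Modules.pushforward p₂.alg.toBase).obj M₂ ≅ E₂}
  (hM₂ : IsModuleOver p₂.alg M₂ η₂) {F₂ : (pullback sX sY).Modules}
  (κ₂ : F₂ ≅ (Scheme.Modules.pushforward p₂.graph).obj M₂)
  {θ₂ : (Scheme.Modules.pushforward (pullback.fst sX sY)).obj F₂ ≅ E₂}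
  (hθ₂ : θ₂ = (Scheme.Modules.pushforward (pullback.fst sX sY)).mapIso κ₂ ≪≫
        (Scheme.Modules.pushforwardComp p₂.graph (pullback.fst sX sY)).app M₂ ≪≫
        (Scheme.Modules.pushforwardCongr p₂.graph_fst).app M₂ ≪≫ η₂)
include hM₁ hθ₁ hM₂ hθ₂

/-- Transported to the surrogates, `g` is linear along `v`, because `p₁.graph` is a closed
immersion. Read through `θ₁` and `θ₂`, this linearity is the identity of endomorphisms. -/
lemma conj_evalGraph [IsClosedImmersion p₁.graph] (hE₂ : SheafOfModules.IsQuasicoherent.{u} E₂)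
    (g : F₁ ≅ F₂) (U : X.AffineZariskiSite)
    (s : Γ(p₁.alg.surrogate, p₁.graph ⁻¹ᵁ (pullback.fst sX sY ⁻¹ᵁ U.1))) :
    EndOn.conj (θ₁.symm ≪≫ (Scheme.Modules.pushforward (pullback.fst sX sY)).mapIso g ≪≫ θ₂) U.1
        (p₁.evalGraph U s).1 =
      (p₂.evalGraph U (v.appLE _ _ (preimage_le_of_comp_eq p₁.graph v hv _) s)).1 := by
  refine EndOn.toEnd_injective hE₂ U.2 (LinearMap.ext fun m => ?_)
  let e := θ₁.symm ≪≫ (Scheme.Modules.pushforward (pullback.fst sX sY)).mapIso g ≪≫ θ₂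
  let G := κ₁.inv ≫ g.hom ≫ κ₂.hom
  let W := pullback.fst sX sY ⁻¹ᵁ U.1
  have hW (n : Γ(M₁, p₁.graph ⁻¹ᵁ W)) : e.hom.app U.1 (θ₁.hom.app U.1 (κ₁.inv.app W n)) =
      θ₂.hom.app U.1 (κ₂.inv.app W (G.app W n)) := by
    refine (congrArg (fun y => θ₂.hom.app U.1 (g.hom.app W y)) (inv_app_hom_app θ₁ U.1 _)).trans ?_
    exact congrArg (θ₂.hom.app U.1) (inv_app_hom_app κ₂ W _).symm
  obtain ⟨m, rfl⟩ := (ConcreteCategory.bijective_of_isIso (e.hom.app U.1)).2 m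
  obtain ⟨m, rfl⟩ := (ConcreteCategory.bijective_of_isIso (θ₁.hom.app U.1)).2 m
  obtain ⟨n, rfl⟩ := (ConcreteCategory.bijective_of_isIso (κ₁.inv.app W)).2 m
  refine (EndOn.toEnd_conj e U.1 _ _).trans ?_
  refine (congrArg (e.hom.app U.1) (p₁.app_smul_eq_evalGraph hM₁ κ₁ hθ₁ U s n)).symm.trans ?_
  refine (hW _).trans ?_
  refine (congrArg (fun y => θ₂.hom.app U.1 (κ₂.inv.app W y))
    (app_smul_of_comp_eq p₁.graph v hv G W s n)).trans ?_
  refine (p₂.app_smul_eq_evalGraph hM₂ κ₂ hθ₂ U _ _).trans ?_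
  exact congrArg (EndOn.toEnd E₂ U.1 _) (hW n).symm

lemma conj_mem [IsClosedImmersion p₁.graph] (hE₂ : SheafOfModules.IsQuasicoherent.{u} E₂)
    (g : F₁ ≅ F₂) (U : X.Opens) (s : EndOn E₁ U) (hs : s ∈ p₁.alg.obj U) :
    EndOn.conj (θ₁.symm ≪≫ (Scheme.Modules.pushforward (pullback.fst sX sY)).mapIso g ≪≫ θ₂) U s ∈
      p₂.alg.obj U := by
  refine CommSubalgebra.conj_mem_of_affine (fun U s hs => ?_) hs
  obtain ⟨t, ht⟩ := (p₁.evalGraph_bijective U).2 ⟨s, hs⟩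
  obtain rfl : (p₁.evalGraph U t).1 = s := congrArg Subtype.val ht
  rw [conj_evalGraph v hv hM₁ κ₁ hθ₁ hM₂ κ₂ hθ₂ hE₂ g U t]
  exact (p₂.evalGraph U _).2

lemma specMap_conjMap_eq [IsClosedImmersion p₁.graph] (hE₂ : SheafOfModules.IsQuasicoherent.{u} E₂)
    (g : F₁ ≅ F₂) : CommSubalgebra.specMap (CommSubalgebra.conjMap _
      (conj_mem v hv hM₁ κ₁ hθ₁ hM₂ κ₂ hθ₂ hE₂ g)) = v := by
  refine CommSubalgebra.hom_ext_of_eval (τ := p₁.alg.toBase) (CommSubalgebra.specMap_conj_toBase _)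
    (toBase_of_graph v hv) fun U s => (CommSubalgebra.eval_specMap_conj _ U s).trans ?_
  obtain ⟨t, rfl⟩ := (resFun_bijective (p₁.preimage_eq U.1).le (p₁.preimage_eq U.1)).2 s
  refine (conj_evalGraph v hv hM₁ κ₁ hθ₁ hM₂ κ₂ hθ₂ hE₂ g U t).trans ?_
  exact congrArg Subtype.val (evalGraph_appLE v hv U t)

/-- Hypothesis `hc` says that `θ₁ ≪≫ e ≪≫ θ₂.symm` is linear along `v`, which is what
`exists_iso_of_comp_eq` needs to lift it to the sheaves. -/
lemma exists_iso_of_conj [IsClosedImmersion p₁.graph] [IsIso v] (e : E₁ ≅ E₂)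
    (hc : ∀ (U : X.AffineZariskiSite)
      (s : Γ(p₁.alg.surrogate, p₁.graph ⁻¹ᵁ (pullback.fst sX sY ⁻¹ᵁ U.1))),
      EndOn.conj e U.1 (p₁.evalGraph U s).1 =
        (p₂.evalGraph U (v.appLE _ _ (preimage_le_of_comp_eq p₁.graph v hv _) s)).1) :
    ∃ g : F₁ ≅ F₂,
      θ₁.symm ≪≫ (Scheme.Modules.pushforward (pullback.fst sX sY)).mapIso g ≪≫ θ₂ = e := by
  have : IsAffineHom (p₁.graph ≫ pullback.fst sX sY) := by
    rw [p₁.graph_fst]; infer_instance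
  let ψ := θ₁ ≪≫ e ≪≫ θ₂.symm
  obtain ⟨g, hg⟩ := exists_iso_of_comp_eq p₁.graph v hv (pullback.fst sX sY) κ₁ κ₂ hM₁.1 hM₂.1 ψ
    fun U hU t m => by
      let W := pullback.fst sX sY ⁻¹ᵁ U
      let n : Γ(M₂, p₂.graph ⁻¹ᵁ W) := κ₂.hom.app W (ψ.hom.app U (κ₁.inv.app W m))
      have hn : θ₂.hom.app U (κ₂.inv.app W n) = e.hom.app U (θ₁.hom.app U (κ₁.inv.app W m)) :=
        (congrArg (θ₂.hom.app U) (inv_app_hom_app κ₂ W _)).trans (hom_app_inv_app θ₂ U _)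
      suffices h : θ₂.hom.app U (ψ.hom.app U (κ₁.inv.app W (show Γ(M₁, p₁.graph ⁻¹ᵁ W) from t • m))) =
          θ₂.hom.app U (κ₂.inv.app W (show Γ(M₂, p₂.graph ⁻¹ᵁ W) from
            v.appLE _ _ (preimage_le_of_comp_eq p₁.graph v hv W) t • n)) by
        have h' := (ConcreteCategory.bijective_of_isIso (θ₂.hom.app U)).1 h
        exact (congrArg (κ₂.hom.app W) h').trans (hom_app_inv_app κ₂ W _)
      refine (hom_app_inv_app θ₂ U _).trans ?_
      refine (congrArg (e.hom.app U) (p₁.app_smul_eq_evalGraph hM₁ κ₁ hθ₁ ⟨U, hU⟩ t m)).trans ?_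
      refine Eq.trans ?_ (p₂.app_smul_eq_evalGraph hM₂ κ₂ hθ₂ ⟨U, hU⟩ _ n).symm
      rw [hn]
      refine (EndOn.toEnd_conj e U _ _).symm.trans ?_
      exact congrArg (fun y => EndOn.toEnd E₂ U y (e.hom.app U (θ₁.hom.app U (κ₁.inv.app W m))))
        (hc ⟨U, hU⟩ t)
  exact ⟨g, by rw [hg]; simp [ψ]⟩

end Iso

/-! ### Isomorphisms of sheaves and of morphisms -/

section MorphismIso
variable {S X Y : Scheme.{u}} {sX : X ⟶ S} {sY : Y ⟶ S} {E₁ E₂ : X.Modules} {r : ℕ}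
  [IsLocallyNoetherian X] [IsProper sY] (hE₁ : IsLocallyFreeOfRank E₁ r)
  (hE₂ : IsLocallyFreeOfRank E₂ r) {φ₁ : AzumayaMorphism sX sY E₁} {φ₂ : AzumayaMorphism sX sY E₂}
  {F₁ F₂ : (pullback sX sY).Modules}
  {θ₁ : (Scheme.Modules.pushforward (pullback.fst sX sY)).obj F₁ ≅ E₁}
  {θ₂ : (Scheme.Modules.pushforward (pullback.fst sX sY)).obj F₂ ≅ E₂}
  (h₁ : Corresponds φ₁ F₁ θ₁) (h₂ : Corresponds φ₂ F₂ θ₂)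
include hE₁ hE₂ h₁ h₂

/-- Isomorphic sheaves have the same annihilator, so the two closed graphs have the same ideal and
lift through each other. The lift is the morphism induced by conjugation, and applying the same
argument to the inverse of `g` shows that conjugation is onto. -/
lemma isMorphismIso_of_iso (g : F₁ ≅ F₂) : IsMorphismIso
    (θ₁.symm ≪≫ (Scheme.Modules.pushforward (pullback.fst sX sY)).mapIso g ≪≫ θ₂) φ₁ φ₂ := by
  obtain ⟨p₁, hp₁, M₁, η₁, κ₁, hM₁, hθ₁⟩ := h₁
  obtain ⟨p₂, hp₂, M₂, η₂, κ₂, hM₂, hθ₂⟩ := h₂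
  have hi₁ := hp₁.isClosedImmersion hE₁.isQuasicoherent fun U hU => hE₁.finite hU
  have hi₂ := hp₂.isClosedImmersion hE₂.isQuasicoherent fun U hU => hE₂.finite hU
  have hk : p₁.graph.ker = p₂.graph.ker :=
    (hp₁.ker_graph hE₁ hM₁ κ₁).trans (hp₂.ker_graph hE₂ hM₂ (g ≪≫ κ₂)).symm
  have hv := IsClosedImmersion.lift_fac p₁.graph p₂.graph hk.le
  have hv' := IsClosedImmersion.lift_fac p₂.graph p₁.graph hk.ge
  refine ⟨p₁, p₂, hp₁, hp₂, fun U s hs => ?_,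
    conj_mem _ hv hM₁ κ₁ hθ₁ hM₂ κ₂ hθ₂ hE₂.isQuasicoherent g, ?_⟩
  · have h := conj_mem _ hv' hM₂ κ₂ hθ₂ hM₁ κ₁ hθ₁ hE₁.isQuasicoherent g.symm U _ hs
    have e : θ₂.symm ≪≫ (Scheme.Modules.pushforward (pullback.fst sX sY)).mapIso g.symm ≪≫ θ₁ =
      (θ₁.symm ≪≫ (Scheme.Modules.pushforward (pullback.fst sX sY)).mapIso g ≪≫ θ₂).symm := by
      ext; simp
    rwa [e, EndOn.conj_symm_conj] at h
  · rw [specMap_conjMap_eq _ hv hM₁ κ₁ hθ₁ hM₂ κ₂ hθ₂ hE₂.isQuasicoherent, map_of_graph _ hv]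

/-- The morphism of surrogates induced by conjugation commutes with the graphs, and it is an
isomorphism because conjugation is bijective between the algebras. Existence is then
`exists_iso_of_conj`, and uniqueness is faithfulness of the push-forward to `X`. -/
lemma IsMorphismIso.existsUnique_iso {e : E₁ ≅ E₂} (he : IsMorphismIso e φ₁ φ₂) : ∃! g : F₁ ≅ F₂,
    θ₁.symm ≪≫ (Scheme.Modules.pushforward (pullback.fst sX sY)).mapIso g ≪≫ θ₂ = e := by
  obtain ⟨p₁, hp₁, M₁, η₁, κ₁, hM₁, hθ₁⟩ := h₁
  obtain ⟨p₂, hp₂, M₂, η₂, κ₂, hM₂, hθ₂⟩ := h₂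
  have hi₁ := hp₁.isClosedImmersion hE₁.isQuasicoherent fun U hU => hE₁.finite hU
  have hi₂ := hp₂.isClosedImmersion hE₂.isQuasicoherent fun U hU => hE₂.finite hU
  obtain ⟨q₁, q₂, hq₁, hq₂, hc', hc, hm⟩ := he
  obtain rfl := hq₁.eq hp₁
  obtain rfl := hq₂.eq hp₂
  let v := CommSubalgebra.specMap (CommSubalgebra.conjMap e hc)
  have hvX : v ≫ q₁.alg.toBase = q₂.alg.toBase := CommSubalgebra.specMap_conj_toBase hc
  have hv : v ≫ q₁.graph = q₂.graph := by
    apply pullback.hom_ext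
    · rw [Category.assoc, Presentation.graph_fst, Presentation.graph_fst, hvX]
    · rw [Category.assoc, Presentation.graph_snd, Presentation.graph_snd, hm]
  have heval (U : X.AffineZariskiSite) (s) := CommSubalgebra.eval_specMap_conj hc U s
  have hiso : IsIso v := isIso_of_appLE (π := q₁.alg.toBase) (π' := q₂.alg.toBase) v hvX
    fun U hU => ⟨fun s t h => ?_, fun t => ?_⟩
  · have : IsAffineHom (q₁.graph ≫ pullback.fst sX sY) := by
      rw [q₁.graph_fst]; infer_instance
    have hex := exists_iso_of_conj v hv hM₁ κ₁ hθ₁ hM₂ κ₂ hθ₂ e fun U s =>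
      (heval U _).symm.trans (congrArg Subtype.val (evalGraph_appLE v hv U s)).symm
    obtain ⟨g, hg⟩ := hex
    refine ⟨g, hg, fun g' hg' => ?_⟩
    have h := congrArg (fun i => θ₁.hom ≫ i.hom ≫ θ₂.inv) (hg'.trans hg.symm)
    refine Iso.ext (hom_ext_of_comp_eq q₁.graph v hv (pullback.fst sX sY) κ₁ κ₂ hM₁.1 ?_)
    simpa using h
  · have h2 := ((heval ⟨U, hU⟩ s).symm.trans
      (congrArg (fun y => (q₂.alg.eval ⟨U, hU⟩ y).1) h)).trans (heval ⟨U, hU⟩ t)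
    have h3 := congrArg (EndOn.conj e.symm U) h2
    rw [EndOn.conj_symm_conj, EndOn.conj_symm_conj] at h3
    exact (q₁.alg.eval_bijective ⟨U, hU⟩).1 (Subtype.ext h3)
  · have hsymm : EndOn.conj e U (EndOn.conj e.symm U (q₂.alg.eval ⟨U, hU⟩ t).1) =
        (q₂.alg.eval ⟨U, hU⟩ t).1 := EndOn.conj_symm_conj e.symm U _
    have hmem : EndOn.conj e.symm U (q₂.alg.eval ⟨U, hU⟩ t).1 ∈ q₁.alg.obj U := by
      refine hc' U _ ?_
      rw [hsymm]
      exact (q₂.alg.eval ⟨U, hU⟩ t).2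
    obtain ⟨s, hs⟩ := (q₁.alg.eval_bijective ⟨U, hU⟩).2 ⟨_, hmem⟩
    refine ⟨s, (q₂.alg.eval_bijective ⟨U, hU⟩).1 (Subtype.ext ?_)⟩
    refine (heval ⟨U, hU⟩ s).trans (Eq.trans ?_ hsymm)
    exact congrArg (fun y => EndOn.conj e U y.1) hs

end MorphismIso

/-- The morphism is determined by the sheaf. -/
lemma Corresponds.eq {S X Y : Scheme.{u}} {sX : X ⟶ S} {sY : Y ⟶ S} {E : X.Modules} {r : ℕ}
    [IsLocallyNoetherian X] [IsProper sY] (hE : IsLocallyFreeOfRank E r)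
    {φ φ' : AzumayaMorphism sX sY E} {F : (pullback sX sY).Modules}
    {θ : (Scheme.Modules.pushforward (pullback.fst sX sY)).obj F ≅ E}
    (h : Corresponds φ F θ) (h' : Corresponds φ' F θ) : φ = φ' := by
  obtain ⟨p, p', hp, hp', -, hc, hm⟩ := isMorphismIso_of_iso hE hE h h' (Iso.refl F)
  have e : θ.symm ≪≫ (Scheme.Modules.pushforward (pullback.fst sX sY)).mapIso (Iso.refl F) ≪≫ θ =
    Iso.refl E := by ext; simp
  rw [← hp.toMorphism_eq, ← hp'.toMorphism_eq]
  -- Once the composite is replaced by the identity of `E`, conjugation is the identity, so the data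
  -- say that `p` refines `p'`.
  generalize θ.symm ≪≫ (Scheme.Modules.pushforward (pullback.fst sX sY)).mapIso (Iso.refl F) ≪≫ θ = e'
    at hc hm e
  subst e
  exact Quot.sound ⟨p, p.refines_refl, hc, hm⟩

/-! ### A coherent sheaf as a module on its support -/

section SupportModule
variable {P : Scheme.{u}} {F : P.Modules}

/-- A coherent sheaf is the push-forward of a faithful coherent sheaf on its support. -/
lemma IsCoherent.exists_module_schemeSupport (hF : IsCoherent F) :
    ∃ (M : (schemeSupport F).Modules) (_ : F ≅ (Scheme.Modules.pushforward (schemeSupportι F)).obj M),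
      IsCoherent M ∧ ∀ V : (schemeSupport F).Opens, IsAffineOpen V → ∀ t : Γ(schemeSupport F, V),
        (∀ m : Γ(M, V), t • m = 0) → t = 0 := by
  let i := schemeSupportι F
  have hker (W : P.Opens) (hW : IsAffineOpen W) (a : Γ(P, W)) :
      i.app W a = 0 ↔ ∀ m : Γ(F, W), a • m = 0 := by
    have h : RingHom.ker (i.app W).hom = Module.annihilator Γ(P, W) Γ(F, W) :=
      ((annihilator F).ker_subschemeι_app ⟨W, hW⟩).trans (annihilator_ideal hF ⟨W, hW⟩)
    exact (RingHom.mem_ker (f := (i.app W).hom)).symm.trans (by rw [h, Module.mem_annihilator])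
  let σ (W : P.Opens) : Γ(P, W) →+* AddMonoid.End Γ(F, W) := Module.toAddMonoidEnd Γ(P, W) Γ(F, W)
  have hσ (W : P.Opens) (hW : IsAffineOpen W) : RingHom.ker (i.app W).hom ≤ RingHom.ker (σ W) :=
    fun a ha => AddMonoidHom.ext fun m => (hker W hW a).mp ha m
  -- Over an affine `W`, functions on the support are `Γ(P, W)` modulo the annihilator, so the
  -- action on `Γ(F, W)` descends to them.
  let ρ (W : P.Opens) (hW : IsAffineOpen W) :
      Γ(schemeSupport F, i ⁻¹ᵁ W) →+* AddMonoid.End Γ(F, W) :=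
    (i.app W).hom.liftOfSurjective (i.app_surjective W hW) ⟨σ W, hσ W hW⟩
  have hρ (W : P.Opens) (hW : IsAffineOpen W) (a : Γ(P, W)) (m : Γ(F, W)) :
      ρ W hW (i.app W a) m = a • m :=
    congr($((i.app W).hom.liftOfRightInverse_comp_apply _
      (Function.rightInverse_surjInv (i.app_surjective W hW)) ⟨σ W, hσ W hW⟩ a) m)
  obtain ⟨α, hα⟩ := exists_act (E := F) (π := i) ρ fun U V hU hV h t m => by
    obtain ⟨a, rfl⟩ := i.app_surjective U hU t
    rw [hρ U hU, ← app_resFun, hρ V hV, resSec_smul]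
  have hα' (W : P.Opens) (a : Γ(P, W)) (m : Γ(F, W)) : α.act W (i.app W a) m = a • m := by
    refine section_ext F _ _ fun x hx => ?_
    obtain ⟨V, hV, hxV, hVW⟩ := exists_affine_mem hx
    refine ⟨V, hVW, hxV, ?_⟩
    rw [α.res hVW, ← app_resFun, hα V hV, hρ V hV, resSec_smul]
  obtain ⟨M, κ, hM, hκ⟩ := α.exists_module hF.1 hα'
  have hcov (z : schemeSupport F) : ∃ W : P.Opens, IsAffineOpen W ∧ i z ∈ W := by
    obtain ⟨W, hW, hz, -⟩ := exists_affine_mem (show i z ∈ (⊤ : P.Opens) from trivial)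
    exact ⟨W, hW, hz⟩
  refine ⟨M, κ.symm, ⟨hM, fun V hV => finite_of_affine_cover hM (fun z => ?_) hV⟩, fun V hV t ht =>
    eq_zero_of_annihilates hM (fun z => ?_) hV ht⟩
  · obtain ⟨W, hW, hz⟩ := hcov z
    exact ⟨_, hW.preimage i, hz, finite_of_pushforward_iso κ (hF.2 W hW)⟩
  · obtain ⟨W, hW, hz⟩ := hcov z
    refine ⟨_, hW.preimage i, hz, finite_of_pushforward_iso κ (hF.2 W hW), fun t ht => ?_⟩
    obtain ⟨a, rfl⟩ := i.app_surjective W hW t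
    refine (hker W hW a).mpr fun m => ?_
    obtain ⟨m, rfl⟩ := (ConcreteCategory.bijective_of_isIso (κ.hom.app W)).2 m
    exact (κ.hom.app_smul a m).symm.trans
      ((congrArg (κ.hom.app W) (ht m)).trans (map_zero (κ.hom.app W).hom))

end SupportModule

/-! ### Finiteness of the fibres of the support -/

section Nakayama
open IsLocalRing

/-- The hypothesis gives `L = 𝔪 L`, and `𝔪` maps into the maximal ideal of `A'` because `φ` is
local. Nakayama is applied over `A'`, the ring over which `L` is finite. -/
lemma subsingleton_of_subsingleton_tensor {A A' L : Type*} [CommRing A] [CommRing A'] [IsLocalRing A]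
    [IsLocalRing A'] (φ : A →+* A') [IsLocalHom φ] [AddCommGroup L] [Module A L] [Module A' L]
    [Module.Finite A' L] (hφ : ∀ (a : A) (v : L), a • v = φ a • v)
    (h : Subsingleton (ResidueField A ⊗[A] L)) : Subsingleton L := by
  have h : Subsingleton ((A ⧸ maximalIdeal A) ⊗[A] L) := h
  have h1 : Subsingleton (L ⧸ (maximalIdeal A • (⊤ : Submodule A L))) :=
    (TensorProduct.quotTensorEquivQuotSMul L (maximalIdeal A)).symm.injective.subsingleton
  have h2 := Submodule.unique_quotient_iff_eq_top.mp ⟨⟨⟨0⟩, fun _ => h1.elim _ _⟩⟩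
  have h3 (v : L) : v ∈ maximalIdeal A' • (⊤ : Submodule A' L) := by
    refine Submodule.smul_induction_on (p := fun v => v ∈ maximalIdeal A' • (⊤ : Submodule A' L))
      (by rw [h2]; trivial : v ∈ maximalIdeal A • (⊤ : Submodule A L)) (fun a ha v _ => ?_)
      fun _ _ => Submodule.add_mem _
    rw [hφ]
    exact Submodule.smul_mem_smul (map_nonunit φ a ha) trivial
  have h4 := Submodule.eq_bot_of_le_smul_of_le_jacobson_bot (maximalIdeal A') (⊤ : Submodule A' L)
    Module.Finite.fg_top (fun v _ => h3 v) (maximalIdeal_le_jacobson _)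
  exact Submodule.subsingleton_iff A' |>.mp (subsingleton_of_bot_eq_top h4.symm)

end Nakayama

section Fibres
variable {Z X : Scheme.{u}} (π : Z ⟶ X) {M : Z.Modules}

/-- If the length vanished, so would the stalk, by Nakayama. Finitely many generators would then be
killed by one function outside the prime of `z`; faithfulness makes that function zero, which lies
in every prime. -/
lemma fibreLengthAt_ne_zero (hM : IsCoherent M)
    (hf : ∀ V : Z.Opens, IsAffineOpen V → ∀ t : Γ(Z, V), (∀ m : Γ(M, V), t • m = 0) → t = 0) (z : Z) :
    fibreLengthAt π M z ≠ 0 := by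
  intro h0
  have h := Module.length_eq_zero_iff.mp h0
  obtain ⟨W, hW, hz, -⟩ := exists_affine_mem (show z ∈ (⊤ : Z.Opens) from trivial)
  have hfin := hM.2 W hW
  let := stalkModule π M z
  let := stalkModuleOn π M z hz
  let := Z.presheaf.algebra_section_stalk ⟨z, hz⟩
  have := hW.isLocalization_stalk ⟨z, hz⟩
  have : IsScalarTower Γ(Z, W) (Z.presheaf.stalk z) (StalkOver π M z) :=
    .of_algebraMap_smul fun _ _ => rfl
  have hl := isLocalizedModule_germLin π M z hz hM.1 hW
  have : Module.Finite (Z.presheaf.stalk z) (StalkOver π M z) :=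
    .of_isLocalizedModule (hW.primeIdealOf ⟨z, hz⟩).asIdeal.primeCompl
      (Rₚ := Z.presheaf.stalk z) (germLin π M z hz)
  have hs : Subsingleton (StalkOver π M z) :=
    subsingleton_of_subsingleton_tensor (π.stalkMap z).hom (fun _ _ => rfl) h
  obtain ⟨S, hS⟩ := hfin.fg_top
  have key (m : Γ(M, W)) : ∃ s : (hW.primeIdealOf ⟨z, hz⟩).asIdeal.primeCompl, s.1 • m = 0 :=
    (IsLocalizedModule.eq_zero_iff _ (germLin π M z hz)).mp (Subsingleton.elim _ _)
  choose s hs' using key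
  have hann : ∀ m : Γ(M, W), (∏ m ∈ S, (s m).1) • m = 0 := fun m => by
    have hm : m ∈ Submodule.span Γ(Z, W) (S : Set Γ(M, W)) := hS ▸ Submodule.mem_top
    induction hm using Submodule.span_induction with
    | mem m hm =>
      obtain ⟨c, hc⟩ := Finset.dvd_prod_of_mem (fun m => (s m).1) hm
      rw [hc, mul_comm, mul_smul, hs', smul_zero]
    | zero => exact smul_zero _
    | add _ _ _ _ h h' => rw [smul_add, h, h', add_zero]
    | smul a m _ h => rw [smul_comm, h, smul_zero]
  have h1 := hf W hW _ hann
  have h2 : (∏ m ∈ S, s m).1 ∈ (hW.primeIdealOf ⟨z, hz⟩).asIdeal := by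
    rw [Submonoid.coe_finsetProd, h1]
    exact zero_mem _
  exact (∏ m ∈ S, s m).2 h2

/-- Each point contributes at least one, so `r + 1` distinct points would exceed the total length.
-/
lemma finite_fibre {r : ℕ} (hr : HasRelativeLength π M r) (h : ∀ z, fibreLengthAt π M z ≠ 0) (x : X) :
    (π ⁻¹' {x}).Finite := by
  by_contra hinf
  have : Infinite {z : Z // π z = x} := Set.infinite_coe_iff.mpr hinf
  obtain ⟨s, hs⟩ := Infinite.exists_subset_card_eq {z : Z // π z = x} (r + 1)
  have h1 : ((r + 1 : ℕ) : ℕ∞) ≤ ∑ z ∈ s, fibreLengthAt π M z.1 := by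
    rw [← hs, Finset.card_eq_sum_ones, Nat.cast_sum]
    exact Finset.sum_le_sum fun z _ => by
      simpa using Order.one_le_iff_pos.mpr (pos_iff_ne_zero.mpr (h z.1))
  have h2 := h1.trans ((le_iSup (fun s : Finset {z : Z // π z = x} =>
    ∑ z ∈ s, fibreLengthAt π M z.1) s).trans (hr x).le)
  exact absurd (Nat.cast_le.mp h2) (by simp)

end Fibres

/-! ### Flat families are finite over the base -/

section Finite
variable {P X : Scheme.{u}} (f : P ⟶ X) [IsProper f] {F : P.Modules} {r : ℕ}

lemma IsLocallyFreeOfRank.of_iso {E E' : X.Modules} (hE : IsLocallyFreeOfRank E r) (e : E ≅ E') :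
    IsLocallyFreeOfRank E' r := fun x => by
  obtain ⟨U, hU, ⟨b⟩⟩ := hE x
  exact ⟨U, hU, ⟨(Scheme.Modules.restrictFunctor U.ι).mapIso e.symm ≪≫ b⟩⟩

/-- A flat family is the push-forward of a faithful coherent sheaf on its support, which is finite
over the base. -/
lemma IsFlatFamily.exists_module_schemeSupport (h : IsFlatFamily f F r) :
    ∃ (M : (schemeSupport F).Modules) (_ : F ≅ (Scheme.Modules.pushforward (schemeSupportι F)).obj M),
      IsFinite (schemeSupportι F ≫ f) ∧ IsFlatFamily (schemeSupportι F ≫ f) M r ∧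
      ∀ V : (schemeSupport F).Opens, IsAffineOpen V → ∀ t : Γ(schemeSupport F, V),
        (∀ m : Γ(M, V), t • m = 0) → t = 0 := by
  obtain ⟨M, κ, hM, ht⟩ := h.coherent.exists_module_schemeSupport
  have hl := (hasRelativeLength_iff (schemeSupportι F) f κ r).mp h.length
  exact ⟨M, κ, isFinite_of_finite_fibres _ (finite_fibre _ hl (fibreLengthAt_ne_zero _ hM ht)),
    ⟨hM, (isFlatOver_iff (schemeSupportι F) f κ).mp h.flat, hl⟩, ht⟩

/-- The push-forward of a flat family of relative length `r` is locally free of rank `r`. -/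
lemma IsFlatFamily.isLocallyFreeOfRank_pushforward [IsLocallyNoetherian X] (h : IsFlatFamily f F r) :
    IsLocallyFreeOfRank ((Scheme.Modules.pushforward f).obj F) r := by
  obtain ⟨M, κ, hfin, hM, -⟩ := h.exists_module_schemeSupport
  exact (AzumayaBrane.isLocallyFreeOfRank_pushforward hM.coherent hM.flat hM.length).of_iso
    (((Scheme.Modules.pushforward f).mapIso κ ≪≫
      (Scheme.Modules.pushforwardComp (schemeSupportι F) f).app M).symm)

end Finite

/-! ### The action of functions through an isomorphism with a push-forward -/

section Action
variable {Z X : Scheme.{u}} {π : Z ⟶ X} {M : Z.Modules} {E : X.Modules}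
  (ϑ : (Scheme.Modules.pushforward π).obj M ≅ E)

/-- The action of functions on `Z` on a sheaf isomorphic to a push-forward from `Z`. -/
def actOfIso : Act π E where
  act V :=
    { toFun := fun t => (ϑ.hom.app V).hom.comp
        ((Module.toAddMonoidEnd Γ(Z, π ⁻¹ᵁ V) Γ(M, π ⁻¹ᵁ V) t).comp (ϑ.inv.app V).hom)
      map_one' := AddMonoidHom.ext fun m =>
        (congrArg (ϑ.hom.app V) (one_smul Γ(Z, π ⁻¹ᵁ V) (show Γ(M, π ⁻¹ᵁ V) from ϑ.inv.app V m))).trans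
          (hom_app_inv_app ϑ V m)
      map_zero' := AddMonoidHom.ext fun m =>
        (congrArg (ϑ.hom.app V) (zero_smul Γ(Z, π ⁻¹ᵁ V)
          (show Γ(M, π ⁻¹ᵁ V) from ϑ.inv.app V m))).trans (map_zero (ϑ.hom.app V).hom)
      map_add' := fun s t => AddMonoidHom.ext fun m =>
        (congrArg (ϑ.hom.app V) (add_smul s t
          (show Γ(M, π ⁻¹ᵁ V) from ϑ.inv.app V m))).trans (map_add (ϑ.hom.app V).hom _ _)
      map_mul' := fun s t => AddMonoidHom.ext fun m =>
        (congrArg (ϑ.hom.app V) (mul_smul s t (show Γ(M, π ⁻¹ᵁ V) from ϑ.inv.app V m))).trans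
          (congrArg (fun y : Γ(M, π ⁻¹ᵁ V) => ϑ.hom.app V (show Γ(M, π ⁻¹ᵁ V) from s • y))
            (inv_app_hom_app ϑ V
              (show Γ(M, π ⁻¹ᵁ V) from t • (show Γ(M, π ⁻¹ᵁ V) from ϑ.inv.app V m))).symm) }
  res {V W} h t m := by
    refine (app_resSec ϑ.hom h _).symm.trans (congrArg (ϑ.hom.app W) ?_)
    refine (resSec_smul M (π.preimage_mono h) t _).trans ?_
    exact congrArg (fun y : Γ(M, π ⁻¹ᵁ W) => resFun (π.preimage_mono h) t • y)
      (app_resSec ϑ.inv h m).symm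

lemma actOfIso_hom_app (V : X.Opens) (t : Γ(Z, π ⁻¹ᵁ V)) (m : Γ(M, π ⁻¹ᵁ V)) :
    (actOfIso ϑ).act V t (ϑ.hom.app V m) = ϑ.hom.app V (show Γ(M, π ⁻¹ᵁ V) from t • m) :=
  congrArg (fun y : Γ(M, π ⁻¹ᵁ V) => ϑ.hom.app V (show Γ(M, π ⁻¹ᵁ V) from t • y))
    (inv_app_hom_app ϑ V m)

lemma actOfIso_app (V : X.Opens) (a : Γ(X, V)) (m : Γ(E, V)) :
    (actOfIso ϑ).act V (π.app V a) m = a • m := by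
  obtain ⟨m, rfl⟩ := (ConcreteCategory.bijective_of_isIso (ϑ.hom.app V)).2 m
  exact (actOfIso_hom_app ϑ V _ m).trans (ϑ.hom.app_smul a m)

lemma smul_eq_zero_of_actOfIso {V : X.Opens} {t : Γ(Z, π ⁻¹ᵁ V)}
    (h : ∀ m, (actOfIso ϑ).act V t m = 0) (m : Γ(M, π ⁻¹ᵁ V)) : t • m = 0 :=
  (ConcreteCategory.bijective_of_isIso (ϑ.hom.app V)).1
    ((actOfIso_hom_app ϑ V t m).symm.trans ((h _).trans (map_zero (ϑ.hom.app V).hom).symm))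

end Action

/-! ### From a flat family to a morphism -/

section Existence
variable {S X Y : Scheme.{u}} {sX : X ⟶ S} {sY : Y ⟶ S} {E : X.Modules} {r : ℕ}
  [IsLocallyNoetherian X] [IsProper sY]

/-- Every flat family is given by a morphism. -/
lemma IsFlatFamily.exists_corresponds (hE : IsLocallyFreeOfRank E r) {F : (pullback sX sY).Modules}
    (θ : (Scheme.Modules.pushforward (pullback.fst sX sY)).obj F ≅ E)
    (hF : IsFlatFamily (pullback.fst sX sY) F r) :
    ∃ φ : AzumayaMorphism sX sY E, Corresponds φ F θ := by
  obtain ⟨M, κ, hfin, hM, ht⟩ := hF.exists_module_schemeSupport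
  let i := schemeSupportι F
  let τ := i ≫ pullback.fst sX sY
  let ϑ : (Scheme.Modules.pushforward τ).obj M ≅ E :=
    (Scheme.Modules.pushforwardComp i (pullback.fst sX sY)).symm.app M ≪≫
      (Scheme.Modules.pushforward (pullback.fst sX sY)).mapIso κ.symm ≪≫ θ
  have : IsAffineHom τ := inferInstanceAs (IsAffineHom (schemeSupportι F ≫ pullback.fst sX sY))
  -- Faithfulness of `M` on the support makes the action on `E` faithful, so the support becomes the
  -- surrogate of a subalgebra `A`, with closed graph.
  obtain ⟨A, u, hu, hA, -⟩ := (actOfIso ϑ).exists_commSubalgebra (actOfIso_app ϑ) fun U hU t h =>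
    ht _ (hU.preimage τ) t (smul_eq_zero_of_actOfIso ϑ h)
  let p : Presentation sX sY E := ⟨A, u.hom ≫ i ≫ pullback.snd sX sY, by
    rw [Category.assoc, Category.assoc, ← pullback.condition, ← hu]
    simp only [τ, Category.assoc]⟩
  have hp : p.graph = u.hom ≫ i := by
    apply pullback.hom_ext
    · rw [p.graph_fst, Category.assoc]; exact hu.symm
    · rw [p.graph_snd, Category.assoc]
  have hw : u.inv ≫ p.graph = i := by rw [hp, Iso.inv_hom_id_assoc]
  have hle (U : X.Opens) : τ ⁻¹ᵁ U ≤ u.inv ⁻¹ᵁ (A.toBase ⁻¹ᵁ U) := by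
    rw [← (Iso.inv_comp_eq u).mpr hu.symm]; rfl
  have : IsClosedImmersion p.graph := by rw [hp]; infer_instance
  let κ' : F ≅ (Scheme.Modules.pushforward p.graph).obj ((Scheme.Modules.pushforward u.inv).obj M) :=
    κ ≪≫ (Scheme.Modules.pushforwardCongr hw.symm).app M ≪≫
      (Scheme.Modules.pushforwardComp u.inv p.graph).symm.app M
  -- Defined by solving the compatibility with `θ` for `η`, so that this compatibility is formal;
  -- what remains is that functions act as `A` acts on `E`.
  let η : (Scheme.Modules.pushforward p.alg.toBase).obj ((Scheme.Modules.pushforward u.inv).obj M) ≅ E :=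
    (Scheme.Modules.pushforwardCongr p.graph_fst).symm.app _ ≪≫
      (Scheme.Modules.pushforwardComp p.graph (pullback.fst sX sY)).symm.app _ ≪≫
      (Scheme.Modules.pushforward (pullback.fst sX sY)).mapIso κ'.symm ≪≫ θ
  have hη (U : X.Opens) (m : Γ(M, u.inv ⁻¹ᵁ (A.toBase ⁻¹ᵁ U))) :
      η.hom.app U m = ϑ.hom.app U (show Γ(M, τ ⁻¹ᵁ U) from resSec M (hle U) m) :=
    congrArg (ϑ.hom.app U) (resSec_resSec M _ _ m)
  refine ⟨p.toMorphism, p, Presentation.isCanonical_of_isClosedImmersion hE.isQuasicoherent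
    (fun U hU => hE.finite hU) p, _, η, κ', ⟨isQuasicoherent_pushforward _ M hM.coherent.1,
    fun U t m => ?_⟩, ?_⟩
  · have heval : (A.eval U t).1 = (actOfIso ϑ).toEndOn (actOfIso_app ϑ) U.1
        (u.inv.appLE (A.toBase ⁻¹ᵁ U.1) (τ ⁻¹ᵁ U.1) (hle U.1) t) := by
      refine Eq.trans ?_ (hA U _)
      rw [appLE_appLE, appLE_congr_hom u.hom_inv_id, appLE_id]
    refine Eq.trans ?_ (congrArg (fun s : EndOn E U.1 => s.1 ⟨U.1, le_rfl⟩ (η.hom.app U.1 m)) heval).symm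
    refine (hη U.1 _).trans (Eq.trans ?_ (((congrArg _ (hη U.1 m)).trans
      (actOfIso_hom_app ϑ U.1 (resFun le_rfl (u.inv.appLE (A.toBase ⁻¹ᵁ U.1) (τ ⁻¹ᵁ U.1) (hle U.1) t))
        (resSec M (hle U.1) m)))).symm)
    rw [resFun_self]
    exact congrArg (ϑ.hom.app U.1) (resSec_smul M (hle U.1) (u.inv.app _ t) m)
  · ext : 1
    simp [η]

end Existence

end AzumayaBrane

end

/-! ### The correspondence over the complex numbers -/

theorem lemma2p2p8 {X Y : Scheme.{0}} (sX : X ⟶ Spec (CommRingCat.of ℂ))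
    (sY : Y ⟶ Spec (CommRingCat.of ℂ)) [IsLocallyNoetherian X] [IsProper sY] (r : ℕ) :
    -- the push-forward to `X` of a flat family of relative length `r` is a fundamental module
    (∀ F : (pullback sX sY).Modules, IsFlatFamily (pullback.fst sX sY) F r →
      IsLocallyFreeOfRank ((Scheme.Modules.pushforward (pullback.fst sX sY)).obj F) r) ∧
    (∀ E : X.Modules, IsLocallyFreeOfRank E r →
      -- every morphism has a canonical presentation `(𝒜_φ, f_φ : X_φ ⟶ Y)`
      (∀ φ : AzumayaMorphism sX sY E, ∃! p : Presentation sX sY E, p.IsCanonical φ) ∧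
      -- every morphism is given by a sheaf on `X × Y`
      (∀ φ : AzumayaMorphism sX sY E, ∃ (F : (pullback sX sY).Modules)
        (θ : (Scheme.Modules.pushforward (pullback.fst sX sY)).obj F ≅ E), Corresponds φ F θ) ∧
      -- which is a flat family of relative length `r` with scheme-theoretic support `X_φ`
      (∀ (φ : AzumayaMorphism sX sY E) (F : (pullback sX sY).Modules)
        (θ : (Scheme.Modules.pushforward (pullback.fst sX sY)).obj F ≅ E), Corresponds φ F θ →
          IsFlatFamily (pullback.fst sX sY) F r ∧
          ∀ p : Presentation sX sY E, p.IsCanonical φ →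
            ∃ u : p.alg.surrogate ≅ schemeSupport F,
              u.hom ≫ schemeSupportι F ≫ pullback.fst sX sY = p.alg.toBase ∧
              u.hom ≫ schemeSupportι F ≫ pullback.snd sX sY = p.map) ∧
      -- every flat family of relative length `r` gives exactly one morphism
      (∀ (F : (pullback sX sY).Modules)
        (θ : (Scheme.Modules.pushforward (pullback.fst sX sY)).obj F ≅ E),
          IsFlatFamily (pullback.fst sX sY) F r →
            ∃! φ : AzumayaMorphism sX sY E, Corresponds φ F θ)) ∧
    -- isomorphisms of sheaves on `X × Y` are the same as isomorphisms of morphisms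
    (∀ E₁ E₂ : X.Modules, IsLocallyFreeOfRank E₁ r → IsLocallyFreeOfRank E₂ r →
      ∀ (φ₁ : AzumayaMorphism sX sY E₁) (φ₂ : AzumayaMorphism sX sY E₂)
        (F₁ F₂ : (pullback sX sY).Modules)
        (θ₁ : (Scheme.Modules.pushforward (pullback.fst sX sY)).obj F₁ ≅ E₁)
        (θ₂ : (Scheme.Modules.pushforward (pullback.fst sX sY)).obj F₂ ≅ E₂),
        Corresponds φ₁ F₁ θ₁ → Corresponds φ₂ F₂ θ₂ →
          (∀ g : F₁ ≅ F₂, IsMorphismIso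
            (θ₁.symm ≪≫ (Scheme.Modules.pushforward (pullback.fst sX sY)).mapIso g ≪≫ θ₂) φ₁ φ₂) ∧
          (∀ e : E₁ ≅ E₂, IsMorphismIso e φ₁ φ₂ → ∃! g : F₁ ≅ F₂,
            θ₁.symm ≪≫ (Scheme.Modules.pushforward (pullback.fst sX sY)).mapIso g ≪≫ θ₂ = e)) := by
  have hf {E : X.Modules} (hE : IsLocallyFreeOfRank E r) (U : X.Opens) (hU : IsAffineOpen U) :
      Module.Finite Γ(X, U) Γ(E, U) := hE.finite hU
  refine ⟨fun F hF => hF.isLocallyFreeOfRank_pushforward, fun E hE => ⟨fun φ => ?_, fun φ => ?_,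
    fun φ F θ h => ?_, fun F θ hF => ?_⟩, fun E₁ E₂ hE₁ hE₂ φ₁ φ₂ F₁ F₂ θ₁ θ₂ h₁ h₂ =>
    ⟨isMorphismIso_of_iso hE₁ hE₂ h₁ h₂, fun e he => IsMorphismIso.existsUnique_iso hE₁ hE₂ h₁ h₂ he⟩⟩
  · obtain ⟨p, -, hp⟩ := Presentation.exists_isCanonical hE.isQuasicoherent (hf hE) φ
    exact ⟨p, hp, fun q hq => hq.eq hp⟩
  · obtain ⟨p, -, hp⟩ := Presentation.exists_isCanonical hE.isQuasicoherent (hf hE) φ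
    exact hp.exists_corresponds hE.isQuasicoherent
  · obtain ⟨p, hp, M, η, κ, hM, -⟩ := h
    refine ⟨hp.isFlatFamily hE hM κ, fun q hq => ?_⟩
    obtain rfl := hq.eq hp
    exact hp.exists_iso_schemeSupport hE hM κ
  · obtain ⟨φ, h⟩ := hF.exists_corresponds hE θ
    exact ⟨φ, h, fun φ' h' => h'.eq hE h⟩
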